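/- Let $L$ be Lebesgue measure on $\mathbb C$. Let $\mathcal E$ (resp. $\widetilde{\mathcal E}$) be the space of functions $u(z)=e^{-|z|^2/2}f(z)$ with $f$ entire and $u\in L^2(\mathbb C)$ (resp. $u\in\mathscr S'(\mathbb C)$). Put $$[\Pi v](z)=\frac1\pi e^{-|z|^2/2}\int_{\mathbb C}e^{\overline w z-|w|^2/2}v(w)\,dL(w),$$ and consider the equation (LLL): $i\partial_tu=\Pi(|u|^2u)$ for $(t,z)\in\mathbb R\times\mathbb C$. An $M$-stationary wave is a solution of (LLL) of the form $u(t,z)=e^{-i\lambda t}u_0(z)$, and an $MP$-stationary wave is a solution of the form $u(t,z)=e^{-i\lambda t}u_0(e^{-i\mu t}z)$, where $\lambda,\mu\in\mathbb R$ and $u_0\in\widetilde{\mathcal E}$; such a wave is said to be in $\mathcal E$ (resp. $\widetilde{\mathcal E}\setminus\mathcal E$), or to have finitely many zeros, if $u(0,\cdot)$ is or does. "Modulo space and phase rotation" means up to replacing $u(t,z)$ by $e^{i\gamma}u(t,e^{i\theta}z)$ with $\gamma,\theta\in\mathbb R$ independent of $t$. Let $$\mathcal H(u)=\tfrac14\int|u|^4\,dL,\quad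 M(u)=\int|u|^2\,dL,\quad P(u)=\int(\Lambda u)\,\overline u\,dL,\quad Q(u)=\int z|u|^2\,dL,$$ with $\Lambda=z\partial_z-\overline z\,\partial_{\overline z}$; let $R_\alpha u(z)=u(z+\alpha)e^{\frac12(\overline z\alpha-z\overline\alpha)}$ and $\phi_n(z)=\frac1{\sqrt{\pi n!}}z^ne^{-|z|^2/2}$. **Theorem.** (i) The $M$-stationary waves in $\mathcal E$ with finitely many zeros and unit mass are exactly, modulo space and phase rotation, the functions $\phi_n^\alpha(z)e^{-i\lambda t}$, $n\in\mathbb N$ (including $n=0$), $\alpha\in\mathbb C$, where $$\phi_n^\alpha(z)=R_{-\overline\alpha}\phi_n(z)=\frac1{\sqrt{\pi n!}}(z-\overline\alpha)^ne^{-\frac{|z|^2}2-\frac{|\alpha|^2}2+\alpha z},\qquad\lambda=\frac{(2n)!}{\pi(n!)^22^{2n+1}}.$$ They satisfy $\mathcal H(\phi_n^\alpha)=\frac1{8\pi}\frac{(2n)!}{2^{2n}(n!)^2}$, $M(\phi_n^\alpha)=1$, $P(\phi_n^\alpha)=n+|\alpha|^2$, $Q(\phi_n^\alpha)=\overline\alpha$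 (all the integrals converging absolutely). (ii) The $MP$-stationary waves in $\mathcal E$ with finitely many zeros and unit mass are exactly, modulo space and phase rotation, those of (i) and the functions $\psi_b(e^{-i\mu t}z)e^{-i\lambda t}$, $b\in[0,\infty)$, where $$\psi_b(z)=\frac{e^{-\frac12\left(\frac b{1+b^2}\right)^2}}{\sqrt{\pi(1+b^2)}}\left(z-\frac{b(2+b^2)}{1+b^2}\right)e^{-\frac12|z|^2+\frac b{1+b^2}z},$$ $$\lambda=\frac1{8\pi(1+b^2)}\left(4b^2+3+\frac{b^2}{1+b^2}\right),\qquad\mu=-\frac1{8\pi}.$$ They satisfy $\mathcal H(\psi_b)=\frac1{8\pi}\left(1-\frac1{2(1+b^2)^2}\right)$, $M(\psi_b)=1$, $P(\psi_b)=\frac1{(1+b^2)^2}$, $Q(\psi_b)=0$ (all the integrals converging absolutely). (iii) The $M$-stationary waves in $\widetilde{\mathcal E}\setminus\mathcal E$ with finitely many zeros are exactly, modulo space and phase rotation, the functions $$A\,e^{-\frac12|z|^2+\frac12z^2+isz}\,e^{-i\lambda t},\qquad A\in\mathbb R\setminus\{0\},\ s\in\mathbb R,\ \lambda=\frac{A^2e^{s^2/2}}{\sqrt2}.$$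 (iv) The $MP$-stationary waves in $\widetilde{\mathcal E}\setminus\mathcal E$ with finitely many zeros are exactly, modulo space and phase rotation, those of (iii) and the functions $$A\,(e^{-i\mu t}z+ir)\,e^{-\frac12|z|^2+\frac12e^{-2i\mu t}z^2}\,e^{-i\lambda t},\qquad A\in\mathbb R\setminus\{0\},\ r\in\mathbb R,\ \lambda=\frac1{\sqrt2}\left(\tfrac32+r^2\right)A^2,\ \mu=\frac{A^2}{\sqrt2}.$$ -/

import Mathlib

open MeasureTheory

noncomputable section

namespace LLL

/-- `u(z) = e^{-|z|²/2} f(z)` with `f` entire. -/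
def IsGaussianHolomorphic (u : ℂ → ℂ) : Prop :=
  ∃ f : ℂ → ℂ, Differentiable ℂ f ∧ ∀ z : ℂ, u z = (Real.exp (-‖z‖ ^ 2 / 2) : ℂ) * f z

/-- The function `u` belongs to `𝒮'(ℂ)`: the distribution `φ ↦ ∫ φ u` on test functions is the
restriction of a tempered distribution (a continuous linear functional on the Schwartz space). -/
def IsTempered (u : ℂ → ℂ) : Prop :=
  ∃ T : SchwartzMap ℂ ℂ →L[ℂ] ℂ, ∀ φ : SchwartzMap ℂ ℂ, HasCompactSupport (φ : ℂ → ℂ) →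
    T φ = ∫ z : ℂ, φ z * u z

/-- The Bargmann–Fock space `ℰ` (lowest Landau level). -/
def fockSpace : Set (ℂ → ℂ) :=
  {u | IsGaussianHolomorphic u ∧ MemLp u 2 volume}

/-- The enlarged lowest Landau level space `ℰ̃`. -/
def enlargedFockSpace : Set (ℂ → ℂ) :=
  {u | IsGaussianHolomorphic u ∧ IsTempered u}

/-- `[Π v](z) = π⁻¹ e^{-|z|²/2} ∫ e^{w̄ z - |w|²/2} v(w) dL(w)`. For `v = |u|² u` with `u ∈ ℰ̃`, which
is of at most polynomial growth, this integral converges absolutely. -/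
def proj (v : ℂ → ℂ) (z : ℂ) : ℂ :=
  (1 / (Real.pi : ℂ)) * (Real.exp (-‖z‖ ^ 2 / 2) : ℂ) *
    ∫ w : ℂ, Complex.exp ((starRingEnd ℂ) w * z - ((‖w‖ ^ 2 / 2 : ℝ) : ℂ)) * v w

/-- The nonlinearity `Π(|u|² u)`. -/
def nonlin (u : ℂ → ℂ) : ℂ → ℂ :=
  proj fun w => ((‖u w‖ ^ 2 : ℝ) : ℂ) * u w

/-- Global solutions in `ℰ̃` of `i ∂ₜ u = Π(|u|² u)`. -/
def IsSolution (u : ℝ → ℂ → ℂ) : Prop :=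
  (∀ t, u t ∈ enlargedFockSpace) ∧
    ∀ t z, ∃ d : ℂ, HasDerivAt (fun s => u s z) d t ∧ Complex.I * d = nonlin (u t) z

/-- The function `(t, z) ↦ e^{-iλt} v(e^{-iμt} z)`. -/
def rotatingWave (lam mu : ℝ) (v : ℂ → ℂ) (t : ℝ) (z : ℂ) : ℂ :=
  Complex.exp (-Complex.I * lam * t) * v (Complex.exp (-Complex.I * mu * t) * z)

/-- `M`-stationary waves: solutions of the form `e^{-iλt} u₀(z)`, with `λ ∈ ℝ` and `u₀ ∈ ℰ̃`. -/
def IsMStationaryWave (u : ℝ → ℂ → ℂ) : Prop :=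
  IsSolution u ∧ ∃ lam : ℝ, ∃ u₀ ∈ enlargedFockSpace,
    ∀ t z, u t z = Complex.exp (-Complex.I * lam * t) * u₀ z

/-- `MP`-stationary waves: solutions of the form `e^{-iλt} u₀(e^{-iμt} z)`, with `λ, μ ∈ ℝ` and
`u₀ ∈ ℰ̃`. -/
def IsMPStationaryWave (u : ℝ → ℂ → ℂ) : Prop :=
  IsSolution u ∧ ∃ lam mu : ℝ, ∃ u₀ ∈ enlargedFockSpace, ∀ t z, u t z = rotatingWave lam mu u₀ t z

/-- The zero set of `v` is finite. -/
def HasFinitelyManyZeros (v : ℂ → ℂ) : Prop := {z : ℂ | v z = 0}.Finite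

/-- The phase rotation `T_γ`. -/
def phaseRot (γ : ℝ) (v : ℂ → ℂ) (z : ℂ) : ℂ := Complex.exp (Complex.I * γ) * v z

/-- The space rotation `L_θ`. -/
def spaceRot (θ : ℝ) (v : ℂ → ℂ) (z : ℂ) : ℂ := v (Complex.exp (Complex.I * θ) * z)

/-- The magnetic translation `R_α`. -/
def magTrans (α : ℂ) (v : ℂ → ℂ) (z : ℂ) : ℂ :=
  v (z + α) * Complex.exp (((starRingEnd ℂ) z * α - z * (starRingEnd ℂ) α) / 2)

/-- The time-dependent function `u` is obtained from `w` by a phase rotation and a space rotation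
(with angles independent of time). -/
def EqModRotations (u w : ℝ → ℂ → ℂ) : Prop :=
  ∃ γ θ : ℝ, ∀ t, u t = phaseRot γ (spaceRot θ (w t))

/-- The angular momentum operator `Λ = i (y ∂ₓ - x ∂_y) = z ∂_z - z̄ ∂_z̄`. -/
def angMom (v : ℂ → ℂ) (z : ℂ) : ℂ :=
  Complex.I * ((z.im : ℂ) * fderiv ℝ v z 1 - (z.re : ℂ) * fderiv ℝ v z Complex.I)

/-- The mass. -/
def mass (v : ℂ → ℂ) : ℝ := ∫ z : ℂ, ‖v z‖ ^ 2

/-- The Hamiltonian `¼ ∫ |v|⁴ dL`. -/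
def hamiltonian (v : ℂ → ℂ) : ℝ := (1 / 4) * ∫ z : ℂ, ‖v z‖ ^ 4

/-- The angular momentum `∫ (Λ v) v̄ dL`. -/
def angularMomentum (v : ℂ → ℂ) : ℂ := ∫ z : ℂ, angMom v z * (starRingEnd ℂ) (v z)

/-- The magnetic momentum `∫ z |v|² dL`. -/
def magneticMomentum (v : ℂ → ℂ) : ℂ := ∫ z : ℂ, z * ((‖v z‖ ^ 2 : ℝ) : ℂ)

/-- The integrals defining `ℋ(v)`, `M(v)`, `P(v)`, `Q(v)` converge absolutely and have the values
`H`, `M`, `P`, `Q`. -/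
structure HasConservedQuantities (v : ℂ → ℂ) (H M P : ℝ) (Q : ℂ) : Prop where
  integrable_H : Integrable fun z : ℂ => ‖v z‖ ^ 4
  integrable_M : Integrable fun z : ℂ => ‖v z‖ ^ 2
  integrable_P : Integrable fun z : ℂ => angMom v z * (starRingEnd ℂ) (v z)
  integrable_Q : Integrable fun z : ℂ => z * ((‖v z‖ ^ 2 : ℝ) : ℂ)
  hamiltonian_eq : hamiltonian v = H
  mass_eq : mass v = M
  angularMomentum_eq : angularMomentum v = (P : ℂ)
  magneticMomentum_eq : magneticMomentum v = Q

/-- The special Hermite function `φ_n(z) = (π n!)^{-1/2} zⁿ e^{-|z|²/2}`. -/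
def phi (n : ℕ) (z : ℂ) : ℂ :=
  ((1 / Real.sqrt (Real.pi * n.factorial) : ℝ) : ℂ) * z ^ n * (Real.exp (-‖z‖ ^ 2 / 2) : ℂ)

/-- `φ_n^α = R_{-ᾱ} φ_n`. -/
def phiShift (n : ℕ) (α : ℂ) : ℂ → ℂ := magTrans (-(starRingEnd ℂ) α) (phi n)

/-- The frequency of `φ_n^α`. -/
def phiFreq (n : ℕ) : ℝ :=
  ((2 * n).factorial : ℝ) / (Real.pi * (n.factorial : ℝ) ^ 2 * 2 ^ (2 * n + 1))

/-- The profile `ψ_b`. -/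
def psi (b : ℝ) (z : ℂ) : ℂ :=
  ((Real.exp (-(b / (1 + b ^ 2)) ^ 2 / 2) / Real.sqrt (Real.pi * (1 + b ^ 2)) : ℝ) : ℂ) *
    (z - ((b * (2 + b ^ 2) / (1 + b ^ 2) : ℝ) : ℂ)) *
    Complex.exp (-((‖z‖ ^ 2 / 2 : ℝ) : ℂ) + ((b / (1 + b ^ 2) : ℝ) : ℂ) * z)

/-- The phase frequency `λ` of the wave with profile `ψ_b`. -/
def psiFreq (b : ℝ) : ℝ :=
  1 / (8 * Real.pi * (1 + b ^ 2)) * (4 * b ^ 2 + 3 + b ^ 2 / (1 + b ^ 2))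

/-- The profile `A e^{-|z|²/2 + z²/2 + isz}`. -/
def expProfile (A s : ℝ) (z : ℂ) : ℂ :=
  (A : ℂ) * Complex.exp (-((‖z‖ ^ 2 / 2 : ℝ) : ℂ) + z ^ 2 / 2 + Complex.I * s * z)

/-- The profile `A (z + ir) e^{-|z|²/2 + z²/2}`. -/
def linProfile (A r : ℝ) (z : ℂ) : ℂ :=
  (A : ℂ) * (z + Complex.I * r) * Complex.exp (-((‖z‖ ^ 2 / 2 : ℝ) : ℂ) + z ^ 2 / 2)

end LLL

end

/-! ### Polynomial growth of the enlarged Fock space -/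

noncomputable section

namespace LLL

/-! A wave `e^{-iλt} v(e^{-iμt} z)` solves the equation exactly when its profile solves `λ v + μ Λ v
= Π(|v|² v)`; for `v = e^{-|z|²/2} f` one has `Λ v = e^{-|z|²/2} z f'`, so this is an identity
between holomorphic functions (`IsProfile`, `isMPStationaryWave_iff`). Everything is then a
classification of profiles.

Temperedness forces polynomial growth of `v` (`exists_polynomial_bound`), so `f` is entire of
Gaussian growth with finitely many zeros. Hadamard's factorization leaves `f = P e^{az²/2 + bz}`
with `P` a polynomial (`exists_eq_polynomial_mul_exp`). A space rotation makes `a ≥ 0`, and growth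
along the real axis forces `a ≤ 1`, with `b` imaginary when `a = 1` (`gaussProfile_growth`). For
such `v` the integral defining `Π(|v|² v)` is a Gaussian moment, computable in closed form: a
polynomial times the exponential of an explicit quadratic (`moment_eq`, `nonlin_gaussProfile`).

If `a > 0`, the two exponentials must agree up to a constant, which gives `a = 2a / (4 - 2a²)`, so
`a = 1`. The right-hand polynomial then has degree exactly `3 deg P` and the left-hand one at most
`deg P + 2`, so `deg P ≤ 1` (`eq_one_of_isProfile`). Comparing four coefficients yields the
exponential and the linear family (`classification_of_pos`). These do not decay along the real
direction, hence lie outside `L²`.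

If `a = 0`, a magnetic translation, which commutes with the nonlinearity, writes `v` as a translate
of `Q(z) e^{-|z|²/2}`, and the equation becomes a polynomial identity. Let `n` be the degree of `Q`
and `m` its order of vanishing at `0`. The right side has a nonzero coefficient of degree `2n - m`,
while the left side has degree at most `n + 1`, so `m ≥ n - 1`. The case `m = n` gives the
monomials. The case `m = n - 1 = 0` gives, after solving for `b`, `μ`, `λ`, the family `ψ_b`. The
case `m = n - 1 ≥ 1` is excluded by comparing the coefficients of degree `n + 1` and `m - 1`, which
leads to a false identity between factorials (`classification_of_zero`). All these profiles are in
`L²`, so membership in `ℰ` separates the cases `a = 0` and `a = 1`; the conserved quantities follow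
from the orthogonality of monomials for the Gaussian weight. -/

/-- The mean value property of entire functions against radial weights. -/
theorem integral_radial_mul_eq {ρ : ℝ → ℝ} (hρ : Continuous ρ) (hρ1 : ∀ r, 1 ≤ r → ρ r = 0)
    {g : ℂ → ℂ} (hg : Differentiable ℂ g) :
    ∫ w : ℂ, (ρ ‖w‖ : ℂ) * g w = (∫ w : ℂ, (ρ ‖w‖ : ℂ)) * g 0 := by
  have key : ∀ h : ℂ → ℂ, Differentiable ℂ h →
      ∫ w : ℂ, (ρ ‖w‖ : ℂ) * h w =
        (∫ r in Set.Ioi (0 : ℝ), (r * ρ r * (2 * Real.pi) : ℂ)) * h 0 := by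
    intro h hh
    rw [← Complex.integral_comp_polarCoord_symm]
    have hc : Continuous fun p : ℝ × ℝ => p.1 • ((ρ p.1 : ℂ) *
        h (p.1 * Complex.exp (p.2 * Complex.I))) := by
      have := hh.continuous
      fun_prop
    have e1 : ∀ p ∈ Set.Ioi (0 : ℝ) ×ˢ Set.Ioo (-Real.pi) Real.pi,
        p.1 • ((ρ ‖Complex.polarCoord.symm p‖ : ℂ) * h (Complex.polarCoord.symm p)) =
        p.1 • ((ρ p.1 : ℂ) * h (p.1 * Complex.exp (p.2 * Complex.I))) := by
      rintro ⟨r, θ⟩ ⟨hr, -⟩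
      have hr : 0 < r := hr
      simp only [Complex.polarCoord_symm_apply]
      push_cast
      rw [← Complex.exp_mul_I, norm_mul, Complex.norm_exp_ofReal_mul_I]
      simp [abs_of_pos hr]
    rw [polarCoord_target, setIntegral_congr_fun (measurableSet_Ioi.prod measurableSet_Ioo) e1,
      Measure.volume_eq_prod, setIntegral_prod]
    · rw [← integral_mul_const]
      refine setIntegral_congr_fun measurableSet_Ioi fun r hr => ?_
      have hr : 0 < r := hr
      simp only [Complex.real_smul]
      rw [integral_const_mul, integral_const_mul, ← integral_Ioc_eq_integral_Ioo,
        ← intervalIntegral.integral_of_le (by linarith [Real.pi_pos])]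
      have hm := (hh.diffContOnCl (s := Metric.ball 0 |r|)).circleAverage
      rw [Real.circleAverage_eq_integral_add (-Real.pi)] at hm
      rw [intervalIntegral.integral_comp_add_right (fun θ => h (circleMap 0 r θ))] at hm
      rw [show (0 : ℝ) + -Real.pi = -Real.pi by ring,
        show 2 * Real.pi + -Real.pi = Real.pi by ring] at hm
      simp only [circleMap, zero_add, Complex.real_smul] at hm
      rw [← hm]
      generalize (∫ x in -Real.pi..Real.pi, h (r * Complex.exp (x * Complex.I))) = J
      have : (Real.pi : ℂ) ≠ 0 := by exact_mod_cast Real.pi_ne_zero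
      push_cast
      field_simp
    · refine IntegrableOn.of_forall_sdiff_eq_zero (s := Set.Icc (0 : ℝ) 1 ×ˢ
        Set.Icc (-Real.pi) Real.pi) ?_ (measurableSet_Ioi.prod measurableSet_Ioo) ?_
      · exact hc.continuousOn.integrableOn_compact (isCompact_Icc.prod isCompact_Icc)
      · rintro ⟨r, θ⟩ ⟨⟨hr, hθ⟩, hn⟩
        have hr : 0 < r := hr
        have : 1 ≤ r := by
          by_contra! hlt
          exact hn ⟨⟨hr.le, hlt.le⟩, Set.Ioo_subset_Icc_self hθ⟩
        simp [hρ1 r this]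
  have h1 := key (fun _ => 1) (by fun_prop)
  simp only [mul_one] at h1
  rw [key g hg, h1]

/-- A smooth radial cutoff. -/
def cutoff (w : ℂ) : ℂ := (Real.smoothTransition (1 - ‖w‖ ^ 2) : ℝ)

theorem contDiff_cutoff : ContDiff ℝ (⊤ : ℕ∞) cutoff := by
  unfold cutoff
  have h1 : ContDiff ℝ (⊤ : ℕ∞) fun w : ℂ => Real.smoothTransition (1 - ‖w‖ ^ 2) :=
    Real.smoothTransition.contDiff.comp (contDiff_const.sub (contDiff_norm_sq ℝ))
  exact Complex.ofRealCLM.contDiff.comp h1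

theorem cutoff_eq_zero {w : ℂ} (hw : 1 ≤ ‖w‖) : cutoff w = 0 := by
  unfold cutoff
  rw [Real.smoothTransition.zero_of_nonpos]
  · simp
  · nlinarith

theorem hasCompactSupport_cutoff : HasCompactSupport cutoff :=
  HasCompactSupport.of_support_subset_isCompact (isCompact_closedBall 0 1) fun w hw => by
    by_contra h
    refine hw (cutoff_eq_zero ?_)
    simp at h
    exact h.le

/-- The smooth radial cutoff as a Schwartz function. -/
def cutoffS : SchwartzMap ℂ ℂ := hasCompactSupport_cutoff.toSchwartzMap contDiff_cutoff

/-- The real linear form `w ↦ Im (z w̄)`. -/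
def twistForm (z : ℂ) : ℂ →L[ℝ] ℝ :=
  Complex.imCLM ∘L ((ContinuousLinearMap.mul ℝ ℂ z) ∘L (Complex.conjCLE : ℂ →L[ℝ] ℂ))

theorem twistForm_apply (z w : ℂ) : twistForm z w = (z * (starRingEnd ℂ) w).im := rfl

theorem norm_twistForm_le (z : ℂ) : ‖twistForm z‖ ≤ ‖z‖ := by
  refine ContinuousLinearMap.opNorm_le_bound _ (norm_nonneg _) fun w => ?_
  rw [twistForm_apply]
  refine (Complex.abs_im_le_norm _).trans ?_
  simp

theorem contDiff_expI : ContDiff ℝ (⊤ : ℕ∞) fun x : ℝ => Complex.exp (Complex.I * (x : ℂ)) :=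
  (contDiff_const.mul Complex.ofRealCLM.contDiff).cexp

/-- Each derivative of `e^{ix}` is unimodular, and composing with `L` costs one factor `‖L‖` per
order. -/
theorem norm_iteratedFDeriv_expI_comp_le (L : ℂ →L[ℝ] ℝ) (n : ℕ) (w : ℂ) :
    ‖iteratedFDeriv ℝ n (fun w => Complex.exp (Complex.I * (L w : ℂ))) w‖ ≤ ‖L‖ ^ n := by
  have h := L.iteratedFDeriv_comp_right contDiff_expI w (i := n) (by exact_mod_cast le_top)
  have h' : (fun w => Complex.exp (Complex.I * (L w : ℂ))) =
    (fun x : ℝ => Complex.exp (Complex.I * (x : ℂ))) ∘ L := rfl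
  rw [h', h]
  refine (ContinuousMultilinearMap.norm_compContinuousLinearMap_le _ _).trans ?_
  rw [norm_iteratedFDeriv_eq_norm_iteratedDeriv]
  have e : iteratedDeriv n (fun x : ℝ => Complex.exp (Complex.I * (x : ℂ))) =
      fun x : ℝ => Complex.I ^ n * Complex.exp (Complex.I * (x : ℂ)) := by
    induction n with
    | zero => simp
    | succ n ih =>
      rw [iteratedDeriv_succ, ih (L.iteratedFDeriv_comp_right contDiff_expI w (by exact_mod_cast le_top))]
      ext x
      have : HasDerivAt (fun x : ℝ => Complex.I ^ n * Complex.exp (Complex.I * (x : ℂ)))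
          (Complex.I ^ n * (Complex.exp (Complex.I * (x : ℂ)) * (Complex.I * 1))) x :=
        (((hasDerivAt_id _).ofReal_comp.const_mul _).cexp).const_mul _
      rw [this.deriv]
      ring
  rw [e]
  simp [mul_comm Complex.I, Complex.norm_exp_ofReal_mul_I]

/-- The cutoff translated and modulated. -/
def twistedCutoff (z w : ℂ) : ℂ :=
  cutoff (w - z) * Complex.exp (Complex.I * (twistForm z w : ℂ))

theorem contDiff_twistedCutoff (z : ℂ) : ContDiff ℝ (⊤ : ℕ∞) (twistedCutoff z) := by
  unfold twistedCutoff
  refine (contDiff_cutoff.comp (by fun_prop)).mul ?_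
  exact contDiff_expI.comp (twistForm z).contDiff

theorem hasCompactSupport_twistedCutoff (z : ℂ) : HasCompactSupport (twistedCutoff z) := by
  refine HasCompactSupport.of_support_subset_isCompact (isCompact_closedBall z 1) fun w hw => ?_
  by_contra h
  refine hw ?_
  simp only [Metric.mem_closedBall, not_le, dist_eq_norm] at h
  simp [twistedCutoff, cutoff_eq_zero h.le]

/-- The twisted cutoff as a Schwartz function. -/
def twistedCutoffS (z : ℂ) : SchwartzMap ℂ ℂ :=
  (hasCompactSupport_twistedCutoff z).toSchwartzMap (contDiff_twistedCutoff z)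

theorem coe_twistedCutoffS (z : ℂ) : ⇑(twistedCutoffS z) = twistedCutoff z := rfl

/-- By the Leibniz rule, moving the cutoff to `z` costs `(1 + |z|)^k` in the weight, and modulating
it at frequency of size `|z|` costs at most `(1 + |z|)^n` in the derivatives. -/
theorem seminorm_twistedCutoffS_le (k n : ℕ) : ∃ C : ℝ, 0 ≤ C ∧ ∀ z : ℂ,
    SchwartzMap.seminorm ℂ k n (twistedCutoffS z) ≤ C * (1 + ‖z‖) ^ (k + n) := by
  set M : ℝ := 2 ^ k * ((Finset.Iic (k, n)).sup fun m => SchwartzMap.seminorm ℂ m.1 m.2) cutoffS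
    with hM
  have hM0 : 0 ≤ M := by positivity
  refine ⟨∑ i ∈ Finset.range (n + 1), (n.choose i : ℝ) * M, by positivity, fun z => ?_⟩
  refine SchwartzMap.seminorm_le_bound ℂ k n _ (by positivity) fun w => ?_
  have h1 : ‖iteratedFDeriv ℝ n (twistedCutoffS z) w‖ ≤ ∑ i ∈ Finset.range (n + 1),
      (n.choose i : ℝ) * ‖iteratedFDeriv ℝ i (fun w => cutoff (w - z)) w‖ *
        ‖iteratedFDeriv ℝ (n - i) (fun w => Complex.exp (Complex.I * (twistForm z w : ℂ))) w‖ := by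
    refine norm_iteratedFDeriv_mul_le (N := (⊤ : ℕ∞)) ?_ ?_ w (by exact_mod_cast le_top)
    · exact contDiff_cutoff.comp (by fun_prop)
    · exact contDiff_expI.comp (twistForm z).contDiff
  have hw : ‖w‖ ≤ (1 + ‖z‖) * (1 + ‖w - z‖) := by
    have : ‖w‖ ≤ ‖w - z‖ + ‖z‖ := by simpa using norm_add_le (w - z) z
    nlinarith [norm_nonneg z, norm_nonneg (w - z)]
  calc ‖w‖ ^ k * ‖iteratedFDeriv ℝ n (twistedCutoffS z) w‖
      ≤ ((1 + ‖z‖) * (1 + ‖w - z‖)) ^ k * ∑ i ∈ Finset.range (n + 1),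
      (n.choose i : ℝ) * ‖iteratedFDeriv ℝ i (fun w => cutoff (w - z)) w‖ *
        ‖iteratedFDeriv ℝ (n - i) (fun w => Complex.exp (Complex.I * (twistForm z w : ℂ))) w‖ := by
        gcongr
    _ ≤ _ := by
      rw [Finset.mul_sum, Finset.sum_mul]
      refine Finset.sum_le_sum fun i hi => ?_
      have hi : i ≤ n := by simpa [Nat.lt_succ_iff] using hi
      have h2 : (1 + ‖w - z‖) ^ k * ‖iteratedFDeriv ℝ i cutoff (w - z)‖ ≤ M :=
        SchwartzMap.one_add_le_sup_seminorm_apply (m := (k, n)) le_rfl hi cutoffS (w - z)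
      have h3 : ‖iteratedFDeriv ℝ (n - i)
          (fun w => Complex.exp (Complex.I * (twistForm z w : ℂ))) w‖ ≤ (1 + ‖z‖) ^ n := by
        refine (norm_iteratedFDeriv_expI_comp_le _ _ _).trans ?_
        calc ‖twistForm z‖ ^ (n - i) ≤ (1 + ‖z‖) ^ (n - i) := by
              gcongr
              linarith [norm_twistForm_le z]
          _ ≤ (1 + ‖z‖) ^ n := pow_le_pow_right₀ (by linarith [norm_nonneg z]) (by omega)
      rw [iteratedFDeriv_comp_sub]
      calc _ = (n.choose i : ℝ) * ((1 + ‖w - z‖) ^ k * ‖iteratedFDeriv ℝ i cutoff (w - z)‖) *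
            ((1 + ‖z‖) ^ k * ‖iteratedFDeriv ℝ (n - i)
          (fun w => Complex.exp (Complex.I * (twistForm z w : ℂ))) w‖) := by rw [mul_pow]; ring
        _ ≤ (n.choose i : ℝ) * M * ((1 + ‖z‖) ^ k * (1 + ‖z‖) ^ n) := by gcongr
        _ = _ := by ring

/-- The modulation is designed so that, after translation by `z`, the factor `e^{i Im(z w̄)}
e^{-|w+z|²/2}` is the centred Gaussian times a holomorphic function of `w`. The mean value property
then evaluates the integral at the centre, so pairing with the twisted cutoff reads off a fixed
multiple of `u(z)`. -/
theorem integral_twistedCutoff_mul {f : ℂ → ℂ} (hf : Differentiable ℂ f) (z : ℂ) :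
    ∫ w : ℂ, twistedCutoff z w * ((Real.exp (-‖w‖ ^ 2 / 2) : ℂ) * f w) =
      (∫ w : ℂ, ((Real.smoothTransition (1 - ‖w‖ ^ 2) * Real.exp (-‖w‖ ^ 2 / 2) : ℝ) : ℂ)) *
        ((Real.exp (-‖z‖ ^ 2 / 2) : ℂ) * f z) := by
  have h := integral_radial_mul_eq
    (ρ := fun r => Real.smoothTransition (1 - r ^ 2) * Real.exp (-r ^ 2 / 2))
    (by have := Real.smoothTransition.continuous; fun_prop)
    (fun r hr => by rw [Real.smoothTransition.zero_of_nonpos (by nlinarith), zero_mul])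
    (g := fun w => Complex.exp (‖z‖ ^ 2 / 2 - (starRingEnd ℂ) z * (w + z)) * f (w + z))
    (by fun_prop)
  have e : ∀ v : ℂ, (‖v‖ ^ 2 : ℂ) = v * (starRingEnd ℂ) v := fun v => by
    rw [Complex.mul_conj, Complex.normSq_eq_norm_sq]; push_cast; rfl
  have h0 : Complex.exp (‖z‖ ^ 2 / 2 - (starRingEnd ℂ) z * (0 + z)) * f (0 + z) =
      (Real.exp (-‖z‖ ^ 2 / 2) : ℂ) * f z := by
    push_cast
    rw [zero_add, e]
    congr 2
    ring
  rw [h0] at h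
  rw [← h, ← integral_add_right_eq_self _ z]
  refine integral_congr_ae (Filter.Eventually.of_forall fun w => ?_)
  simp only [twistedCutoff, cutoff, add_sub_cancel_right, twistForm_apply]
  have h5 : ((z * (starRingEnd ℂ) (w + z)).im : ℂ) * Complex.I =
      (z * (starRingEnd ℂ) w - (starRingEnd ℂ) z * w) / 2 := by
    apply Complex.ext <;> simp <;> ring
  rw [mul_comm Complex.I, h5]
  push_cast
  have h6 : Complex.exp ((z * (starRingEnd ℂ) w - (starRingEnd ℂ) z * w) / 2) *
      Complex.exp (-(‖w + z‖ : ℂ) ^ 2 / 2) = Complex.exp (-(‖w‖ : ℂ) ^ 2 / 2) *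
      Complex.exp ((‖z‖ : ℂ) ^ 2 / 2 - (starRingEnd ℂ) z * (w + z)) := by
    rw [← Complex.exp_add, ← Complex.exp_add, e, e, e]
    congr 1
    simp only [map_add]
    ring
  linear_combination (Real.smoothTransition (1 - ‖w‖ ^ 2) : ℂ) * f (w + z) * h6

theorem integral_cutoff_gauss_ne_zero :
    (∫ w : ℂ, ((Real.smoothTransition (1 - ‖w‖ ^ 2) * Real.exp (-‖w‖ ^ 2 / 2) : ℝ) : ℂ)) ≠ 0 := by
  rw [integral_complex_ofReal]
  have hc : Continuous fun w : ℂ => Real.smoothTransition (1 - ‖w‖ ^ 2) *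
      Real.exp (-‖w‖ ^ 2 / 2) := by
    have := Real.smoothTransition.continuous
    fun_prop
  have := hc.integral_pos_of_hasCompactSupport_nonneg_nonzero (μ := volume) (x := 0) ?_ ?_ ?_
  · exact_mod_cast this.ne'
  · refine HasCompactSupport.of_support_subset_isCompact (isCompact_closedBall 0 1) fun w hw => ?_
    by_contra h
    simp at h
    exact hw (by simp only; rw [Real.smoothTransition.zero_of_nonpos (by nlinarith), zero_mul])
  · exact fun w => mul_nonneg (Real.smoothTransition.nonneg _) (Real.exp_pos _).le
  · simp [Real.smoothTransition.one_of_one_le]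

/-- Elements of `ℰ̃` have at most polynomial growth. -/
theorem exists_polynomial_bound {u : ℂ → ℂ} (hu : u ∈ enlargedFockSpace) :
    ∃ (C : ℝ) (N : ℕ), 0 < C ∧ ∀ z, ‖u z‖ ≤ C * (1 + ‖z‖) ^ N := by
  obtain ⟨⟨f, hf, hfu⟩, T, hT⟩ := hu
  obtain ⟨s, C, -, hC⟩ := Seminorm.bound_of_continuous (schwartz_withSeminorms ℂ ℂ ℂ)
    ((normSeminorm ℂ ℂ).comp (T : SchwartzMap ℂ ℂ →ₗ[ℂ] ℂ)) (continuous_norm.comp T.continuous)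
  choose D hD0 hD using seminorm_twistedCutoffS_le
  set K := ∫ w : ℂ, ((Real.smoothTransition (1 - ‖w‖ ^ 2) * Real.exp (-‖w‖ ^ 2 / 2) : ℝ) : ℂ)
    with hK
  have hK0 : 0 < ‖K‖ := norm_pos_iff.2 integral_cutoff_gauss_ne_zero
  -- Continuity of `T` involves only the finitely many seminorms in `s`, each growing like `(1 +
  -- |z|)^(k+n)` on the twisted cutoffs; the largest exponent is the growth order of `u`.
  set N := s.sup fun m => m.1 + m.2 with hN
  set B : ℝ := ∑ m ∈ s, D m.1 m.2 with hB
  have hB0 : 0 ≤ B := Finset.sum_nonneg fun m _ => hD0 _ _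
  refine ⟨(C * B + 1) / ‖K‖, N, by positivity, fun z => ?_⟩
  have h1 : T (twistedCutoffS z) = K * u z := by
    have h0 := hT (twistedCutoffS z) (by
      rw [coe_twistedCutoffS]; exact hasCompactSupport_twistedCutoff z)
    rw [h0, hfu z, hK, ← integral_twistedCutoff_mul hf z, coe_twistedCutoffS]
    simp only [hfu]
  have hz1 : (1 : ℝ) ≤ 1 + ‖z‖ := by linarith [norm_nonneg z]
  have h2 : (s.sup (schwartzSeminormFamily ℂ ℂ ℂ)) (twistedCutoffS z) ≤ B * (1 + ‖z‖) ^ N := by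
    refine Seminorm.finset_sup_apply_le (by positivity) fun m hm => ?_
    refine (hD m.1 m.2 z).trans ?_
    gcongr
    · exact Finset.single_le_sum (f := fun m => D m.1 m.2) (fun m _ => hD0 _ _) hm
    · exact Finset.le_sup (f := fun m : ℕ × ℕ => m.1 + m.2) hm
  have h3 : ‖T (twistedCutoffS z)‖ ≤ C * (s.sup (schwartzSeminormFamily ℂ ℂ ℂ)) (twistedCutoffS z) :=
    hC (twistedCutoffS z)
  rw [h1, norm_mul] at h3
  rw [div_mul_eq_mul_div, le_div_iff₀ hK0]
  calc ‖u z‖ * ‖K‖ = ‖K‖ * ‖u z‖ := mul_comm _ _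
    _ ≤ C * (B * (1 + ‖z‖) ^ N) := h3.trans (by gcongr)
    _ ≤ (C * B + 1) * (1 + ‖z‖) ^ N := by nlinarith [pow_pos (lt_of_lt_of_le one_pos hz1) N]

/-- Continuous functions of polynomial growth are tempered. -/
theorem isTempered_of_bound {u : ℂ → ℂ} (hu : Continuous u) {C : ℝ} {N : ℕ} (hC : 0 ≤ C)
    (hb : ∀ z, ‖u z‖ ≤ C * (1 + ‖z‖) ^ N) : IsTempered u := by
  have hint : Integrable fun z : ℂ => (1 + ‖z‖) ^ (-(3 : ℝ)) :=
    integrable_one_add_norm (by rw [Complex.finrank_real_complex]; norm_num)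
  -- Beyond the `N` powers that compensate the growth of `u`, three more make the weight integrable
  -- on a real plane.
  set m : ℕ × ℕ := (N + 3, 0)
  have hpt : ∀ (φ : SchwartzMap ℂ ℂ) (z : ℂ), ‖φ z * u z‖ ≤
      (C * (2 ^ (N + 3) * ((Finset.Iic m).sup (schwartzSeminormFamily ℂ ℂ ℂ)) φ)) *
        (1 + ‖z‖) ^ (-(3 : ℝ)) := by
    intro φ z
    have h := SchwartzMap.one_add_le_sup_seminorm_apply (𝕜 := ℂ) (m := m) le_rfl le_rfl φ z
    rw [norm_iteratedFDeriv_zero] at h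
    have hz : (0 : ℝ) < 1 + ‖z‖ := by positivity
    have e : (1 + ‖z‖) ^ (-(3 : ℝ)) = ((1 + ‖z‖) ^ 3)⁻¹ := by
      rw [Real.rpow_neg hz.le]; norm_cast
    rw [e, ← div_eq_mul_inv, le_div_iff₀ (by positivity), norm_mul]
    calc ‖φ z‖ * ‖u z‖ * (1 + ‖z‖) ^ 3 ≤ ‖φ z‖ * (C * (1 + ‖z‖) ^ N) * (1 + ‖z‖) ^ 3 := by
          gcongr; exact hb z
      _ = C * ((1 + ‖z‖) ^ (N + 3) * ‖φ z‖) := by ring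
      _ ≤ _ := mul_le_mul_of_nonneg_left h hC
  have hφ : ∀ φ : SchwartzMap ℂ ℂ, Integrable fun z => φ z * u z := fun φ =>
    Integrable.mono' (hint.const_mul _) (φ.continuous.mul hu).aestronglyMeasurable
      (Filter.Eventually.of_forall (hpt φ))
  refine ⟨SchwartzMap.mkCLMtoNormedSpace (σ := RingHom.id ℂ) (fun φ => ∫ z, φ z * u z) ?_ ?_
    ⟨Finset.Iic m, C * 2 ^ (N + 3) * ∫ z : ℂ, (1 + ‖z‖) ^ (-(3 : ℝ)), ?_, fun φ => ?_⟩,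
    fun φ _ => rfl⟩
  · intro φ ψ
    rw [← integral_add (hφ φ) (hφ ψ)]
    simp [add_mul]
  · intro a φ
    simp only [smul_apply, smul_eq_mul, RingHom.id_apply]
    rw [← integral_const_mul]
    simp [mul_assoc]
  · have : 0 ≤ ∫ z : ℂ, (1 + ‖z‖) ^ (-(3 : ℝ)) := integral_nonneg fun z => by positivity
    positivity
  · refine (norm_integral_le_of_norm_le (hint.const_mul _)
      (Filter.Eventually.of_forall (hpt φ))).trans (le_of_eq ?_)
    rw [integral_const_mul]
    ring

end LLL

end

/-! ### Hadamard factorization for Gaussian growth and finitely many zeros -/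

noncomputable section

namespace LLL

open Polynomial in
/-- An entire function with finitely many zeros is a polynomial times a nonvanishing entire
function. -/
theorem exists_polynomial_mul_nonvanishing (s : Finset ℂ) : ∀ f : ℂ → ℂ, Differentiable ℂ f →
    {z | f z = 0} = (s : Set ℂ) → ∃ (P : ℂ[X]) (g : ℂ → ℂ), P ≠ 0 ∧ Differentiable ℂ g ∧
      (∀ z, g z ≠ 0) ∧ ∀ z, f z = P.eval z * g z := by
  induction s using Finset.induction_on with
  | empty =>
    intro f hf hs
    refine ⟨1, f, one_ne_zero, hf, fun z hz => ?_, fun z => by simp⟩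
    have : z ∈ {z | f z = 0} := hz
    simp [hs] at this
  | insert z₀ s hz₀ ih =>
    intro f hf hs
    obtain ⟨p, hp⟩ := hf.analyticAt z₀
    have hp0 : p ≠ 0 := by
      intro h0
      have h1 := hp.locally_zero_iff.2 h0
      have h2 : {z | f z = 0}.Infinite :=
        infinite_of_mem_nhds z₀ h1
      rw [hs] at h2
      exact h2 (Finset.finite_toSet _)
    -- Iterated divided differences divide out the whole zero at `z₀`, multiplicity included, so the
    -- zero set of the quotient loses exactly this point.
    set g := (Function.swap dslope z₀)^[p.order] f with hg
    have hgd : ∀ n, Differentiable ℂ ((Function.swap dslope z₀)^[n] f) := by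
      intro n
      induction n with
      | zero => simpa using hf
      | succ n ihn =>
        rw [Function.iterate_succ_apply', ← differentiableOn_univ]
        exact (Complex.differentiableOn_dslope Filter.univ_mem).2 ihn.differentiableOn
    have hfg : ∀ z, f z = (z - z₀) ^ p.order * g z := hp.eq_pow_order_mul_iterate_dslope
    have hg0 : g z₀ ≠ 0 := hp.iterate_dslope_fslope_ne_zero hp0
    have hz0 : f z₀ = 0 := by
      have : z₀ ∈ {z | f z = 0} := by rw [hs]; simp
      exact this
    have hord : p.order ≠ 0 := by
      intro h
      rw [hfg, h] at hz0
      simp [hg0] at hz0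
    have hgs : {z | g z = 0} = (s : Set ℂ) := by
      ext z
      have hm : f z = 0 ↔ z = z₀ ∨ z ∈ s := by
        have : z ∈ {z | f z = 0} ↔ z ∈ ((insert z₀ s : Finset ℂ) : Set ℂ) := by rw [hs]
        simpa using this
      by_cases h : z = z₀
      · simp [h, hg0, hz₀]
      · rw [hfg] at hm
        simpa [h, sub_eq_zero] using hm
    obtain ⟨P, q, hP, hq, hq0, hgq⟩ := ih g (hgd _) hgs
    refine ⟨(X - C z₀) ^ p.order * P, q, mul_ne_zero (pow_ne_zero _ (X_sub_C_ne_zero _)) hP, hq,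
      hq0, fun z => ?_⟩
    rw [hfg, hgq]
    simp
    ring

/-- A nonvanishing entire function is an exponential. -/
theorem exists_eq_exp {g : ℂ → ℂ} (hg : Differentiable ℂ g) (h0 : ∀ z, g z ≠ 0) :
    ∃ h : ℂ → ℂ, Differentiable ℂ h ∧ ∀ z, g z = Complex.exp (h z) := by
  have hd : Differentiable ℂ (deriv g) := hg.deriv
  obtain ⟨h, hh0, hh⟩ := (hd.div hg h0).isExactOn_univ.with_val_at 0 (Complex.log (g 0))
  have hhd : ∀ z, HasDerivAt h (deriv g z / g z) z := fun z => hh z (Set.mem_univ z)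
  refine ⟨h, fun z => (hhd z).differentiableAt, ?_⟩
  have h1 : ∀ z, HasDerivAt (fun z => g z * Complex.exp (-h z)) 0 z := by
    intro z
    have := (hg z).hasDerivAt.mul (hhd z).neg.cexp
    refine this.congr_deriv ?_
    field_simp [h0 z]
    ring
  intro z
  have h2 := is_const_of_deriv_eq_zero (fun z => (h1 z).differentiableAt) (fun z => (h1 z).deriv) z 0
  simp only [hh0] at h2
  rw [Complex.exp_neg, Complex.exp_neg, Complex.exp_log (h0 0), mul_inv_cancel₀ (h0 0)] at h2
  field_simp [Complex.exp_ne_zero] at h2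
  exact h2

/-- An entire function whose real part grows at most quadratically is a quadratic polynomial. -/
theorem eq_quadratic_of_re_le {h : ℂ → ℂ} (hh : Differentiable ℂ h) {A : ℝ} (hA : 0 < A)
    (hb : ∀ z, (h z).re ≤ A * (1 + ‖z‖) ^ 2) :
    ∃ a b c : ℂ, ∀ z, h z = a * z ^ 2 / 2 + b * z + c := by
  -- Borel–Carathéodory on the disc of radius `2|z|` gives `2A(1 + 2|z|)² + 3‖h 0‖`, and `1 + 2|z| ≤
  -- 3|z|` once `|z| ≥ 1`. Cauchy's estimates then kill the derivatives at `0` of order at least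
  -- three.
  set D : ℝ := 18 * A + 3 * ‖h 0‖ with hD
  have hD0 : 0 ≤ D := by positivity
  have hgrowth : ∀ z, 1 ≤ ‖z‖ → ‖h z‖ ≤ D * ‖z‖ ^ 2 := by
    intro z hz
    have hr : 0 < ‖z‖ := by linarith
    have h1 := Complex.borelCaratheodory (f := h) (M := A * (1 + 2 * ‖z‖) ^ 2) (R := 2 * ‖z‖) (z := z)
      (by positivity) hh.differentiableOn (fun w hw => ?_) (by positivity) (by simp; linarith)
    · have e : 2 * ‖z‖ - ‖z‖ = ‖z‖ := by ring
      rw [e, show 2 * ‖z‖ + ‖z‖ = 3 * ‖z‖ by ring, mul_div_cancel_right₀ _ hr.ne', ← mul_assoc ‖h 0‖,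
        mul_div_cancel_right₀ _ hr.ne'] at h1
      have h2 : (1 + 2 * ‖z‖) ^ 2 ≤ 9 * ‖z‖ ^ 2 := by nlinarith
      have h3 : (1 : ℝ) ≤ ‖z‖ ^ 2 := by nlinarith
      nlinarith [norm_nonneg (h 0)]
    · simp only [Metric.mem_ball, dist_zero_right] at hw
      refine (hb w).trans ?_
      show A * (1 + ‖w‖) ^ 2 ≤ A * (1 + 2 * ‖z‖) ^ 2
      gcongr
  have hder : ∀ n, 3 ≤ n → iteratedDeriv n h 0 = 0 := by
    intro n hn
    have h1 : ∀ R : ℝ, 1 ≤ R → ‖iteratedDeriv n h 0‖ ≤ n.factorial * D / R := by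
      intro R hR
      have hR0 : 0 < R := by linarith
      have := Complex.norm_iteratedDeriv_le_of_forall_mem_sphere_norm_le (c := 0) (f := h)
        (C := D * R ^ 2) n hR0 hh.diffContOnCl (fun z hz => by
          simp at hz
          have := hgrowth z (by rw [hz]; exact hR)
          rwa [hz] at this)
      refine this.trans ?_
      rw [div_le_div_iff₀ (by positivity) hR0]
      calc (n.factorial : ℝ) * (D * R ^ 2) * R = n.factorial * D * R ^ 3 := by ring
        _ ≤ n.factorial * D * R ^ n := by
          gcongr
    by_contra hne
    have hpos : 0 < ‖iteratedDeriv n h 0‖ := norm_pos_iff.2 hne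
    set B : ℝ := n.factorial * D
    have hB : 0 ≤ B := by positivity
    -- A radius at which the bound `B / R` falls below the norm of the derivative, assumed nonzero.
    have := h1 (B / ‖iteratedDeriv n h 0‖ + 1) (by
      have : 0 ≤ B / ‖iteratedDeriv n h 0‖ := by positivity
      linarith)
    rw [le_div_iff₀ (by positivity), mul_add, mul_div_cancel₀ _ hpos.ne'] at this
    linarith
  refine ⟨iteratedDeriv 2 h 0, iteratedDeriv 1 h 0, h 0, fun z => ?_⟩
  have hs := Complex.hasSum_taylorSeries_of_entire hh 0 z
  have hs' : HasSum (fun n : ℕ => ((n.factorial : ℂ))⁻¹ • (z - 0) ^ n • iteratedDeriv n h 0)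
      (∑ n ∈ Finset.range 3, ((n.factorial : ℂ))⁻¹ • (z - 0) ^ n • iteratedDeriv n h 0) := by
    refine hasSum_sum_of_ne_finset_zero fun n hn => ?_
    rw [hder n (by simpa using hn)]
    simp
  rw [hs.unique hs']
  simp [Finset.sum_range_succ]
  ring

open Polynomial in
theorem exists_le_norm_eval {P : ℂ[X]} (hP : P ≠ 0) :
    ∃ c R : ℝ, 0 < c ∧ ∀ z : ℂ, R ≤ ‖z‖ → c ≤ ‖P.eval z‖ := by
  rcases (natDegree P).eq_zero_or_pos with h | h
  · obtain ⟨x, rfl⟩ := natDegree_eq_zero.1 h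
    have : x ≠ 0 := by rintro rfl; simp at hP
    exact ⟨‖x‖, 0, norm_pos_iff.2 this, fun z _ => by simp⟩
  · have := P.tendsto_norm_atTop (natDegree_pos_iff_degree_pos.1 h) (l := Filter.cocompact ℂ)
      (z := fun z => z) tendsto_norm_cocompact_atTop
    have h1 := this.eventually_ge_atTop 1
    rw [← Metric.cobounded_eq_cocompact, ← comap_norm_atTop, Filter.eventually_comap] at h1
    obtain ⟨R, hR⟩ := Filter.eventually_atTop.1 h1
    exact ⟨1, R, one_pos, fun z hz => hR _ hz z rfl⟩

open Polynomial in
/-- An entire function of Gaussian growth with finitely many zeros is a polynomial times the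
exponential of a quadratic polynomial. -/
theorem exists_eq_polynomial_mul_exp {f : ℂ → ℂ} (hf : Differentiable ℂ f)
    (hfin : {z | f z = 0}.Finite) {C : ℝ} {N : ℕ} (hC : 0 < C)
    (hb : ∀ z, ‖f z‖ ≤ C * (1 + ‖z‖) ^ N * Real.exp (‖z‖ ^ 2 / 2)) :
    ∃ (P : ℂ[X]) (a b : ℂ), P ≠ 0 ∧
      ∀ z, f z = P.eval z * Complex.exp (a * z ^ 2 / 2 + b * z) := by
  obtain ⟨P, g, hP, hg, hg0, hfg⟩ := exists_polynomial_mul_nonvanishing hfin.toFinset f hf (by simp)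
  obtain ⟨h, hh, hgh⟩ := exists_eq_exp hg hg0
  obtain ⟨c, R, hc, hR⟩ := exists_le_norm_eval hP
  obtain ⟨B, hB⟩ := (isCompact_closedBall (0 : ℂ) R).exists_bound_of_continuousOn
    hh.continuous.continuousOn
  -- Outside the disc of radius `R`, dividing by `P` loses only the factor `c`, and the bounds `C /
  -- c ≤ e^{C/c}` and `1 + |z| ≤ e^{1+|z|}` turn the growth of `g` into a bound on `Re h`. Inside,
  -- compactness gives `|B|`.
  have hre : ∀ z, (h z).re ≤ (C / c + N + 1 + |B|) * (1 + ‖z‖) ^ 2 := by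
    intro z
    have hz0 := norm_nonneg z
    have hCc : 0 < C / c := by positivity
    rcases le_total R ‖z‖ with hz | hz
    · have h1 : Real.exp (h z).re ≤ Real.exp (C / c + N * (1 + ‖z‖) + ‖z‖ ^ 2 / 2) := by
        rw [← Complex.norm_exp, ← hgh]
        have h2 : c * ‖g z‖ ≤ C * (1 + ‖z‖) ^ N * Real.exp (‖z‖ ^ 2 / 2) := by
          refine le_trans ?_ (hb z)
          rw [hfg, norm_mul]
          gcongr
          exact hR z hz
        rw [Real.exp_add, Real.exp_add]
        calc ‖g z‖ ≤ C / c * (1 + ‖z‖) ^ N * Real.exp (‖z‖ ^ 2 / 2) := by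
              rw [div_mul_eq_mul_div, div_mul_eq_mul_div, le_div_iff₀ hc]; linarith
          _ ≤ _ := by
            gcongr
            · linarith [Real.add_one_le_exp (C / c)]
            · rw [Real.exp_nat_mul]
              gcongr
              linarith [Real.add_one_le_exp (1 + ‖z‖)]
      rw [Real.exp_le_exp] at h1
      have hN : (0 : ℝ) ≤ N := N.cast_nonneg
      have hB0 := abs_nonneg B
      refine h1.trans ?_
      have e1 : 1 ≤ (1 + ‖z‖) ^ 2 := by nlinarith
      have e2 : 1 + ‖z‖ ≤ (1 + ‖z‖) ^ 2 := by nlinarith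
      have e3 : ‖z‖ ^ 2 / 2 ≤ (1 + ‖z‖) ^ 2 := by nlinarith
      have e4 := mul_le_mul_of_nonneg_left e2 hN
      have e5 := mul_le_mul_of_nonneg_left e1 hCc.le
      have e6 : 0 ≤ |B| * (1 + ‖z‖) ^ 2 := by positivity
      linarith
    · have h1 : (h z).re ≤ |B| := (Complex.re_le_norm _).trans
        ((hB z (by simpa using hz)).trans (le_abs_self B))
      have hN : (0 : ℝ) ≤ N := N.cast_nonneg
      have e1 : 1 ≤ (1 + ‖z‖) ^ 2 := by nlinarith
      nlinarith [abs_nonneg B]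
  obtain ⟨a, b, k, hq⟩ := eq_quadratic_of_re_le hh (by positivity) hre
  refine ⟨Polynomial.C (Complex.exp k) * P, a, b,
    mul_ne_zero (by simp [Complex.exp_ne_zero]) hP, fun z => ?_⟩
  rw [hfg, hgh, hq, Complex.exp_add]
  simp
  ring

end LLL

end

/-! ### Gaussian moments: convergence, differentiation, integration by parts -/

noncomputable section

namespace LLL

open scoped ComplexConjugate

theorem integrable_pow_mul_exp (n : ℕ) (c : ℝ) :
    Integrable fun w : ℂ => ‖w‖ ^ n * Real.exp (c * ‖w‖ - ‖w‖ ^ 2 / 2) := by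
  have h0 := (GaussianFourier.integrable_cexp_neg_mul_sq_norm_add (V := ℂ) (b := (1 / 4 : ℝ))
    (by simp) 0 0).norm
  have h1 : Integrable fun w : ℂ => n.factorial * Real.exp ((c + 1) ^ 2) *
      Real.exp (-‖w‖ ^ 2 / 4) := by
    refine (h0.congr (Filter.Eventually.of_forall fun w => ?_)).const_mul _
    simp only [zero_mul, add_zero, Complex.norm_exp]
    congr 1
    rw [← Complex.ofReal_pow, ← Complex.ofReal_neg, ← Complex.ofReal_mul, Complex.ofReal_re]
    ring
  refine h1.mono' (by fun_prop) (Filter.Eventually.of_forall fun w => ?_)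
  rw [Real.norm_of_nonneg (by positivity)]
  have h2 : ‖w‖ ^ n ≤ n.factorial * Real.exp ‖w‖ := by
    have := Real.pow_div_factorial_le_exp ‖w‖ (norm_nonneg _) n
    rwa [div_le_iff₀' (by positivity)] at this
  calc ‖w‖ ^ n * Real.exp (c * ‖w‖ - ‖w‖ ^ 2 / 2)
      ≤ n.factorial * Real.exp ‖w‖ * Real.exp (c * ‖w‖ - ‖w‖ ^ 2 / 2) := by gcongr
    _ = n.factorial * Real.exp (‖w‖ + (c * ‖w‖ - ‖w‖ ^ 2 / 2)) := by rw [Real.exp_add]; ring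
    _ ≤ n.factorial * Real.exp ((c + 1) ^ 2 + -‖w‖ ^ 2 / 4) := by
      refine mul_le_mul_of_nonneg_left (Real.exp_le_exp.2 ?_) (by positivity)
      nlinarith [sq_nonneg ((c + 1) - ‖w‖ / 2)]
    _ = _ := by rw [Real.exp_add]; ring

/-- The Gaussian weight `exp (s w + t w̄ - 2 |w|² + a w² + a w̄² / 2)`. -/
def gaussW (a : ℝ) (s t w : ℂ) : ℂ :=
  Complex.exp (s * w + t * conj w - 2 * (w * conj w) + a * w ^ 2 + a / 2 * conj w ^ 2)

theorem continuous_gaussW (a : ℝ) (s t : ℂ) : Continuous (gaussW a s t) := by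
  unfold gaussW
  fun_prop

/-- The quadratic part of the real exponent is `-2|w|² + (3a/2)(x² - y²)`, which for `0 ≤ a ≤ 1` is
at most `-|w|²/2`. -/
theorem norm_gaussW_le {a : ℝ} (ha : 0 ≤ a) (ha1 : a ≤ 1) (s t w : ℂ) :
    ‖gaussW a s t w‖ ≤ Real.exp ((‖s‖ + ‖t‖) * ‖w‖ - ‖w‖ ^ 2 / 2) := by
  rw [gaussW, Complex.norm_exp, Real.exp_le_exp]
  have h1 : (s * w).re ≤ ‖s‖ * ‖w‖ := (Complex.re_le_norm _).trans (norm_mul_le _ _)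
  have h2 : (t * conj w).re ≤ ‖t‖ * ‖w‖ := (Complex.re_le_norm _).trans (by simp)
  have h3 : ‖w‖ ^ 2 = w.re ^ 2 + w.im ^ 2 := by
    rw [← Complex.normSq_eq_norm_sq, Complex.normSq_apply]; ring
  have h4 : (2 * (w * conj w)).re = 2 * (w.re ^ 2 + w.im ^ 2) := by simp; ring
  have h5 : ((a : ℂ) * w ^ 2 + a / 2 * conj w ^ 2).re = 3 * a / 2 * (w.re ^ 2 - w.im ^ 2) := by
    simp [pow_two]; ring
  have h6 : (s * w + t * conj w - 2 * (w * conj w) + a * w ^ 2 + a / 2 * conj w ^ 2).re =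
    (s * w).re + (t * conj w).re - (2 * (w * conj w)).re +
      ((a : ℂ) * w ^ 2 + a / 2 * conj w ^ 2).re := by simp; ring
  rw [h6, h4, h5, h3]
  nlinarith [sq_nonneg w.re, sq_nonneg w.im, mul_nonneg ha (sq_nonneg w.im),
    mul_nonneg (sub_nonneg.2 ha1) (sq_nonneg w.re)]

theorem norm_moment_le {a : ℝ} (ha : 0 ≤ a) (ha1 : a ≤ 1) (s t : ℂ) (j k : ℕ) (w : ℂ) :
    ‖w ^ j * conj w ^ k * gaussW a s t w‖ ≤
      ‖w‖ ^ (j + k) * Real.exp ((‖s‖ + ‖t‖) * ‖w‖ - ‖w‖ ^ 2 / 2) := by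
  rw [norm_mul, norm_mul, norm_pow, norm_pow, RCLike.norm_conj, ← pow_add]
  gcongr
  exact norm_gaussW_le ha ha1 s t w

theorem integrable_moment {a : ℝ} (ha : 0 ≤ a) (ha1 : a ≤ 1) (s t : ℂ) (j k : ℕ) :
    Integrable fun w : ℂ => w ^ j * conj w ^ k * gaussW a s t w := by
  refine (integrable_pow_mul_exp (j + k) (‖s‖ + ‖t‖)).mono' ?_
    (Filter.Eventually.of_forall (norm_moment_le ha ha1 s t j k))
  have := continuous_gaussW a s t
  exact Continuous.aestronglyMeasurable (by fun_prop)

/-- The Gaussian moments `π⁻¹ ∫ wʲ w̄ᵏ exp (s w + t w̄ - 2 |w|² + a w² + a w̄² / 2)`. -/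
def moment (a : ℝ) (s : ℂ) (j k : ℕ) (t : ℂ) : ℂ :=
  1 / Real.pi * ∫ w : ℂ, w ^ j * conj w ^ k * gaussW a s t w

/-- Since `t` multiplies `w̄` in the exponent, differentiating in `t` inserts a factor `w̄`: all
moments follow from those with `k = 0`. -/
theorem hasDerivAt_moment {a : ℝ} (ha : 0 ≤ a) (ha1 : a ≤ 1) (s : ℂ) (j k : ℕ) (t : ℂ) :
    HasDerivAt (moment a s j k) (moment a s j (k + 1) t) t := by
  unfold moment
  refine HasDerivAt.const_mul _ ?_
  refine (hasDerivAt_integral_of_dominated_loc_of_deriv_le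
    (F' := fun τ w => w ^ j * conj w ^ (k + 1) * gaussW a s τ w)
    (bound := fun w => ‖w‖ ^ (j + (k + 1)) * Real.exp ((‖s‖ + (‖t‖ + 1)) * ‖w‖ - ‖w‖ ^ 2 / 2))
    (Metric.ball_mem_nhds t one_pos) (Filter.Eventually.of_forall fun τ =>
      (integrable_moment ha ha1 s τ j k).aestronglyMeasurable) (integrable_moment ha ha1 s t j k)
    (integrable_moment ha ha1 s t j (k + 1)).aestronglyMeasurable
    (Filter.Eventually.of_forall fun w τ hτ => ?_) (integrable_pow_mul_exp _ _)
    (Filter.Eventually.of_forall fun w τ hτ => ?_)).2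
  · refine (norm_moment_le ha ha1 s τ j (k + 1) w).trans ?_
    have : ‖τ‖ ≤ ‖t‖ + 1 := by
      have h1 : ‖τ - t‖ < 1 := by simpa [dist_eq_norm] using hτ
      have h2 : ‖τ‖ ≤ ‖t‖ + ‖τ - t‖ := by simpa using norm_add_le t (τ - t)
      linarith
    gcongr
  · unfold gaussW
    have h1 : HasDerivAt (fun τ : ℂ => s * w + τ * conj w - 2 * (w * conj w) + a * w ^ 2 +
        a / 2 * conj w ^ 2) (1 * conj w) τ :=
      ((((hasDerivAt_id τ).mul_const _).const_add _).sub_const _ |>.add_const _).add_const _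
    refine (h1.cexp.const_mul (w ^ j * conj w ^ k)).congr_deriv ?_
    ring

/-- The exponent of the Gaussian integral with weight `gaussW`. -/
def gaussExpo (a : ℝ) (s t : ℂ) : ℂ :=
  (a / 2 * s ^ 2 + 2 * s * t + a * t ^ 2) / (4 - 2 * a ^ 2)

theorem cpow_half_ofReal {x : ℝ} (hx : 0 ≤ x) : (x : ℂ) ^ (1 / 2 : ℂ) = (Real.sqrt x : ℂ) := by
  rw [Real.sqrt_eq_rpow, Complex.ofReal_cpow hx]
  norm_num

theorem moment_zero_zero {a : ℝ} (ha : 0 ≤ a) (ha1 : a ≤ 1) (s t : ℂ) :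
    moment a s 0 0 t = (1 / Real.sqrt (4 - 2 * a ^ 2) : ℝ) * Complex.exp (gaussExpo a s t) := by
  have hint := integrable_moment ha ha1 s t 0 0
  unfold moment
  simp only [pow_zero, one_mul] at hint ⊢
  -- Here `-p` is the coefficient of `x²` in the exponent; completing the square in `x`, with cross
  -- term `i a x y`, leaves the coefficient `-q` for `y²`. The determinant `p q = 4 - 2a²` governs
  -- the final constant and exponent.
  set p : ℝ := 2 - 3 * a / 2 with hp
  have hp0 : 0 < p := by rw [hp]; linarith
  set q : ℝ := 2 + 3 * a / 2 + a ^ 2 / (4 * p) with hq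
  have hq0 : 0 < q := by positivity
  have hpq : p * q = 4 - 2 * a ^ 2 := by
    rw [hq, mul_add, show p * (a ^ 2 / (4 * p)) = a ^ 2 / 4 by field_simp, hp]; ring
  have hpC : (p : ℂ) ≠ 0 := by exact_mod_cast hp0.ne'
  have hqC : (q : ℂ) ≠ 0 := by exact_mod_cast hq0.ne'
  have e1 : ∫ w : ℂ, gaussW a s t w =
      ∫ y : ℝ, ∫ x : ℝ, gaussW a s t (Complex.measurableEquivRealProd.symm (x, y)) := by
    have h1 := Complex.volume_preserving_equiv_real_prod.symm
    rw [← h1.integral_comp Complex.measurableEquivRealProd.symm.measurableEmbedding,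
      Measure.volume_eq_prod, integral_prod_symm]
    rw [← Measure.volume_eq_prod]
    exact (h1.integrable_comp_emb
      Complex.measurableEquivRealProd.symm.measurableEmbedding).2 hint
  have e2 : ∀ y : ℝ, ∫ x : ℝ, gaussW a s t (Complex.measurableEquivRealProd.symm (x, y)) =
      (Real.sqrt (Real.pi / p) : ℂ) * Complex.exp (-(q : ℂ) * y ^ 2 +
        (Complex.I * (s - t) + Complex.I * a * (s + t) / (2 * p)) * y +
          (s + t) ^ 2 / (4 * p)) := by
    intro y
    have h1 : ∀ x : ℝ, gaussW a s t (Complex.measurableEquivRealProd.symm (x, y)) =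
        Complex.exp (-(p : ℂ) * x ^ 2 + (s + t + Complex.I * a * y) * x +
          (Complex.I * (s - t) * y - (2 + 3 * a / 2) * y ^ 2)) := by
      intro x
      have hz : Complex.measurableEquivRealProd.symm (x, y) = x + y * Complex.I := by
        rw [Complex.measurableEquivRealProd_symm_apply]
        apply Complex.ext <;> simp
      rw [gaussW, hz]
      congr 1
      simp only [map_add, map_mul, Complex.conj_ofReal, Complex.conj_I, hp]
      push_cast
      linear_combination ((-2 : ℂ) * (-1) * (y : ℂ) ^ 2 + (3 * a / 2) * (y : ℂ) ^ 2) * Complex.I_sq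
    simp only [h1]
    rw [integral_cexp_quadratic (by simpa using hp0), neg_neg, ← Complex.ofReal_div,
      cpow_half_ofReal (by positivity)]
    congr 2
    rw [hq]
    push_cast
    field_simp
    linear_combination (2 * (a : ℂ) ^ 2 * y ^ 2) * Complex.I_sq
  rw [e1]
  simp only [e2]
  rw [integral_const_mul, integral_cexp_quadratic (by simpa using hq0), neg_neg,
    ← Complex.ofReal_div, cpow_half_ofReal (by positivity)]
  have e3 : Real.sqrt (Real.pi / p) * Real.sqrt (Real.pi / q) =
      Real.pi / Real.sqrt (4 - 2 * a ^ 2) := by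
    rw [← Real.sqrt_mul (by positivity), ← hpq, div_mul_div_comm, Real.sqrt_div (by positivity),
      Real.sqrt_mul_self Real.pi_pos.le]
  have e4 : (s + t) ^ 2 / (4 * p) - (Complex.I * (s - t) + Complex.I * a * (s + t) / (2 * p)) ^ 2 /
      (4 * -(q : ℂ)) = gaussExpo a s t := by
    have h2 : (4 - 2 * a ^ 2 : ℂ) = p * q := by rw [← Complex.ofReal_mul, hpq]; push_cast; ring
    have h3 : (q : ℂ) * p = 4 - 2 * a ^ 2 := by rw [h2]; ring
    have h4 : (p : ℂ) = 2 - 3 * a / 2 := by rw [hp]; push_cast; ring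
    rw [gaussExpo, h2]
    field_simp
    have h5 : 4 * (s + t) ^ 2 * (4 - 2 * a ^ 2) - (2 * p * (s - t) + (s + t) * a) ^ 2 -
        8 * p * (a * s ^ 2 + 4 * s * t + 2 * a * t ^ 2) = 0 := by
      rw [h4]; ring
    linear_combination 4 * (s + t) ^ 2 * h3 + (2 * p * (s - t) + (s + t) * a) ^ 2 * Complex.I_sq + h5
  have e5 : (Real.sqrt (Real.pi / p) : ℂ) * Real.sqrt (Real.pi / q) =
      Real.pi / Real.sqrt (4 - 2 * a ^ 2) := by exact_mod_cast e3
  have : (Real.pi : ℂ) ≠ 0 := by exact_mod_cast Real.pi_ne_zero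
  rw [e4, mul_left_comm, ← mul_assoc, ← mul_assoc, mul_right_comm _ _ (Real.sqrt (Real.pi / q) : ℂ),
    e5]
  push_cast
  field_simp

/-- This is `∫ ∂_w̄ (w^j gaussW) = 0`: the derivative `∂_w̄` ignores `w^j` and brings down `t - 2w +
a w̄`. -/
theorem two_mul_moment_succ {a : ℝ} (ha : 0 ≤ a) (ha1 : a ≤ 1) (s t : ℂ) (j : ℕ) :
    2 * moment a s (j + 1) 0 t = t * moment a s j 0 t + a * moment a s j 1 t := by
  have hfd : ∀ w : ℂ, HasFDerivAt (𝕜 := ℝ) (fun w : ℂ => w ^ j * gaussW a s t w)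
      (w ^ j • (gaussW a s t w • (s • ContinuousLinearMap.id ℝ ℂ +
        t • (Complex.conjCLE : ℂ →L[ℝ] ℂ) - (2 : ℂ) • (w • (Complex.conjCLE : ℂ →L[ℝ] ℂ) +
          conj w • ContinuousLinearMap.id ℝ ℂ) +
        (a : ℂ) • ((2 * w) • ContinuousLinearMap.id ℝ ℂ) +
        (a / 2 : ℂ) • ((2 * conj w) • (Complex.conjCLE : ℂ →L[ℝ] ℂ)))) +
        gaussW a s t w • ((j * w ^ (j - 1)) • ContinuousLinearMap.id ℝ ℂ)) w := by
    intro w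
    have h1 : HasFDerivAt (𝕜 := ℝ) (fun w : ℂ => w) (ContinuousLinearMap.id ℝ ℂ) w :=
      hasFDerivAt_id w
    have h2 : HasFDerivAt (𝕜 := ℝ) (fun w : ℂ => conj w) (Complex.conjCLE : ℂ →L[ℝ] ℂ) w :=
      Complex.conjCLE.hasFDerivAt
    have h3 := (((((h1.const_mul s).add (h2.const_mul t)).sub ((h1.mul h2).const_mul 2)).add
      ((h1.pow 2).const_mul (a : ℂ))).add ((h2.pow 2).const_mul (a / 2 : ℂ))).cexp
    have h4 := (h1.pow j).mul h3
    refine h4.congr_fderiv ?_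
    ext
    simp [gaussW]
  set M : ℕ → ℕ → ℂ := fun j k => ∫ w : ℂ, w ^ j * conj w ^ k * gaussW a s t w with hM
  have key : ∀ v : ℂ, (s * v + t * conj v) * M j 0 + (2 * a * v - 2 * conj v) * M (j + 1) 0 +
      (a * conj v - 2 * v) * M j 1 + j * v * M (j - 1) 0 = 0 := by
    intro v
    have hm := integrable_moment ha ha1 s t
    have e : ∀ w, fderiv ℝ (fun w : ℂ => w ^ j * gaussW a s t w) w v =
        (s * v + t * conj v) * (w ^ j * conj w ^ 0 * gaussW a s t w) +
        (2 * a * v - 2 * conj v) * (w ^ (j + 1) * conj w ^ 0 * gaussW a s t w) +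
        (a * conj v - 2 * v) * (w ^ j * conj w ^ 1 * gaussW a s t w) +
        j * v * (w ^ (j - 1) * conj w ^ 0 * gaussW a s t w) := by
      intro w
      rw [(hfd w).fderiv]
      simp
      ring
    have hi : Integrable fun w => fderiv ℝ (fun w : ℂ => w ^ j * gaussW a s t w) w v := by
      simp only [e]
      exact ((((hm j 0).const_mul _).add ((hm (j + 1) 0).const_mul _)).add
        ((hm j 1).const_mul _)).add ((hm (j - 1) 0).const_mul _)
    have h0 := integral_mul_fderiv_eq_neg_fderiv_mul_of_integrable (μ := volume) (𝕜 := ℂ)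
      (f := fun _ : ℂ => (1 : ℂ)) (g := fun w : ℂ => w ^ j * gaussW a s t w) (v := v)
      (by simp) (by simpa using hi) (by simpa using hm j 0) (by simp)
      (fun w _ => (hfd w).differentiableAt)
    simp only [one_mul, e, fderiv_fun_const, Pi.zero_apply, zero_apply, zero_mul,
      integral_zero, neg_zero] at h0
    rw [integral_add, integral_add, integral_add] at h0
    · simpa only [integral_const_mul] using h0
    · exact (hm j 0).const_mul _
    · exact (hm (j + 1) 0).const_mul _
    · exact ((hm j 0).const_mul _).add ((hm (j + 1) 0).const_mul _)
    · exact (hm j 1).const_mul _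
    · exact (((hm j 0).const_mul _).add ((hm (j + 1) 0).const_mul _)).add ((hm j 1).const_mul _)
    · exact (hm (j - 1) 0).const_mul _
  -- The directional identities for `1` and `i` combine as `∂_x + i ∂_y = 2 ∂_w̄`, which removes the
  -- terms containing `s` and `j`.
  have k1 := key 1
  have k2 := key Complex.I
  simp only [map_one, Complex.conj_I] at k1 k2
  unfold moment
  change 2 * (1 / Real.pi * M (j + 1) 0) = t * (1 / Real.pi * M j 0) + a * (1 / Real.pi * M j 1)
  have h : 2 * (t * M j 0 - 2 * M (j + 1) 0 + a * M j 1) = 0 := by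
    linear_combination k1 + Complex.I * k2 - (s * M j 0 - t * M j 0 + (2 * a + 2) * M (j + 1) 0 -
      (a + 2) * M j 1 + j * M (j - 1) 0) * Complex.I_sq
  linear_combination -(1 / (2 * Real.pi)) * h

end LLL

end

/-! ### Closed form of the moments and of the nonlinearity on Gaussian profiles -/

noncomputable section

namespace LLL

open scoped ComplexConjugate
open Polynomial

/-- Differentiation in `t` of `p(t) exp (gaussExpo a s t)`, expressed on polynomials. -/
def gaussD (a : ℝ) (s : ℂ) : Module.End ℂ ℂ[X] :=
  derivative + LinearMap.mulLeft ℂ (C (2 * s / (4 - 2 * a ^ 2) : ℂ) + C (2 * a / (4 - 2 * a ^ 2) : ℂ) * X)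

/-- The polynomial factors of the moments `moment a s j 0`. -/
def gaussK (a : ℝ) (s : ℂ) : ℕ → ℂ[X]
  | 0 => 1
  | j + 1 => C (1 / 2) * (X * gaussK a s j + C (a : ℂ) * gaussD a s (gaussK a s j))

theorem gaussD_apply (a : ℝ) (s : ℂ) (p : ℂ[X]) : gaussD a s p =
    derivative p + (C (2 * s / (4 - 2 * a ^ 2) : ℂ) + C (2 * a / (4 - 2 * a ^ 2) : ℂ) * X) * p := rfl

theorem hasDerivAt_eval_mul_gaussExpo (a : ℝ) (s : ℂ) (p : ℂ[X]) (t : ℂ) :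
    HasDerivAt (fun t => p.eval t * Complex.exp (gaussExpo a s t))
      ((gaussD a s p).eval t * Complex.exp (gaussExpo a s t)) t := by
  have h1 : HasDerivAt (gaussExpo a s) ((2 * s * 1 + a * (2 * t ^ (2 - 1) * 1)) / (4 - 2 * a ^ 2))
      t := by
    unfold gaussExpo
    exact ((((hasDerivAt_id t).const_mul (2 * s)).const_add _).add
      (((hasDerivAt_id t).pow 2).const_mul (a : ℂ))).div_const _
  refine ((p.hasDerivAt t).mul h1.cexp).congr_deriv ?_
  rw [gaussD_apply]
  simp
  ring

/-- Induction on `k` uses differentiation in `t`, which acts on the polynomial factor as `gaussD`;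
induction on `j` uses integration by parts, whose recurrence is the one defining `gaussK`. -/
theorem moment_eq {a : ℝ} (ha : 0 ≤ a) (ha1 : a ≤ 1) (s : ℂ) (j k : ℕ) (t : ℂ) :
    moment a s j k t = (1 / Real.sqrt (4 - 2 * a ^ 2) : ℝ) *
      ((((gaussD a s) ^ k) (gaussK a s j)).eval t * Complex.exp (gaussExpo a s t)) := by
  have hk : ∀ j, (∀ t, moment a s j 0 t = (1 / Real.sqrt (4 - 2 * a ^ 2) : ℝ) *
      ((gaussK a s j).eval t * Complex.exp (gaussExpo a s t))) → ∀ k t,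
      moment a s j k t = (1 / Real.sqrt (4 - 2 * a ^ 2) : ℝ) *
      ((((gaussD a s) ^ k) (gaussK a s j)).eval t * Complex.exp (gaussExpo a s t)) := by
    intro j hj k
    induction k with
    | zero => simpa using hj
    | succ k ih =>
      intro t
      have h1 := hasDerivAt_moment ha ha1 s j k t
      have h2 := (hasDerivAt_eval_mul_gaussExpo a s (((gaussD a s) ^ k) (gaussK a s j)) t).const_mul
        ((1 / Real.sqrt (4 - 2 * a ^ 2) : ℝ) : ℂ)
      rw [← funext ih] at h2
      rw [h1.unique h2, pow_succ' (gaussD a s), Module.End.mul_apply]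
  refine hk j ?_ k t
  induction j with
  | zero => intro t; rw [moment_zero_zero ha ha1, gaussK, eval_one, one_mul]
  | succ j ih =>
    intro t
    have h1 := two_mul_moment_succ ha ha1 s t j
    have h2 := hk j ih 1 t
    rw [pow_one] at h2
    rw [ih t, h2] at h1
    simp only [gaussK, eval_mul, eval_add, eval_C, eval_X]
    linear_combination (1 / 2) * h1

/-- The polynomial factor of the Gaussian integral of `R(w) S(w̄)`. -/
def gaussPoly (a : ℝ) (s : ℂ) (N M : ℕ) (R S : ℂ[X]) : ℂ[X] :=
  ∑ j ∈ Finset.range (N + 1), ∑ k ∈ Finset.range (M + 1),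
    C (R.coeff j * S.coeff k) * ((gaussD a s) ^ k) (gaussK a s j)

theorem integral_gaussW {a : ℝ} (ha : 0 ≤ a) (ha1 : a ≤ 1) (s t : ℂ) {N M : ℕ} {R S : ℂ[X]}
    (hR : R.natDegree ≤ N) (hS : S.natDegree ≤ M) :
    1 / Real.pi * ∫ w : ℂ, R.eval w * S.eval (conj w) * gaussW a s t w =
      (1 / Real.sqrt (4 - 2 * a ^ 2) : ℝ) *
        ((gaussPoly a s N M R S).eval t * Complex.exp (gaussExpo a s t)) := by
  have e : ∀ w, R.eval w * S.eval (conj w) * gaussW a s t w = ∑ j ∈ Finset.range (N + 1),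
      ∑ k ∈ Finset.range (M + 1), (R.coeff j * S.coeff k) * (w ^ j * conj w ^ k * gaussW a s t w) := by
    intro w
    rw [eval_eq_sum_range' (Nat.lt_succ_of_le hR), eval_eq_sum_range' (Nat.lt_succ_of_le hS),
      Finset.sum_mul_sum, Finset.sum_mul]
    refine Finset.sum_congr rfl fun j _ => ?_
    rw [Finset.sum_mul]
    refine Finset.sum_congr rfl fun k _ => ?_
    ring
  simp only [e]
  rw [integral_finsetSum _ fun j _ => integrable_finsetSum _ fun k _ =>
    (integrable_moment ha ha1 s t j k).const_mul _, gaussPoly, eval_finsetSum, Finset.mul_sum,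
    Finset.sum_mul, Finset.mul_sum]
  refine Finset.sum_congr rfl fun j _ => ?_
  rw [integral_finsetSum _ fun k _ => (integrable_moment ha ha1 s t j k).const_mul _,
    eval_finsetSum, Finset.mul_sum, Finset.sum_mul, Finset.mul_sum]
  refine Finset.sum_congr rfl fun k _ => ?_
  have h := moment_eq ha ha1 s j k t
  unfold moment at h
  rw [integral_const_mul, eval_mul, eval_C, mul_left_comm, h]
  ring

theorem natDegree_gaussD_le {a : ℝ} {s : ℂ} {p : ℂ[X]} {n : ℕ} (hp : p.natDegree ≤ n) :
    (gaussD a s p).natDegree ≤ n + 1 ∧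
      (gaussD a s p).coeff (n + 1) = 2 * a / (4 - 2 * a ^ 2) * p.coeff n := by
  have hd : (derivative p).natDegree ≤ n := (natDegree_derivative_le p).trans (by omega)
  rw [gaussD_apply]
  constructor
  · refine natDegree_add_le_of_degree_le (hd.trans (by omega)) (natDegree_mul_le.trans ?_)
    have : (C (2 * s / (4 - 2 * a ^ 2) : ℂ) + C (2 * a / (4 - 2 * a ^ 2) : ℂ) * X).natDegree ≤ 1 := by
      compute_degree
    omega
  · rw [coeff_add, coeff_eq_zero_of_natDegree_lt (lt_of_le_of_lt hd (Nat.lt_succ_self n)), add_mul,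
      coeff_add, coeff_C_mul, coeff_eq_zero_of_natDegree_lt (lt_of_le_of_lt hp (Nat.lt_succ_self n)),
      mul_assoc, coeff_C_mul, coeff_X_mul]
    ring

theorem natDegree_gaussD_pow_le {a : ℝ} {s : ℂ} {p : ℂ[X]} {n : ℕ} (hp : p.natDegree ≤ n) (k : ℕ) :
    (((gaussD a s) ^ k) p).natDegree ≤ n + k ∧
      (((gaussD a s) ^ k) p).coeff (n + k) = (2 * a / (4 - 2 * a ^ 2)) ^ k * p.coeff n := by
  induction k with
  | zero => simpa using hp
  | succ k ih =>
    have h := natDegree_gaussD_le (a := a) (s := s) ih.1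
    rw [pow_succ' (gaussD a s), Module.End.mul_apply]
    refine ⟨h.1, ?_⟩
    rw [← add_assoc, h.2, ih.2, pow_succ']
    ring

theorem natDegree_gaussK_le (a : ℝ) (s : ℂ) (j : ℕ) : (gaussK a s j).natDegree ≤ j ∧
    (gaussK a s j).coeff j = (1 / 2 * (1 + a * (2 * a / (4 - 2 * a ^ 2)))) ^ j := by
  induction j with
  | zero => simp [gaussK]
  | succ j ih =>
    have h := natDegree_gaussD_le (a := a) (s := s) ih.1
    rw [gaussK]
    constructor
    · refine (natDegree_C_mul_le _ _).trans (natDegree_add_le_of_degree_le ?_ ?_)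
      · refine natDegree_mul_le.trans ?_
        rw [natDegree_X]
        omega
      · exact (natDegree_C_mul_le _ _).trans h.1
    · rw [coeff_C_mul, coeff_add, coeff_X_mul, coeff_C_mul, h.2, ih.2]
      ring

/-- Only the pair `(N, M)` reaches degree `N + M`, and its coefficient is nonzero when `a > 0`,
provided both leading coefficients are. For `a = 0` and `M > 0` it vanishes, which is why that case
needs a finer count. -/
theorem natDegree_gaussPoly_le (a : ℝ) (s : ℂ) (N M : ℕ) (R S : ℂ[X]) :
    (gaussPoly a s N M R S).natDegree ≤ N + M ∧ (gaussPoly a s N M R S).coeff (N + M) =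
      R.coeff N * S.coeff M * ((2 * a / (4 - 2 * a ^ 2)) ^ M *
        (1 / 2 * (1 + a * (2 * a / (4 - 2 * a ^ 2)))) ^ N) := by
  have hdeg : ∀ j k, (((gaussD a s) ^ k) (gaussK a s j)).natDegree ≤ j + k := fun j k =>
    (natDegree_gaussD_pow_le (natDegree_gaussK_le a s j).1 k).1
  constructor
  · refine natDegree_sum_le_of_forall_le _ _ fun j hj => natDegree_sum_le_of_forall_le _ _ fun k hk =>
      (natDegree_C_mul_le _ _).trans ((hdeg j k).trans ?_)
    simp at hj hk
    omega
  · rw [gaussPoly, finsetSum_coeff, Finset.sum_eq_single N, finsetSum_coeff,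
      Finset.sum_eq_single M]
    · rw [coeff_C_mul, (natDegree_gaussD_pow_le (natDegree_gaussK_le a s N).1 M).2,
        (natDegree_gaussK_le a s N).2]
    · intro k hk hne
      have : k ≤ M := by simpa [Nat.lt_succ_iff] using hk
      rw [coeff_C_mul, coeff_eq_zero_of_natDegree_lt ((hdeg N k).trans_lt (by omega)), mul_zero]
    · simp
    · intro j hj hne
      rw [finsetSum_coeff]
      refine Finset.sum_eq_zero fun k hk => ?_
      have h1 : j ≤ N := by simpa [Nat.lt_succ_iff] using hj
      have h2 : k ≤ M := by simpa [Nat.lt_succ_iff] using hk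
      rw [coeff_C_mul, coeff_eq_zero_of_natDegree_lt ((hdeg j k).trans_lt (by omega)), mul_zero]
    · simp

/-- If `p e^g = q` with polynomials `p ≠ 0`, `q`, `g`, then `g` is constant. -/
theorem derivative_eq_zero_of_mul_exp_eq {p q g : ℂ[X]} (hp : p ≠ 0)
    (h : ∀ z, p.eval z * Complex.exp (g.eval z) = q.eval z) : derivative g = 0 := by
  have hq : q ≠ 0 := by
    rintro rfl
    refine hp (funext fun z => ?_)
    have := h z
    simpa [Complex.exp_ne_zero] using this
  have hd : ∀ z, ((derivative p).eval z + (derivative g).eval z * p.eval z) *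
      Complex.exp (g.eval z) = (derivative q).eval z := by
    intro z
    have h1 := (p.hasDerivAt z).mul (g.hasDerivAt z).cexp
    have h2 := q.hasDerivAt z
    rw [← _root_.funext h] at h2
    rw [← h1.unique h2]
    ring
  have hpoly : derivative q * p = (derivative p + derivative g * p) * q := by
    refine funext fun z => ?_
    simp only [eval_mul, eval_add]
    rw [← hd, ← h]
    ring
  by_contra hg
  -- If `g' ≠ 0`, the left side has degree at least that of `p q`, while the right side, each term
  -- carrying a derivative, has strictly smaller degree.
  have e : derivative g * p * q = derivative q * p - derivative p * q := by
    linear_combination -hpoly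
  have h1 : (derivative g * p * q).degree ≥ (p * q).degree := by
    rw [mul_assoc, degree_mul]
    have : (0 : WithBot ℕ) ≤ (derivative g).degree := zero_le_degree_iff.2 hg
    exact le_add_of_nonneg_left this
  have h2 : (derivative q * p - derivative p * q).degree < (p * q).degree := by
    refine (degree_sub_le _ _).trans_lt (max_lt ?_ ?_)
    · rw [mul_comm p q, degree_mul, degree_mul]
      exact WithBot.add_lt_add_right (degree_ne_bot.2 hp) (degree_derivative_lt hq)
    · rw [degree_mul, degree_mul]
      exact WithBot.add_lt_add_right (degree_ne_bot.2 hq) (degree_derivative_lt hp)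
  rw [e] at h1
  exact absurd h2 (not_lt.2 h1)

/-- The function `e^{-|z|²/2} P(z) e^{a z²/2 + b z}`. -/
def gaussProfile (P : ℂ[X]) (a b : ℂ) (z : ℂ) : ℂ :=
  (Real.exp (-‖z‖ ^ 2 / 2) : ℂ) * (P.eval z * Complex.exp (a * z ^ 2 / 2 + b * z))

theorem eval_map_conj (P : ℂ[X]) (w : ℂ) : (P.map (starRingEnd ℂ)).eval (conj w) = conj (P.eval w) := by
  rw [eval_map, eval₂_at_apply]

theorem ofReal_norm_sq (w : ℂ) : (‖w‖ : ℂ) ^ 2 = w * conj w := by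
  rw [Complex.mul_conj, Complex.normSq_eq_norm_sq]; push_cast; rfl

/-- In `|v|² v` the holomorphic factor appears squared and its conjugate once. Together with the
kernel of `Π` this is the weight `gaussW` with `s = 2b` and `t = z + b̄`, carrying the polynomial
factors `P²` in `w` and `P` conjugated in `w̄`. -/
theorem nonlin_gaussProfile {a : ℝ} (ha : 0 ≤ a) (ha1 : a ≤ 1) (b : ℂ) {P : ℂ[X]} {n : ℕ}
    (hP : P.natDegree ≤ n) (z : ℂ) : nonlin (gaussProfile P a b) z =
      (Real.exp (-‖z‖ ^ 2 / 2) : ℂ) * ((1 / Real.sqrt (4 - 2 * a ^ 2) : ℝ) *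
        ((gaussPoly a (2 * b) (2 * n) n (P ^ 2) (P.map (starRingEnd ℂ))).eval (z + conj b) *
          Complex.exp (gaussExpo a (2 * b) (z + conj b)))) := by
  rw [← integral_gaussW ha ha1 (2 * b) (z + conj b)
    (natDegree_pow_le.trans (Nat.mul_le_mul_left 2 hP)) (natDegree_map_le.trans hP)]
  unfold nonlin proj
  rw [mul_comm (1 / (Real.pi : ℂ)), mul_assoc]
  congr 2
  refine integral_congr_ae (Filter.Eventually.of_forall fun w => ?_)
  simp only [eval_pow, eval_map_conj]
  have h1 : (((‖gaussProfile P a b w‖ ^ 2 : ℝ)) : ℂ) * gaussProfile P a b w =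
      P.eval w ^ 2 * conj (P.eval w) * (Complex.exp (-(w * conj w) / 2 * 3) *
        Complex.exp (a * w ^ 2 + 2 * b * w + a * conj w ^ 2 / 2 + conj b * conj w)) := by
    push_cast
    rw [ofReal_norm_sq]
    unfold gaussProfile
    push_cast
    rw [ofReal_norm_sq, map_mul, map_mul, ← Complex.exp_conj, ← Complex.exp_conj]
    have e1 : conj (-(w * conj w) / 2) = -(w * conj w) / 2 := by
      simp [Complex.conj_ofNat]; ring
    have e2 : conj ((a : ℂ) * w ^ 2 / 2 + b * w) = a * conj w ^ 2 / 2 + conj b * conj w := by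
      simp [Complex.conj_ofNat]
    rw [e1, e2]
    have e3 : Complex.exp (-(w * conj w) / 2 * 3) = Complex.exp (-(w * conj w) / 2) ^ 3 := by
      rw [← Complex.exp_nat_mul]; congr 1; push_cast; ring
    have e4 : Complex.exp (a * w ^ 2 + 2 * b * w + a * conj w ^ 2 / 2 + conj b * conj w) =
        Complex.exp (a * w ^ 2 / 2 + b * w) ^ 2 *
          Complex.exp (a * conj w ^ 2 / 2 + conj b * conj w) := by
      rw [← Complex.exp_nat_mul, ← Complex.exp_add]; congr 1; push_cast; ring
    rw [e3, e4]
    ring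
  rw [h1, gaussW]
  push_cast
  rw [ofReal_norm_sq, mul_left_comm, ← Complex.exp_add, ← Complex.exp_add]
  congr 2
  ring

end LLL

end

/-! ### The profile equation and its symmetries -/

noncomputable section

namespace LLL

open scoped ComplexConjugate

/-- `v` is the profile of a wave `e^{-iλt} v(e^{-iμt} z)`: it solves `λ v + μ Λ v = Π(|v|² v)`. -/
def IsProfile (lam mu : ℝ) (v : ℂ → ℂ) : Prop :=
  v ∈ enlargedFockSpace ∧ ∃ f : ℂ → ℂ, Differentiable ℂ f ∧
    (∀ z, v z = (Real.exp (-‖z‖ ^ 2 / 2) : ℂ) * f z) ∧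
    ∀ z, (Real.exp (-‖z‖ ^ 2 / 2) : ℂ) * (lam * f z + mu * (z * deriv f z)) = nonlin v z

theorem norm_exp_I_mul (θ : ℝ) : ‖Complex.exp (Complex.I * θ)‖ = 1 := by
  rw [mul_comm, Complex.norm_exp_ofReal_mul_I]

theorem norm_spaceRot_arg (θ : ℝ) (z : ℂ) : ‖Complex.exp (Complex.I * θ) * z‖ = ‖z‖ := by
  rw [norm_mul, norm_exp_I_mul, one_mul]

theorem norm_phaseRot_spaceRot (γ θ : ℝ) (v : ℂ → ℂ) (z : ℂ) :
    ‖phaseRot γ (spaceRot θ v) z‖ = ‖v (Complex.exp (Complex.I * θ) * z)‖ := by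
  rw [phaseRot, norm_mul, norm_exp_I_mul, one_mul, spaceRot]

/-- Multiplication by `e^{iθ}` as a linear isometry. -/
def rotIso (θ : ℝ) : ℂ ≃ₗᵢ[ℝ] ℂ := rotation (Circle.exp θ)

theorem rotIso_apply (θ : ℝ) (z : ℂ) : rotIso θ z = Complex.exp (Complex.I * θ) * z := by
  rw [rotIso, rotation_apply, Circle.coe_exp, mul_comm Complex.I]

theorem measurePreserving_rot (θ : ℝ) :
    MeasurePreserving (fun z : ℂ => Complex.exp (Complex.I * θ) * z) := by
  have := (rotIso θ).measurePreserving
  rwa [show ⇑(rotIso θ) = fun z : ℂ => Complex.exp (Complex.I * θ) * z from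
    funext (rotIso_apply θ)] at this

theorem measurableEmbedding_rot (θ : ℝ) :
    MeasurableEmbedding (fun z : ℂ => Complex.exp (Complex.I * θ) * z) := by
  have := (rotIso θ).toHomeomorph.measurableEmbedding
  rwa [show ⇑(rotIso θ).toHomeomorph = fun z : ℂ => Complex.exp (Complex.I * θ) * z from
    funext (rotIso_apply θ)] at this

theorem integral_comp_rot {E : Type*} [NormedAddCommGroup E] [NormedSpace ℝ E] (θ : ℝ) (g : ℂ → E) :
    ∫ z : ℂ, g (Complex.exp (Complex.I * θ) * z) = ∫ z : ℂ, g z :=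
  (measurePreserving_rot θ).integral_comp (measurableEmbedding_rot θ) g

theorem phaseRot_spaceRot_phaseRot_spaceRot (γ γ' θ θ' : ℝ) (v : ℂ → ℂ) :
    phaseRot γ (spaceRot θ (phaseRot γ' (spaceRot θ' v))) =
      phaseRot (γ + γ') (spaceRot (θ + θ') v) := by
  funext z
  simp only [phaseRot, spaceRot]
  push_cast
  rw [mul_add, Complex.exp_add, mul_add, Complex.exp_add, mul_assoc]
  congr 3
  ring

theorem phaseRot_zero_spaceRot_zero (v : ℂ → ℂ) : phaseRot 0 (spaceRot 0 v) = v := by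
  funext z
  simp [phaseRot, spaceRot]

theorem rotatingWave_eq (lam mu : ℝ) (v : ℂ → ℂ) (t : ℝ) :
    rotatingWave lam mu v t = phaseRot (-lam * t) (spaceRot (-mu * t) v) := by
  funext z
  simp only [phaseRot, spaceRot, rotatingWave]
  push_cast
  congr 2
  · ring_nf
  · ring_nf

theorem rotatingWave_zero (lam mu : ℝ) (v : ℂ → ℂ) : rotatingWave lam mu v 0 = v := by
  rw [rotatingWave_eq]
  simpa using phaseRot_zero_spaceRot_zero v

theorem rotatingWave_rot (lam mu γ θ : ℝ) (v : ℂ → ℂ) (t : ℝ) :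
    rotatingWave lam mu (phaseRot γ (spaceRot θ v)) t =
      phaseRot γ (spaceRot θ (rotatingWave lam mu v t)) := by
  rw [rotatingWave_eq, rotatingWave_eq, phaseRot_spaceRot_phaseRot_spaceRot,
    phaseRot_spaceRot_phaseRot_spaceRot, add_comm γ, add_comm θ]

/-- Rotations commute with the rotating-wave evolution, so equivalence of waves reduces to
equivalence of profiles. -/
theorem eqModRotations_iff (u : ℝ → ℂ → ℂ) (lam mu : ℝ) (v : ℂ → ℂ) :
    EqModRotations u (rotatingWave lam mu v) ↔
      ∃ γ θ : ℝ, u = rotatingWave lam mu (phaseRot γ (spaceRot θ v)) := by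
  unfold EqModRotations
  refine exists_congr fun γ => exists_congr fun θ => ?_
  rw [funext_iff]
  exact forall_congr' fun t => by rw [rotatingWave_rot]

/-- The substitution `w ↦ e^{iθ} w` preserves Lebesgue measure and the kernel, which depends on `w̄
z`, `|w|` and `|z|` only; the cubic term is gauge covariant. -/
theorem nonlin_rot (γ θ : ℝ) (v : ℂ → ℂ) :
    nonlin (phaseRot γ (spaceRot θ v)) = phaseRot γ (spaceRot θ (nonlin v)) := by
  funext z
  simp only [phaseRot, spaceRot, nonlin, proj, norm_mul, norm_exp_I_mul, one_mul]
  rw [mul_left_comm]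
  congr 1
  rw [← integral_const_mul]
  symm
  rw [← integral_comp_rot θ]
  refine integral_congr_ae (Filter.Eventually.of_forall fun w => ?_)
  simp only [norm_mul, norm_exp_I_mul, one_mul, map_mul]
  have : conj (Complex.exp (Complex.I * θ)) * Complex.exp (Complex.I * θ) = 1 := by
    rw [mul_comm, ← ofReal_norm_sq, norm_exp_I_mul]
    simp
  have h2 : conj (Complex.exp (Complex.I * θ)) * conj w * (Complex.exp (Complex.I * θ) * z) =
      conj w * z := by
    linear_combination conj w * z * this
  rw [h2]
  ring

theorem isGaussianHolomorphic_continuous {u : ℂ → ℂ} (hu : IsGaussianHolomorphic u) :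
    Continuous u := by
  obtain ⟨f, hf, h⟩ := hu
  rw [funext h]
  have := hf.continuous
  fun_prop

theorem rot_mem_enlargedFockSpace (γ θ : ℝ) {v : ℂ → ℂ} (hv : v ∈ enlargedFockSpace) :
    phaseRot γ (spaceRot θ v) ∈ enlargedFockSpace := by
  obtain ⟨C, N, hC, hb⟩ := exists_polynomial_bound hv
  have hg : IsGaussianHolomorphic (phaseRot γ (spaceRot θ v)) := by
    obtain ⟨f, hf, h⟩ := hv.1
    refine ⟨fun z => Complex.exp (Complex.I * γ) * f (Complex.exp (Complex.I * θ) * z),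
      (hf.comp (differentiable_id.const_mul _)).const_mul _, fun z => ?_⟩
    simp only [phaseRot, spaceRot]
    rw [h, norm_spaceRot_arg]
    ring
  refine ⟨hg, isTempered_of_bound (isGaussianHolomorphic_continuous hg) hC.le (N := N) fun z => ?_⟩
  rw [norm_phaseRot_spaceRot]
  simpa only [norm_spaceRot_arg] using hb (Complex.exp (Complex.I * θ) * z)

theorem IsProfile.rot {lam mu : ℝ} {v : ℂ → ℂ} (h : IsProfile lam mu v) (γ θ : ℝ) :
    IsProfile lam mu (phaseRot γ (spaceRot θ v)) := by
  obtain ⟨hv, f, hf, hvf, heq⟩ := h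
  refine ⟨rot_mem_enlargedFockSpace γ θ hv,
    fun z => Complex.exp (Complex.I * γ) * f (Complex.exp (Complex.I * θ) * z),
      (hf.comp (differentiable_id.const_mul _)).const_mul _, fun z => ?_, fun z => ?_⟩
  · simp only [phaseRot, spaceRot]
    rw [hvf, norm_spaceRot_arg]
    ring
  · have hd : HasDerivAt (fun z => Complex.exp (Complex.I * γ) * f (Complex.exp (Complex.I * θ) * z))
        (Complex.exp (Complex.I * γ) * (deriv f (Complex.exp (Complex.I * θ) * z) *
          (Complex.exp (Complex.I * θ) * 1))) z :=
      (((hf _).hasDerivAt).comp z ((hasDerivAt_id z).const_mul _)).const_mul _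
    rw [hd.deriv, nonlin_rot]
    simp only [phaseRot, spaceRot]
    rw [← heq, norm_spaceRot_arg]
    ring

theorem hasDerivAt_rotatingWave (lam mu : ℝ) {v f : ℂ → ℂ} (hf : Differentiable ℂ f)
    (hvf : ∀ z, v z = (Real.exp (-‖z‖ ^ 2 / 2) : ℂ) * f z) (t : ℝ) (z : ℂ) :
    HasDerivAt (fun s => rotatingWave lam mu v s z)
      (-Complex.I * (Complex.exp (-Complex.I * lam * t) * ((Real.exp (-‖z‖ ^ 2 / 2) : ℂ) *
        (lam * f (Complex.exp (-Complex.I * mu * t) * z) + mu *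
          (Complex.exp (-Complex.I * mu * t) * z *
            deriv f (Complex.exp (-Complex.I * mu * t) * z)))))) t := by
  have e : ∀ (c s : ℝ), -Complex.I * c * s = Complex.I * ((-c * s : ℝ) : ℂ) := fun c s => by
    push_cast; ring
  have h0 : (fun s : ℝ => rotatingWave lam mu v s z) = fun s : ℝ =>
      Complex.exp (-Complex.I * lam * s) * ((Real.exp (-‖z‖ ^ 2 / 2) : ℂ) *
        f (Complex.exp (-Complex.I * mu * s) * z)) := by
    funext s
    rw [rotatingWave, hvf, e mu, norm_spaceRot_arg]
  have hE : ∀ c : ℝ, HasDerivAt (fun s : ℝ => Complex.exp (-Complex.I * c * s))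
      (Complex.exp (-Complex.I * c * t) * (-Complex.I * c * 1)) t := fun c =>
    ((hasDerivAt_id t).ofReal_comp.const_mul (-Complex.I * c)).cexp
  have hF : HasDerivAt (fun s : ℝ => f (Complex.exp (-Complex.I * mu * s) * z))
      (deriv f (Complex.exp (-Complex.I * mu * t) * z) *
        (Complex.exp (-Complex.I * mu * t) * (-Complex.I * mu * 1) * z)) t :=
    ((hf _).hasDerivAt).comp_of_eq t ((hE mu).mul_const z) rfl
  rw [h0]
  refine ((hE lam).mul (hF.const_mul _)).congr_deriv ?_
  ring

/-- At each time the wave is a rotated copy of `v`, so covariance of the nonlinearity carries the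
profile equation to every `t`; conversely, time `0` alone already gives it back. -/
theorem IsProfile.isSolution {lam mu : ℝ} {v : ℂ → ℂ} (h : IsProfile lam mu v) :
    IsSolution (rotatingWave lam mu v) := by
  have h' := h
  obtain ⟨hv, f, hf, hvf, heq⟩ := h
  refine ⟨fun t => ?_, fun t z => ⟨_, hasDerivAt_rotatingWave lam mu hf hvf t z, ?_⟩⟩
  · rw [rotatingWave_eq]
    exact rot_mem_enlargedFockSpace _ _ hv
  · rw [rotatingWave_eq, nonlin_rot]
    simp only [phaseRot, spaceRot]
    have e : ∀ (c s : ℝ), Complex.I * ((-c * s : ℝ) : ℂ) = -Complex.I * c * s := fun c s => by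
      push_cast; ring
    have h1 := heq (Complex.exp (Complex.I * ((-mu * t : ℝ) : ℂ)) * z)
    rw [norm_spaceRot_arg] at h1
    rw [← h1, e, e, ← mul_assoc, mul_neg, Complex.I_mul_I, neg_neg, one_mul]

theorem isProfile_of_isSolution {lam mu : ℝ} {v : ℂ → ℂ}
    (h : IsSolution (rotatingWave lam mu v)) : IsProfile lam mu v := by
  have hv : v ∈ enlargedFockSpace := by simpa only [rotatingWave_zero] using h.1 0
  obtain ⟨f, hf, hvf⟩ := hv.1
  refine ⟨hv, f, hf, hvf, fun z => ?_⟩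
  obtain ⟨d, hd, hd2⟩ := h.2 0 z
  rw [hd.unique (hasDerivAt_rotatingWave lam mu hf hvf 0 z), rotatingWave_zero] at hd2
  rw [← hd2]
  simp only [Complex.ofReal_zero, mul_zero, Complex.exp_zero, one_mul]
  linear_combination ((Real.exp (-‖z‖ ^ 2 / 2) : ℂ) * (lam * f z + mu * (z * deriv f z))) *
    Complex.I_sq

theorem isMPStationaryWave_iff (u : ℝ → ℂ → ℂ) : IsMPStationaryWave u ↔
    ∃ (lam mu : ℝ) (v : ℂ → ℂ), IsProfile lam mu v ∧ u = rotatingWave lam mu v := by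
  constructor
  · rintro ⟨h, lam, mu, v, hv, hu⟩
    have e : u = rotatingWave lam mu v := funext fun t => funext fun z => hu t z
    exact ⟨lam, mu, v, isProfile_of_isSolution (e ▸ h), e⟩
  · rintro ⟨lam, mu, v, hv, rfl⟩
    exact ⟨hv.isSolution, lam, mu, v, hv.1, fun t z => rfl⟩

theorem rotatingWave_mu_zero (lam : ℝ) (v : ℂ → ℂ) (t : ℝ) (z : ℂ) :
    rotatingWave lam 0 v t z = Complex.exp (-Complex.I * lam * t) * v z := by
  simp [rotatingWave]

theorem isMStationaryWave_iff (u : ℝ → ℂ → ℂ) : IsMStationaryWave u ↔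
    ∃ (lam : ℝ) (v : ℂ → ℂ), IsProfile lam 0 v ∧ u = rotatingWave lam 0 v := by
  constructor
  · rintro ⟨h, lam, v, hv, hu⟩
    have e : u = rotatingWave lam 0 v := funext fun t => funext fun z => by
      rw [rotatingWave_mu_zero, hu]
    exact ⟨lam, v, isProfile_of_isSolution (e ▸ h), e⟩
  · rintro ⟨lam, v, hv, rfl⟩
    exact ⟨hv.isSolution, lam, v, hv.1, fun t z => rotatingWave_mu_zero lam v t z⟩

/-- The phase in `magTrans` is the one that makes the kernel of `Π` invariant under simultaneous
translation of `z` and `w`. By contrast `Λ` is not invariant, so the translation centre survives in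
the profile equation through `μ`. -/
theorem nonlin_magTrans (α : ℂ) (v : ℂ → ℂ) : nonlin (magTrans α v) = magTrans α (nonlin v) := by
  funext z
  simp only [magTrans, nonlin, proj]
  have hn : ∀ w : ℂ, ‖Complex.exp ((conj w * α - w * conj α) / 2)‖ = 1 := by
    intro w
    rw [Complex.norm_exp, Real.exp_eq_one_iff]
    simp
  rw [mul_right_comm, mul_right_comm (1 / (Real.pi : ℂ)), mul_assoc (1 / (Real.pi : ℂ)),
    mul_assoc (1 / (Real.pi : ℂ)), mul_assoc (1 / (Real.pi : ℂ))]
  congr 1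
  rw [← integral_sub_right_eq_self _ α, mul_assoc, ← integral_mul_const, ← integral_const_mul,
    ← integral_const_mul]
  refine integral_congr_ae (Filter.Eventually.of_forall fun w => ?_)
  simp only [norm_mul, hn, mul_one, sub_add_cancel]
  push_cast
  simp only [ofReal_norm_sq]
  have h1 : Complex.exp (conj (w - α) * z - (w - α) * conj (w - α) / 2) *
      Complex.exp ((conj (w - α) * α - (w - α) * conj α) / 2) * Complex.exp (-(z * conj z) / 2) =
      Complex.exp (conj w * (z + α) - w * conj w / 2) *
        Complex.exp (-((z + α) * conj (z + α)) / 2) * Complex.exp ((conj z * α - z * conj α) / 2) := by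
    simp only [← Complex.exp_add]
    congr 1
    simp only [map_add, map_sub]
    ring
  linear_combination (v w * conj (v w) * v w) * h1

end LLL

end

/-! ### Growth constraints and normal forms of profiles -/

noncomputable section

namespace LLL

open scoped ComplexConjugate
open Polynomial

theorem exists_norm_eval_le (P : ℂ[X]) :
    ∃ C : ℝ, 0 ≤ C ∧ ∀ z : ℂ, ‖P.eval z‖ ≤ C * (1 + ‖z‖) ^ P.natDegree := by
  refine ⟨∑ i ∈ Finset.range (P.natDegree + 1), ‖P.coeff i‖, by positivity, fun z => ?_⟩
  rw [eval_eq_sum_range, Finset.sum_mul]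
  refine (norm_sum_le _ _).trans (Finset.sum_le_sum fun i hi => ?_)
  rw [norm_mul, norm_pow]
  have hi : i ≤ P.natDegree := by simpa [Nat.lt_succ_iff] using hi
  have h0 := norm_nonneg z
  calc ‖P.coeff i‖ * ‖z‖ ^ i ≤ ‖P.coeff i‖ * (1 + ‖z‖) ^ i := by gcongr; linarith
    _ ≤ _ := by gcongr; linarith

theorem isGaussianHolomorphic_gaussProfile (P : ℂ[X]) (a b : ℂ) :
    IsGaussianHolomorphic (gaussProfile P a b) :=
  ⟨fun z => P.eval z * Complex.exp (a * z ^ 2 / 2 + b * z), by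
    have := P.differentiable
    fun_prop, fun _ => rfl⟩

theorem norm_gaussProfile (P : ℂ[X]) (a b z : ℂ) : ‖gaussProfile P a b z‖ =
    ‖P.eval z‖ * Real.exp (-‖z‖ ^ 2 / 2 + (a * z ^ 2 / 2 + b * z).re) := by
  rw [gaussProfile, norm_mul, norm_mul, Complex.norm_exp, Complex.norm_real,
    Real.norm_of_nonneg (Real.exp_pos _).le, Real.exp_add]
  ring

theorem gaussProfile_mem_enlargedFockSpace (P : ℂ[X]) {a b : ℂ} {K : ℝ}
    (h : ∀ z : ℂ, -‖z‖ ^ 2 / 2 + (a * z ^ 2 / 2 + b * z).re ≤ K) :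
    gaussProfile P a b ∈ enlargedFockSpace := by
  have hg := isGaussianHolomorphic_gaussProfile P a b
  obtain ⟨C, hC, hb⟩ := exists_norm_eval_le P
  refine ⟨hg, isTempered_of_bound (isGaussianHolomorphic_continuous hg) (C := C * Real.exp K)
    (N := P.natDegree) (by positivity) fun z => ?_⟩
  rw [norm_gaussProfile]
  calc _ ≤ C * (1 + ‖z‖) ^ P.natDegree * Real.exp K := by
        gcongr
        · exact hb z
        · exact h z
    _ = _ := by ring

theorem exp_quadratic_growth {c C κ β R : ℝ} {N : ℕ} (hc : 0 < c)
    (h : ∀ x : ℝ, R ≤ x → c * Real.exp (κ * x ^ 2 + β * x) ≤ C * (1 + x) ^ N) :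
    κ ≤ 0 ∧ (κ = 0 → β ≤ 0) := by
  have key : ∀ δ R' : ℝ, 0 < δ → ¬ ∀ x, R' ≤ x → c * Real.exp (δ * x) ≤ C * (1 + x) ^ N := by
    intro δ R' hδ h'
    -- The term of order `N + 1` of the exponential series alone outgrows `(1 + x)^N`; `x` is chosen
    -- so that it does.
    set A : ℝ := c * δ ^ (N + 1) / (N + 1).factorial with hA
    have hA0 : 0 < A := by positivity
    set x : ℝ := max (max R' 1) ((|C| * 2 ^ N + 1) / A) with hx
    have hxR : R' ≤ x := (le_max_left _ _).trans (le_max_left _ _)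
    have hx1 : 1 ≤ x := (le_max_right _ _).trans (le_max_left _ _)
    have hxA : |C| * 2 ^ N + 1 ≤ A * x := by
      rw [← div_le_iff₀' hA0]; exact le_max_right _ _
    have h1 := Real.pow_div_factorial_le_exp (δ * x) (by positivity) (N + 1)
    have h2 : A * x * x ^ N ≤ |C| * 2 ^ N * x ^ N := by
      calc A * x * x ^ N = c * ((δ * x) ^ (N + 1) / (N + 1).factorial) := by
            rw [hA]; ring
        _ ≤ c * Real.exp (δ * x) := by gcongr
        _ ≤ C * (1 + x) ^ N := h' x hxR
        _ ≤ |C| * (2 * x) ^ N := by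
          gcongr
          · exact le_abs_self C
          · linarith
        _ = _ := by rw [mul_pow]; ring
    have h3 := le_of_mul_le_mul_right h2 (by positivity)
    linarith
  constructor
  · by_contra! hκ
    refine key 1 (max R (max 0 ((1 - β) / κ))) one_pos fun x hx => ?_
    have hxR : R ≤ x := (le_max_left _ _).trans hx
    have hx0 : 0 ≤ x := (le_max_left _ _).trans ((le_max_right _ _).trans hx)
    have hx1 : (1 - β) / κ ≤ x := (le_max_right _ _).trans ((le_max_right _ _).trans hx)
    rw [div_le_iff₀ hκ] at hx1
    refine le_trans ?_ (h x hxR)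
    gcongr
    nlinarith
  · rintro rfl
    by_contra! hβ
    refine key β R hβ fun x hx => ?_
    simpa using h x hx

theorem gaussProfile_growth {P : ℂ[X]} (hP : P ≠ 0) {a : ℝ} {b : ℂ}
    (h : gaussProfile P a b ∈ enlargedFockSpace) : a ≤ 1 ∧ (a = 1 → b.re = 0) := by
  obtain ⟨C, N, hC, hb⟩ := exists_polynomial_bound h
  obtain ⟨c, R, hc, hR⟩ := exists_le_norm_eval hP
  -- Both ends of the real axis are tested: either one bounds `a`, and when `a = 1` the two give `Re
  -- b ≤ 0` and `-Re b ≤ 0`.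
  have key : ∀ ε : ℝ, (ε = 1 ∨ ε = -1) → ∀ x : ℝ, max R 0 ≤ x →
      c * Real.exp ((a - 1) / 2 * x ^ 2 + ε * b.re * x) ≤ C * (1 + x) ^ N := by
    intro ε hε x hx
    have hx0 : 0 ≤ x := (le_max_right _ _).trans hx
    have hε2 : ε ^ 2 = 1 := by rcases hε with rfl | rfl <;> norm_num
    have hn : ‖((ε * x : ℝ) : ℂ)‖ = x := by
      rw [Complex.norm_real, norm_mul, Real.norm_of_nonneg hx0]
      rcases hε with rfl | rfl <;> simp
    have h1 := hb ((ε * x : ℝ) : ℂ)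
    rw [norm_gaussProfile, hn] at h1
    have e : -x ^ 2 / 2 + ((a : ℂ) * ((ε * x : ℝ) : ℂ) ^ 2 / 2 + b * ((ε * x : ℝ) : ℂ)).re =
        (a - 1) / 2 * x ^ 2 + ε * b.re * x := by
      have : ((a : ℂ) * ((ε * x : ℝ) : ℂ) ^ 2 / 2).re = a * (ε * x) ^ 2 / 2 := by
        rw [← Complex.ofReal_pow, ← Complex.ofReal_mul, ← Complex.ofReal_ofNat,
          ← Complex.ofReal_div, Complex.ofReal_re]
      rw [Complex.add_re, this, Complex.re_mul_ofReal, mul_pow, hε2]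
      ring
    rw [e] at h1
    refine le_trans ?_ h1
    gcongr
    exact hR _ (by rw [hn]; exact (le_max_left _ _).trans hx)
  have k1 := exp_quadratic_growth hc (key 1 (Or.inl rfl))
  have k2 := exp_quadratic_growth hc (key (-1) (Or.inr rfl))
  refine ⟨by linarith [k1.1], fun ha => ?_⟩
  have h1 := k1.2 (by rw [ha]; norm_num)
  have h2 := k2.2 (by rw [ha]; norm_num)
  linarith

theorem spaceRot_gaussProfile (θ : ℝ) (P : ℂ[X]) (a b : ℂ) :
    spaceRot θ (gaussProfile P a b) = gaussProfile (P.comp (C (Complex.exp (Complex.I * θ)) * X))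
      (a * Complex.exp (Complex.I * θ) ^ 2) (b * Complex.exp (Complex.I * θ)) := by
  funext z
  rw [spaceRot, gaussProfile, gaussProfile, norm_spaceRot_arg, eval_comp, eval_mul, eval_C, eval_X]
  congr 3
  ring

theorem exists_rotation_gaussProfile {P : ℂ[X]} (hP : P ≠ 0) (a b : ℂ) :
    ∃ (θ : ℝ) (P' : ℂ[X]) (b' : ℂ), P' ≠ 0 ∧
      spaceRot θ (gaussProfile P a b) = gaussProfile P' (‖a‖ : ℝ) b' := by
  -- Rotating by `θ` multiplies `a` by `e^{2iθ}`, so half the argument of `a` suffices.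
  refine ⟨-(Complex.arg a / 2),
    P.comp (C (Complex.exp (Complex.I * (-(Complex.arg a / 2) : ℝ))) * X),
    b * Complex.exp (Complex.I * (-(Complex.arg a / 2) : ℝ)), ?_, ?_⟩
  rotate_left
  · rw [spaceRot_gaussProfile]
    congr 1
    rw [← Complex.exp_nat_mul]
    nth_rewrite 1 [← Complex.norm_mul_exp_arg_mul_I a]
    rw [mul_assoc, ← Complex.exp_add]
    push_cast
    rw [show Complex.arg a * Complex.I + 2 * (Complex.I * -(Complex.arg a / 2)) = 0 by ring,
      Complex.exp_zero, mul_one]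
  · rw [Ne, comp_C_mul_X_eq_zero_iff]
    · exact hP
    · exact mem_nonZeroDivisors_of_ne_zero (Complex.exp_ne_zero _)

theorem hasDerivAt_eval_mul_exp (P : ℂ[X]) (a b z : ℂ) :
    HasDerivAt (fun z => P.eval z * Complex.exp (a * z ^ 2 / 2 + b * z))
      (((derivative P).eval z + (a * z + b) * P.eval z) * Complex.exp (a * z ^ 2 / 2 + b * z)) z := by
  have h1 : HasDerivAt (fun z : ℂ => a * z ^ 2 / 2 + b * z) (a * (2 * z ^ (2 - 1) * 1) / 2 + b * 1) z :=
    ((((hasDerivAt_id z).pow 2).const_mul a).div_const 2).add ((hasDerivAt_id z).const_mul b)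
  refine ((P.hasDerivAt z).mul h1.cexp).congr_deriv ?_
  simp
  ring

theorem gauss_ne_zero (z : ℂ) : (Real.exp (-‖z‖ ^ 2 / 2) : ℂ) ≠ 0 := by
  exact_mod_cast (Real.exp_pos _).ne'

/-- The profile equation for an explicit holomorphic factor. -/
theorem isProfile_iff {lam mu : ℝ} {v f f' : ℂ → ℂ} (hf : ∀ z, HasDerivAt f (f' z) z)
    (hvf : ∀ z, v z = (Real.exp (-‖z‖ ^ 2 / 2) : ℂ) * f z) : IsProfile lam mu v ↔
      v ∈ enlargedFockSpace ∧
        ∀ z, (Real.exp (-‖z‖ ^ 2 / 2) : ℂ) * (lam * f z + mu * (z * f' z)) = nonlin v z := by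
  unfold IsProfile
  refine and_congr_right fun _ => ⟨?_, fun h => ⟨f, fun z => (hf z).differentiableAt, hvf, fun z => ?_⟩⟩
  · rintro ⟨g, hg, hvg, h⟩ z
    have : g = f := by
      funext z
      have := hvg z
      rw [hvf] at this
      exact (mul_left_cancel₀ (gauss_ne_zero z) this).symm
    subst this
    rw [← h, (hf z).deriv]
  · rw [(hf z).deriv, h]

theorem isProfile_gaussProfile_iff {lam mu a : ℝ} (ha : 0 ≤ a) (ha1 : a ≤ 1) (b : ℂ) {P : ℂ[X]}
    {n : ℕ} (hP : P.natDegree ≤ n) : IsProfile lam mu (gaussProfile P a b) ↔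
      gaussProfile P a b ∈ enlargedFockSpace ∧ ∀ z,
        (lam * P.eval z + mu * (z * ((derivative P).eval z + (a * z + b) * P.eval z))) *
          Complex.exp (a * z ^ 2 / 2 + b * z) = (1 / Real.sqrt (4 - 2 * a ^ 2) : ℝ) *
        ((gaussPoly a (2 * b) (2 * n) n (P ^ 2) (P.map (starRingEnd ℂ))).eval (z + conj b) *
          Complex.exp (gaussExpo a (2 * b) (z + conj b))) := by
  rw [isProfile_iff (v := gaussProfile P a b) (hasDerivAt_eval_mul_exp P a b) fun _ => rfl]
  refine and_congr_right fun _ => forall_congr' fun z => ?_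
  rw [nonlin_gaussProfile ha ha1 b hP z, mul_right_inj' (gauss_ne_zero z)]
  refine Eq.congr ?_ rfl
  ring

theorem magTrans_gaussProfile (Q : ℂ[X]) (b z : ℂ) : magTrans (-conj b) (gaussProfile Q 0 0) z =
    (Real.exp (-‖z‖ ^ 2 / 2) : ℂ) *
      (Q.eval (z - conj b) * Complex.exp (b * z - b * conj b / 2)) := by
  rw [magTrans, gaussProfile, ← sub_eq_add_neg]
  push_cast
  rw [ofReal_norm_sq, ofReal_norm_sq]
  have : Complex.exp (-((z - conj b) * conj (z - conj b)) / 2) *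
      Complex.exp ((conj z * -conj b - z * conj (-conj b)) / 2) =
      Complex.exp (-(z * conj z) / 2) * Complex.exp (b * z - b * conj b / 2) := by
    rw [← Complex.exp_add, ← Complex.exp_add]
    congr 1
    simp only [map_sub, map_neg, Complex.conj_conj]
    ring
  simp only [zero_mul, zero_div, add_zero, Complex.exp_zero, mul_one]
  linear_combination Q.eval (z - conj b) * this

theorem gaussProfile_eq_magTrans (P : ℂ[X]) (b : ℂ) : gaussProfile P 0 b =
    magTrans (-conj b) (gaussProfile (C (Complex.exp (b * conj b / 2)) * P.comp (X + C (conj b))) 0 0) := by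
  funext z
  rw [magTrans_gaussProfile, gaussProfile]
  simp only [eval_mul, eval_C, eval_comp, eval_add, eval_X, sub_add_cancel]
  rw [Complex.exp_sub, show (0 : ℂ) * z ^ 2 / 2 + b * z = b * z by ring]
  field_simp [Complex.exp_ne_zero]

theorem magTrans_gaussProfile_mem (Q : ℂ[X]) (b : ℂ) :
    magTrans (-conj b) (gaussProfile Q 0 0) ∈ enlargedFockSpace := by
  have e : magTrans (-conj b) (gaussProfile Q 0 0) =
      gaussProfile (C (Complex.exp (-(b * conj b / 2))) * Q.comp (X - C (conj b))) 0 b := by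
    funext z
    rw [magTrans_gaussProfile, gaussProfile]
    simp only [eval_mul, eval_C, eval_comp, sub_eq_add_neg, Complex.exp_add]
    simp
    ring
  rw [e]
  refine gaussProfile_mem_enlargedFockSpace _ (K := ‖b‖ ^ 2 / 2) fun z => ?_
  have h1 : (b * z).re ≤ ‖b‖ * ‖z‖ := (Complex.re_le_norm _).trans (norm_mul_le _ _)
  simp only [zero_mul, zero_div, zero_add]
  nlinarith [sq_nonneg (‖b‖ - ‖z‖)]

theorem hasDerivAt_eval_sub_mul_exp (Q : ℂ[X]) (b z : ℂ) :
    HasDerivAt (fun z => Q.eval (z - conj b) * Complex.exp (b * z - b * conj b / 2))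
      (((derivative Q).eval (z - conj b) + b * Q.eval (z - conj b)) *
        Complex.exp (b * z - b * conj b / 2)) z := by
  have h1 : HasDerivAt (fun z : ℂ => b * z - b * conj b / 2) (b * 1) z :=
    ((hasDerivAt_id z).const_mul b).sub_const _
  have h2 : HasDerivAt (fun z : ℂ => Q.eval (z - conj b)) ((derivative Q).eval (z - conj b) * 1) z :=
    (Q.hasDerivAt _).comp z ((hasDerivAt_id z).sub_const _)
  refine (h2.mul h1.cexp).congr_deriv ?_
  ring

/-- In the variable `w = z - b̄` both sides carry the same nonvanishing exponential, leaving a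
polynomial identity. In it `z ∂_z` reads `(w + b̄)(∂_w + b)`, and `1/2` is the Gaussian constant at
`a = 0`. -/
theorem isProfile_magTrans_iff {lam mu : ℝ} (b : ℂ) {Q : ℂ[X]} {n : ℕ} (hQ : Q.natDegree ≤ n) :
    IsProfile lam mu (magTrans (-conj b) (gaussProfile Q 0 0)) ↔
      C (lam : ℂ) * Q + C (mu : ℂ) * ((X + C (conj b)) * (derivative Q + C b * Q)) =
        C (1 / 2) * gaussPoly 0 0 (2 * n) n (Q ^ 2) (Q.map (starRingEnd ℂ)) := by
  have hf := hasDerivAt_eval_sub_mul_exp Q b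
  have hs : (1 / Real.sqrt (4 - 2 * 0 ^ 2) : ℝ) = 1 / 2 := by
    rw [show (4 - 2 * 0 ^ 2 : ℝ) = 2 ^ 2 by norm_num, Real.sqrt_sq (by norm_num)]
  have hnl : ∀ z, nonlin (gaussProfile Q 0 0) z = gaussProfile (C (1 / 2) *
      gaussPoly 0 0 (2 * n) n (Q ^ 2) (Q.map (starRingEnd ℂ))) 0 0 z := by
    intro z
    have := nonlin_gaussProfile le_rfl zero_le_one 0 hQ z
    rw [hs] at this
    simp only [Complex.ofReal_zero] at this
    rw [this, gaussProfile, gaussExpo]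
    simp
  rw [isProfile_iff hf (magTrans_gaussProfile Q b)]
  refine (and_iff_right (magTrans_gaussProfile_mem Q b)).trans ?_
  rw [nonlin_magTrans, funext hnl]
  simp only [magTrans_gaussProfile]
  have hz : ∀ z, (Real.exp (-‖z‖ ^ 2 / 2) : ℂ) ≠ 0 := gauss_ne_zero
  constructor
  · intro h
    refine Polynomial.funext fun w => ?_
    have h1 := mul_left_cancel₀ (hz _) (h (w + conj b))
    simp only [add_sub_cancel_right] at h1
    have h2 := Complex.exp_ne_zero (b * (w + conj b) - b * conj b / 2)
    apply mul_right_cancel₀ h2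
    rw [← h1]
    simp
    ring
  · intro h z
    congr 1
    have h1 := congrArg (fun p => eval (z - conj b) p) h
    simp only [eval_add, eval_mul, eval_C, eval_X, sub_add_cancel] at h1
    simp only [eval_mul, eval_C]
    rw [← h1]
    ring

end LLL

end

/-! ### Profiles with a quadratic exponential factor -/

noncomputable section

namespace LLL

open scoped ComplexConjugate
open Polynomial

theorem cubic_coeffs_eq_zero {A B D E : ℂ} (h : ∀ z : ℂ, A * z ^ 3 + B * z ^ 2 + D * z + E = 0) :
    A = 0 ∧ B = 0 ∧ D = 0 ∧ E = 0 := by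
  have h0 := h 0
  have h1 := h 1
  have h2 := h (-1)
  have h3 := h 2
  refine ⟨?_, ?_, ?_, ?_⟩
  · linear_combination (1 / 6) * h3 - (1 / 2) * h1 - (1 / 6) * h2 + (1 / 2) * h0
  · linear_combination (1 / 2) * h1 + (1 / 2) * h2 - h0
  · linear_combination -(1 / 6) * h3 + h1 - (1 / 3) * h2 - (1 / 2) * h0
  · linear_combination h0

theorem eval_gaussPoly_one (σ t : ℂ) (R S : ℂ[X]) : (gaussPoly 1 σ 2 1 R S).eval t =
    R.coeff 0 * S.coeff 0 + R.coeff 0 * S.coeff 1 * (σ + t) + R.coeff 1 * S.coeff 0 * (σ / 2 + t) +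
      R.coeff 1 * S.coeff 1 * ((σ / 2 + t) * (σ + t) + 1) +
      R.coeff 2 * S.coeff 0 * ((σ / 2 + t) ^ 2 + 1 / 2) +
      R.coeff 2 * S.coeff 1 * ((σ / 2 + t) ^ 2 * (σ + t) + 2 * (σ / 2 + t) + (σ + t) / 2) := by
  have h1 : (2 * σ / (4 - 2 * ((1 : ℝ) : ℂ) ^ 2)) = σ := by push_cast; ring
  have h2 : (2 * ((1 : ℝ) : ℂ) / (4 - 2 * ((1 : ℝ) : ℂ) ^ 2)) = 1 := by push_cast; ring
  simp only [gaussPoly, Finset.sum_range_succ, Finset.sum_range_zero, gaussK, pow_zero, pow_one,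
    Module.End.one_apply, gaussD_apply, h1, h2, zero_add]
  simp only [eval_add, eval_mul, eval_C, eval_X, eval_one, derivative_add, derivative_mul,
    derivative_C, derivative_X, derivative_one, derivative_zero, eval_zero, Complex.ofReal_one]
  ring

/-- Moving both exponentials to one side gives `A e^g = G'` with polynomials, so `g` is constant;
its quadratic coefficient determines `a`, and the degrees of `A` and `G'` then bound that of `P`. -/
theorem eq_one_of_isProfile {lam mu a : ℝ} (ha : 0 < a) (ha1 : a ≤ 1) {b : ℂ} {P : ℂ[X]}
    (hP : P ≠ 0) (h : IsProfile lam mu (gaussProfile P a b)) : a = 1 ∧ P.natDegree ≤ 1 := by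
  obtain ⟨-, h⟩ := (isProfile_gaussProfile_iff ha.le ha1 b le_rfl).1 h
  set n := P.natDegree with hn
  set G := gaussPoly a (2 * b) (2 * n) n (P ^ 2) (P.map (starRingEnd ℂ)) with hG
  have hden : 0 < 4 - 2 * a ^ 2 := by nlinarith
  have hdenC : (4 - 2 * a ^ 2 : ℂ) ≠ 0 := by exact_mod_cast hden.ne'
  set κ : ℂ := ((1 / Real.sqrt (4 - 2 * a ^ 2) : ℝ) : ℂ) with hκ
  have hκ0 : κ ≠ 0 := by
    have := Real.sqrt_pos.2 hden
    rw [hκ]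
    exact_mod_cast (one_div_pos.2 this).ne'
  have hcoef : G.coeff (2 * n + n) ≠ 0 := by
    rw [hG, (natDegree_gaussPoly_le _ _ _ _ _ _).2]
    have h1 : (P ^ 2).coeff (2 * n) ≠ 0 := by
      rw [coeff_pow_of_natDegree_le le_rfl, coeff_natDegree]
      exact pow_ne_zero _ (leadingCoeff_ne_zero.2 hP)
    have h2 : (P.map (starRingEnd ℂ)).coeff n ≠ 0 := by
      rw [coeff_map, coeff_natDegree]
      simpa using hP
    have h3 : (2 * a / (4 - 2 * a ^ 2) : ℂ) ≠ 0 := by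
      have : 0 < 2 * a / (4 - 2 * a ^ 2) := by positivity
      exact_mod_cast this.ne'
    have h4 : (1 / 2 * (1 + a * (2 * a / (4 - 2 * a ^ 2))) : ℂ) ≠ 0 := by
      have : 0 < 1 / 2 * (1 + a * (2 * a / (4 - 2 * a ^ 2))) := by positivity
      have h5 := Complex.ofReal_ne_zero.2 this.ne'
      push_cast at h5
      exact h5
    exact mul_ne_zero (mul_ne_zero h1 h2) (mul_ne_zero (pow_ne_zero _ h3) (pow_ne_zero _ h4))
  have hGdeg : G.natDegree = 3 * n := by
    have h1 := (natDegree_gaussPoly_le a (2 * b) (2 * n) n (P ^ 2) (P.map (starRingEnd ℂ))).1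
    have h2 := le_natDegree_of_ne_zero hcoef
    rw [← hG] at h1
    omega
  have hG0 : G ≠ 0 := by rintro h0; simp [h0] at hcoef
  set G' : ℂ[X] := C κ * G.comp (X + C (conj b)) with hG'
  have hG'deg : G'.natDegree = 3 * n := by
    rw [hG', natDegree_C_mul hκ0, natDegree_comp, natDegree_X_add_C, mul_one, hGdeg]
  have hG'0 : G' ≠ 0 := by
    refine mul_ne_zero (by simpa using hκ0) ?_
    rwa [Ne, comp_X_add_C_eq_zero_iff]
  set A : ℂ[X] := C (lam : ℂ) * P + C (mu : ℂ) * (X * (derivative P + (C (a : ℂ) * X + C b) * P))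
    with hA
  have hAe : ∀ z, A.eval z = lam * P.eval z +
      mu * (z * ((derivative P).eval z + (a * z + b) * P.eval z)) := fun z => by simp [hA]
  set g : ℂ[X] := C (a / 2 : ℂ) * X ^ 2 + C b * X - C (1 / (4 - 2 * a ^ 2) : ℂ) *
    (C (a / 2 * (2 * b) ^ 2 : ℂ) + C (2 * (2 * b)) * (X + C (conj b)) +
      C (a : ℂ) * (X + C (conj b)) ^ 2) with hg
  have hge : ∀ z, g.eval z = (a * z ^ 2 / 2 + b * z) - gaussExpo a (2 * b) (z + conj b) := by
    intro z
    simp [hg, gaussExpo]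
    field_simp
  have hAG : ∀ z, A.eval z * Complex.exp (g.eval z) = G'.eval z := by
    intro z
    have h1 := h z
    rw [← hAe] at h1
    rw [hge, Complex.exp_sub, ← mul_div_assoc, h1]
    simp only [hG', eval_mul, eval_C, eval_comp, eval_add, eval_X]
    field_simp [Complex.exp_ne_zero]
  have hA0 : A ≠ 0 := by
    intro h0
    refine hG'0 (Polynomial.funext fun z => ?_)
    rw [← hAG, h0]
    simp
  have hdg := derivative_eq_zero_of_mul_exp_eq hA0 hAG
  have ha_eq : a = 1 := by
    have hge' : ∀ z, (derivative g).eval z =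
        a * z + b - 1 / (4 - 2 * a ^ 2) * (4 * b + 2 * a * (z + conj b)) := by
      intro z
      simp only [hg, derivative_sub, derivative_add, derivative_C_mul, derivative_C, derivative_X,
        derivative_pow, eval_sub, eval_add, eval_mul, eval_C, eval_X, eval_one, eval_zero, eval_pow]
      push_cast
      ring
    have e0 := hge' 0
    have e1 := hge' 1
    rw [hdg, eval_zero] at e0 e1
    -- The coefficient of `z` in `g'` vanishes, which is `a = 2a / (4 - 2a²)`.
    have e2 : (a : ℂ) * (4 - 2 * a ^ 2) = 2 * a := by
      have e5 : (a : ℂ) = 1 / (4 - 2 * a ^ 2) * (2 * a) := by linear_combination e0 - e1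
      rw [one_div, inv_mul_eq_div, eq_div_iff hdenC] at e5
      exact e5
    have e3 : a * (4 - 2 * a ^ 2) = 2 * a := by exact_mod_cast e2
    have e4 : (4 - 2 * a ^ 2) = 2 := by
      have := mul_left_cancel₀ ha.ne' (e3.trans (mul_comm 2 a))
      exact this
    nlinarith
  refine ⟨ha_eq, ?_⟩
  have hgc : ∃ c : ℂ, g = C c := ⟨_, eq_C_of_derivative_eq_zero hdg⟩
  obtain ⟨c, hc⟩ := hgc
  have hAG' : C (Complex.exp c) * A = G' := by
    refine Polynomial.funext fun z => ?_
    rw [← hAG, hc]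
    simp [mul_comm]
  -- The two extra degrees come from `μ z · a z P`; with `deg G' = 3n` they leave `n ≤ 1`.
  have hAdeg : A.natDegree ≤ n + 2 := by
    have h1 : (derivative P).natDegree ≤ n := (natDegree_derivative_le P).trans (by omega)
    have h2 : ((C (a : ℂ) * X + C b) * P).natDegree ≤ n + 1 := by
      refine natDegree_mul_le.trans ?_
      have := natDegree_linear_le (a := (a : ℂ)) (b := b)
      omega
    refine natDegree_add_le_of_degree_le ((natDegree_C_mul_le _ _).trans (by omega))
      ((natDegree_C_mul_le _ _).trans (natDegree_mul_le.trans ?_))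
    rw [natDegree_X]
    have := natDegree_add_le_of_degree_le (h1.trans (Nat.le_succ n)) h2
    omega
  have := natDegree_C_mul_le (Complex.exp c) A
  rw [hAG', hG'deg] at this
  omega

theorem mul_conj_eq_norm_sq (c : ℂ) : c * conj c = ((‖c‖ ^ 2 : ℝ) : ℂ) := by
  rw [← ofReal_norm_sq]; push_cast; rfl

/-- The equation for `a = 1` and a profile of degree at most one. -/
theorem isProfile_linear_iff {lam mu s : ℝ} {c d : ℂ} :
    IsProfile lam mu (gaussProfile (C c * X + C d) (1 : ℝ) (Complex.I * s)) ↔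
      ∀ z : ℂ, lam * (c * z + d) + mu * (z * (c + (z + Complex.I * s) * (c * z + d))) =
        ((Real.exp (s ^ 2 / 2) / Real.sqrt 2 : ℝ) : ℂ) *
          (d ^ 2 * conj d + d ^ 2 * conj c * (z + Complex.I * s) + 2 * c * d * conj d * z +
            2 * c * d * conj c * (z * (z + Complex.I * s) + 1) + c ^ 2 * conj d * (z ^ 2 + 1 / 2) +
            c ^ 2 * conj c * (z ^ 2 * (z + Complex.I * s) + 2 * z + (z + Complex.I * s) / 2)) := by
  have hmem : gaussProfile (C c * X + C d) (1 : ℝ) (Complex.I * s) ∈ enlargedFockSpace := by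
    refine gaussProfile_mem_enlargedFockSpace _ (K := s ^ 2 / 4) fun z => ?_
    have h3 : ‖z‖ ^ 2 = z.re ^ 2 + z.im ^ 2 := by
      rw [← Complex.normSq_eq_norm_sq, Complex.normSq_apply]; ring
    have h4 : (((1 : ℝ) : ℂ) * z ^ 2 / 2 + Complex.I * s * z).re =
        (z.re ^ 2 - z.im ^ 2) / 2 - s * z.im := by
      simp [pow_two]
      ring
    rw [h4, h3]
    nlinarith [sq_nonneg (z.im + s / 2)]
  rw [isProfile_gaussProfile_iff zero_le_one le_rfl (Complex.I * s) (n := 1) natDegree_linear_le]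
  refine (and_iff_right hmem).trans (forall_congr' fun z => ?_)
  have hc : conj (Complex.I * s) = -(Complex.I * s) := by simp
  have hR : ∀ k, ((C c * X + C d) ^ 2 : ℂ[X]).coeff k =
      (C (c ^ 2) * X ^ 2 + C (2 * c * d) * X ^ 1 + C (d ^ 2) * X ^ 0).coeff k := by
    intro k
    congr 1
    simp only [C_mul, C_pow, C_ofNat]
    ring
  have hE : Complex.exp (gaussExpo (1 : ℝ) (2 * (Complex.I * s)) (z + conj (Complex.I * s))) =
      (Real.exp (s ^ 2 / 2) : ℂ) * Complex.exp (((1 : ℝ) : ℂ) * z ^ 2 / 2 + Complex.I * s * z) := by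
    push_cast
    rw [← Complex.exp_add, gaussExpo, hc]
    congr 1
    push_cast
    linear_combination (-(s : ℂ) ^ 2 / 2) * Complex.I_sq
  rw [hE, hc, mul_one, eval_gaussPoly_one]
  simp only [hR]
  simp only [coeff_add, coeff_C_mul, coeff_X_pow, coeff_map, coeff_X, coeff_C]
  have hs2 : (1 / Real.sqrt (4 - 2 * 1 ^ 2) : ℝ) = 1 / Real.sqrt 2 := by norm_num
  rw [hs2]
  have h0 := Complex.exp_ne_zero (((1 : ℝ) : ℂ) * z ^ 2 / 2 + Complex.I * s * z)
  set E := Complex.exp (((1 : ℝ) : ℂ) * z ^ 2 / 2 + Complex.I * s * z)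
  refine Iff.trans (Eq.congr ?_ ?_) (mul_left_inj' h0)
  · simp
  · simp
    ring

/-- Profiles with a Gaussian factor of full strength. -/
theorem classification_of_pos {lam mu a : ℝ} (ha : 0 < a) {b : ℂ} {P : ℂ[X]} (hP : P ≠ 0)
    (h : IsProfile lam mu (gaussProfile P a b)) : a = 1 ∧ ∃ c : ℂ, c ≠ 0 ∧
      ((∃ s : ℝ, b = Complex.I * s ∧ P = C c ∧ mu = 0 ∧
          lam = ‖c‖ ^ 2 * Real.exp (s ^ 2 / 2) / Real.sqrt 2) ∨
        ∃ r : ℝ, b = 0 ∧ P = C c * (X + C (Complex.I * r)) ∧ mu = ‖c‖ ^ 2 / Real.sqrt 2 ∧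
          lam = 1 / Real.sqrt 2 * (3 / 2 + r ^ 2) * ‖c‖ ^ 2) := by
  obtain ⟨ha1, hb⟩ := gaussProfile_growth hP h.1
  obtain ⟨rfl, hdeg⟩ := eq_one_of_isProfile ha ha1 hP h
  refine ⟨rfl, ?_⟩
  obtain ⟨s, rfl⟩ : ∃ s : ℝ, b = Complex.I * s :=
    ⟨b.im, by apply Complex.ext <;> simp [hb rfl]⟩
  obtain ⟨c, d, rfl⟩ := exists_eq_X_add_C_of_natDegree_le_one hdeg
  have heq := isProfile_linear_iff.1 h
  set κ : ℝ := Real.exp (s ^ 2 / 2) / Real.sqrt 2 with hκ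
  have hκ0 : (κ : ℂ) ≠ 0 := by
    have : 0 < κ := by positivity
    exact_mod_cast this.ne'
  by_cases hc : c = 0
  · subst hc
    have hd : d ≠ 0 := by rintro rfl; simp at hP
    simp only [map_zero, zero_mul, zero_add, mul_zero, add_zero] at heq
    obtain ⟨-, h2, h1, h0⟩ := cubic_coeffs_eq_zero (A := 0) (B := mu * d)
      (D := mu * (Complex.I * s) * d) (E := lam * d - κ * (d ^ 2 * conj d)) fun z => by
        linear_combination heq z
    have hmu : (mu : ℂ) = 0 := (mul_eq_zero.1 h2).resolve_right hd
    refine ⟨d, hd, Or.inl ⟨s, rfl, by simp, by exact_mod_cast hmu, ?_⟩⟩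
    have h3 : (lam : ℂ) = κ * (d * conj d) := by
      apply mul_right_cancel₀ hd
      linear_combination h0
    rw [mul_conj_eq_norm_sq] at h3
    have h4 : lam = κ * ‖d‖ ^ 2 := by exact_mod_cast h3
    rw [h4, hκ]
    ring
  -- Factoring out `c` leaves the unknown root `-δ`: the `z³` coefficient gives `μ = κN`, the `z²`
  -- one then gives `δ̄ = -δ`.
  · set δ : ℂ := d / c with hδ
    have hd : d = c * δ := by rw [hδ]; field_simp
    clear_value δ
    subst hd
    set N : ℂ := c * conj c with hN
    have hcc : conj c ≠ 0 := by simpa using hc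
    have hN0 : N ≠ 0 := mul_ne_zero hc hcc
    obtain ⟨h3, h2, h1, h0⟩ := cubic_coeffs_eq_zero (A := c * (mu - κ * N))
      (B := c * (mu * (δ + Complex.I * s) - κ * N * (2 * δ + conj δ + Complex.I * s)))
      (D := c * (lam + mu * (1 + Complex.I * s * δ) - κ * N * (δ ^ 2 + 2 * δ * conj δ +
        2 * δ * (Complex.I * s) + 5 / 2)))
      (E := c * (lam * δ - κ * N * (δ ^ 2 * conj δ + δ ^ 2 * (Complex.I * s) + 2 * δ + conj δ / 2 +
        Complex.I * s / 2))) fun z => by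
        have := heq z
        simp only [map_mul] at this
        rw [hN]
        linear_combination this
    have h3 := sub_eq_zero.1 ((mul_eq_zero.1 h3).resolve_left hc)
    have h2 := (mul_eq_zero.1 h2).resolve_left hc
    have h1 := (mul_eq_zero.1 h1).resolve_left hc
    have h0 := (mul_eq_zero.1 h0).resolve_left hc
    rw [h3] at h2 h1
    have hκN : (κ : ℂ) * N ≠ 0 := mul_ne_zero hκ0 hN0
    have hδc : conj δ = -δ := by
      have : (κ : ℂ) * N * (conj δ + δ) = 0 := by linear_combination -h2
      linear_combination (mul_eq_zero.1 this).resolve_left hκN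
    obtain ⟨r, rfl⟩ : ∃ r : ℝ, δ = Complex.I * r := by
      refine ⟨δ.im, ?_⟩
      have : δ.re = 0 := by
        have := congrArg Complex.re hδc
        simp at this
        linarith
      apply Complex.ext <;> simp [this]
    -- Eliminating `λ` between the two remaining coefficients leaves `κ N i s = 0`: a genuine zero
    -- of the profile excludes a linear term in the exponent.
    have hs : (Complex.I * s : ℂ) = 0 := by
      have : (κ : ℂ) * N * (Complex.I * s) = 0 := by
        rw [hδc] at h0 h1
        linear_combination 2 * (Complex.I * r) * h1 - 2 * h0
      exact (mul_eq_zero.1 this).resolve_left hκN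
    have hs0 : s = 0 := by simpa using hs
    subst hs0
    have hκ2 : κ = 1 / Real.sqrt 2 := by rw [hκ]; simp
    rw [hδc] at h1
    have hNr : N = ((‖c‖ ^ 2 : ℝ) : ℂ) := mul_conj_eq_norm_sq c
    refine ⟨c, hc, Or.inr ⟨r, hs, ?_, ?_, ?_⟩⟩
    · simp only [C_mul]; ring
    · have : mu = κ * ‖c‖ ^ 2 := by rw [hNr] at h3; exact_mod_cast h3
      rw [this, hκ2]; ring
    · have h5 : (lam : ℂ) = ((κ * ‖c‖ ^ 2 * (3 / 2 + r ^ 2) : ℝ) : ℂ) := by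
        rw [hNr] at h1
        push_cast at h1 ⊢
        linear_combination h1 - (κ * (‖c‖ : ℂ) ^ 2 * r ^ 2) * Complex.I_sq
      have h6 : lam = κ * ‖c‖ ^ 2 * (3 / 2 + r ^ 2) := by exact_mod_cast h5
      rw [h6, hκ2]
      ring

end LLL

end

/-! ### Profiles without quadratic factor: the polynomial identity -/

noncomputable section

namespace LLL

open scoped ComplexConjugate
open Polynomial

theorem gaussK_zero_zero (j : ℕ) : gaussK 0 0 j = C ((1 / 2) ^ j) * X ^ j := by
  induction j with
  | zero => simp [gaussK]
  | succ j ih =>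
    rw [gaussK, ih]
    simp only [pow_succ, C_mul, Complex.ofReal_zero, map_zero, zero_mul, add_zero]
    ring

theorem gaussD_zero_zero : gaussD 0 0 = (derivative : ℂ[X] →ₗ[ℂ] ℂ[X]) := by
  refine LinearMap.ext fun p => ?_
  rw [gaussD_apply]
  simp

/-- At `a = 0`, `s = 0` the moment polynomial of `w^j w̄^k` is the `k`-th derivative of `(t/2)^j`,
so only `j = l + k` contributes to degree `l`. -/
theorem coeff_gaussPoly_zero {N : ℕ} (M : ℕ) {R : ℂ[X]} (S : ℂ[X]) (hR : R.natDegree ≤ N) (l : ℕ) :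
    (gaussPoly 0 0 N M R S).coeff l = ∑ k ∈ Finset.range (M + 1),
      S.coeff k * (R.coeff (l + k) * ((1 / 2) ^ (l + k) * ((l + k).descFactorial k : ℂ))) := by
  rw [gaussPoly, Finset.sum_comm, finsetSum_coeff]
  refine Finset.sum_congr rfl fun k _ => ?_
  rw [finsetSum_coeff]
  have e : ∀ j, (C (R.coeff j * S.coeff k) * ((gaussD 0 0) ^ k) (gaussK 0 0 j)).coeff l =
      if l + k = j then
        S.coeff k * (R.coeff (l + k) * ((1 / 2) ^ (l + k) * ((l + k).descFactorial k : ℂ))) else 0 := by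
    intro j
    rw [gaussK_zero_zero, gaussD_zero_zero, coeff_C_mul, Module.End.pow_apply,
      coeff_iterate_derivative, coeff_C_mul, coeff_X_pow]
    split_ifs with h
    · subst h
      simp
      ring
    · simp
  simp only [e, Finset.sum_ite_eq, Finset.mem_range]
  split_ifs with h
  · rfl
  · rw [coeff_eq_zero_of_natDegree_lt (show R.natDegree < l + k by omega)]
    simp

/-- The image of `Q` under the linear part of the profile equation centred at `conj b`. -/
def linPart (lam mu : ℝ) (b : ℂ) (Q : ℂ[X]) : ℂ[X] :=
  C (lam : ℂ) * Q + C (mu : ℂ) * ((X + C (conj b)) * (derivative Q + C b * Q))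

theorem coeff_linPart_succ (lam mu : ℝ) (b : ℂ) (Q : ℂ[X]) (l : ℕ) :
    (linPart lam mu b Q).coeff (l + 1) = lam * Q.coeff (l + 1) +
      mu * (Q.coeff (l + 1) * (l + 1) + b * Q.coeff l +
        conj b * (Q.coeff (l + 2) * (l + 2) + b * Q.coeff (l + 1))) := by
  simp only [linPart, coeff_add, coeff_C_mul, add_mul, coeff_X_mul, coeff_derivative]
  push_cast
  ring

theorem coeff_linPart_zero (lam mu : ℝ) (b : ℂ) (Q : ℂ[X]) :
    (linPart lam mu b Q).coeff 0 = lam * Q.coeff 0 +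
      mu * (conj b * (Q.coeff 1 + b * Q.coeff 0)) := by
  simp [linPart, add_mul, coeff_derivative]

/-- In degree `2n - m`, a term `k < m` lacks its coefficient in `Q`, and a term `k > m` would need a
coefficient of `Q²` beyond degree `2n`; only the lowest term of `Q` paired with the leading term of
`Q²` remains. -/
theorem coeff_gaussPoly_top {Q : ℂ[X]} {m : ℕ} (hm : ∀ k < m, Q.coeff k = 0)
    (hmn : m ≤ Q.natDegree) :
    (gaussPoly 0 0 (2 * Q.natDegree) Q.natDegree (Q ^ 2) (Q.map (starRingEnd ℂ))).coeff
      (2 * Q.natDegree - m) = conj (Q.coeff m) * (Q.leadingCoeff ^ 2 *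
        ((1 / 2) ^ (2 * Q.natDegree) * ((2 * Q.natDegree).descFactorial m : ℂ))) := by
  rw [coeff_gaussPoly_zero _ _ natDegree_pow_le, Finset.sum_eq_single m]
  · rw [show 2 * Q.natDegree - m + m = 2 * Q.natDegree by omega,
      coeff_pow_of_natDegree_le le_rfl, coeff_natDegree, coeff_map]
  · intro k _ hk
    rcases hk.lt_or_gt with h | h
    · rw [coeff_map, hm k h]
      simp
    · rw [coeff_eq_zero_of_natDegree_lt
        (show (Q ^ 2).natDegree < 2 * Q.natDegree - m + k from
          natDegree_pow_le.trans_lt (by omega))]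
      simp
  · intro h
    simp at h
    omega

/-- Once `μ b = 0`, the linear part acts diagonally on monomials, and so does the nonlinearity; a
single scalar equation remains. -/
theorem isProfile_monomial_iff {lam mu : ℝ} {b c : ℂ} (n : ℕ) (hc : c ≠ 0) (hb : mu * b = 0) :
    linPart lam mu b (C c * X ^ n) = C (1 / 2) *
      gaussPoly 0 0 (2 * n) n ((C c * X ^ n) ^ 2) ((C c * X ^ n).map (starRingEnd ℂ)) ↔
    lam + n * mu = ‖c‖ ^ 2 * ((2 * n).factorial : ℝ) / (2 * 2 ^ (2 * n) * n.factorial) := by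
  have hb' : (mu : ℂ) * conj b = 0 := by
    have := congrArg conj hb
    simpa using this
  have hL : linPart lam mu b (C c * X ^ n) = C (((lam + n * mu : ℝ) : ℂ) * c) * X ^ n := by
    rw [linPart, show C (mu : ℂ) * ((X + C (conj b)) * (derivative (C c * X ^ n) +
      C b * (C c * X ^ n))) = C (mu : ℂ) * (X * derivative (C c * X ^ n)) +
      C ((mu : ℂ) * b) * (X + C (conj b)) * (C c * X ^ n) +
      C ((mu : ℂ) * conj b) * derivative (C c * X ^ n) by simp only [C_mul]; ring, hb, hb']
    rcases n with _ | n
    · simp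
    · simp
      ring
  have hG : gaussPoly 0 0 (2 * n) n ((C c * X ^ n) ^ 2) ((C c * X ^ n).map (starRingEnd ℂ)) =
      C (conj c * (c ^ 2 * ((1 / 2) ^ (2 * n) * ((2 * n).descFactorial n : ℂ)))) * X ^ n := by
    ext l
    rw [coeff_gaussPoly_zero _ _ (natDegree_pow_le.trans
      (Nat.mul_le_mul_left 2 (natDegree_C_mul_X_pow_le c n)))]
    rw [Finset.sum_eq_single n]
    · simp only [mul_pow, ← C_pow, ← pow_mul, Polynomial.map_mul, map_C, Polynomial.map_pow, map_X,
        coeff_C_mul, coeff_X_pow]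
      by_cases h : l = n
      · subst h
        simp [two_mul, mul_two]
      · rw [if_neg (show ¬ l + n = n * 2 by omega), if_neg h]
        simp
    · intro k _ hk
      simp [coeff_X_pow, hk]
    · simp
  rw [hL, hG, ← mul_assoc, ← C_mul]
  have hdf : ((2 * n).descFactorial n : ℝ) = ((2 * n).factorial : ℝ) / n.factorial := by
    rw [eq_div_iff (by positivity)]
    have := Nat.factorial_mul_descFactorial (show n ≤ 2 * n by omega)
    rw [show 2 * n - n = n by omega] at this
    rw [mul_comm]
    exact_mod_cast this
  have hE : 1 / 2 * (conj c * (c ^ 2 * ((1 / 2) ^ (2 * n) * ((2 * n).descFactorial n : ℂ)))) =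
      ((‖c‖ ^ 2 * ((2 * n).factorial : ℝ) / (2 * 2 ^ (2 * n) * n.factorial) : ℝ) : ℂ) * c := by
    have : ((‖c‖ ^ 2 * ((2 * n).factorial : ℝ) / (2 * 2 ^ (2 * n) * n.factorial) : ℝ) : ℂ) =
        ((‖c‖ ^ 2 : ℝ) : ℂ) * (1 / 2 * ((1 / 2) ^ (2 * n) * ((2 * n).descFactorial n : ℂ))) := by
      rw [← Complex.ofReal_natCast ((2 * n).descFactorial n), hdf]
      push_cast
      rw [one_div, inv_pow]
      field_simp
    rw [this, ← mul_conj_eq_norm_sq]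
    ring
  rw [hE]
  constructor
  · intro h
    have := congrArg (fun p => coeff p n) h
    simp only [coeff_C_mul_X_pow, if_true] at this
    exact_mod_cast mul_right_cancel₀ hc this
  · intro h
    rw [h]

theorem linPart_linear_iff {lam mu : ℝ} {b c β : ℂ} (hc : c ≠ 0) :
    linPart lam mu b (C c * (X - C β)) = C (1 / 2) *
      gaussPoly 0 0 (2 * 1) 1 ((C c * (X - C β)) ^ 2) ((C c * (X - C β)).map (starRingEnd ℂ)) ↔
    (mu * b = -(‖c‖ ^ 2 : ℝ) * conj β / 8 ∧
      lam + mu * (1 - b * β + b * conj b) = (‖c‖ ^ 2 : ℝ) / 2 * (β * conj β + 1 / 2) ∧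
      lam * β - mu * conj b * (1 - b * β) = (‖c‖ ^ 2 : ℝ) / 2 * β * (β * conj β + 1)) := by
  have hdeg : (C c * (X - C β)).natDegree ≤ 1 :=
    (natDegree_C_mul_le _ _).trans (natDegree_X_sub_C_le β)
  have h0 : (C c * (X - C β)).coeff 0 = -(c * β) := by simp
  have h1 : (C c * (X - C β)).coeff 1 = c := by simp
  have h2 : ∀ k, (C c * (X - C β)).coeff (k + 2) = 0 := fun k =>
    coeff_eq_zero_of_natDegree_lt (by omega)
  have hsq : (C c * (X - C β)) ^ 2 = C (c ^ 2) * X ^ 2 + C (-(2 * c ^ 2 * β)) * X ^ 1 +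
      C ((c * β) ^ 2) * X ^ 0 := by
    simp only [C_mul, C_pow, C_neg, C_ofNat]
    ring
  have hr : ∀ k, ((C c * (X - C β)) ^ 2).coeff k = (if k = 2 then c ^ 2 else 0) +
      (if k = 1 then -(2 * c ^ 2 * β) else 0) + (if k = 0 then (c * β) ^ 2 else 0) := by
    intro k
    rw [hsq]
    simp only [coeff_add, coeff_C_mul_X_pow]
  have hG : ∀ l : ℕ, (C (1 / 2 : ℂ) * gaussPoly 0 0 (2 * 1) 1 ((C c * (X - C β)) ^ 2)
      ((C c * (X - C β)).map (starRingEnd ℂ))).coeff l = 1 / 2 *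
        (-(conj c * conj β) * (((C c * (X - C β)) ^ 2).coeff l * (1 / 2) ^ l) +
          conj c * (((C c * (X - C β)) ^ 2).coeff (l + 1) * ((1 / 2) ^ (l + 1) * ((l : ℂ) + 1)))) := by
    intro l
    rw [coeff_C_mul, coeff_gaussPoly_zero _ _ (natDegree_pow_le.trans (Nat.mul_le_mul_left 2 hdeg)),
      Finset.sum_range_succ, Finset.sum_range_one, coeff_map, coeff_map, h0, h1]
    simp
  rw [Polynomial.ext_iff, ← mul_conj_eq_norm_sq]
  constructor
  · intro h
    have e0 := h 0
    have e1 := h 1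
    have e2 := h 2
    rw [hG, hr, hr, coeff_linPart_zero, h0, h1] at e0
    rw [hG, hr, hr, coeff_linPart_succ lam mu b _ 0, zero_add, zero_add, h0, h1, h2 0] at e1
    rw [hG, hr, hr, coeff_linPart_succ lam mu b _ 1, show 1 + 1 = 0 + 2 from rfl, h1, h2 0,
      show 1 + 2 = 1 + 2 from rfl, h2 1] at e2
    norm_num at e0 e1 e2
    refine ⟨mul_left_cancel₀ hc ?_, mul_left_cancel₀ hc ?_, mul_left_cancel₀ hc ?_⟩
    · linear_combination e2
    · linear_combination e1
    · linear_combination -e0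
  · rintro ⟨e2, e1, e0⟩ l
    rw [hG, hr, hr]
    rcases l with _ | _ | _ | l
    · rw [coeff_linPart_zero, h0, h1]
      norm_num
      linear_combination -c * e0
    · rw [coeff_linPart_succ lam mu b _ 0, zero_add, zero_add, h0, h1, h2 0]
      norm_num
      linear_combination c * e1
    · rw [coeff_linPart_succ lam mu b _ 1, show 1 + 1 = 0 + 2 from rfl, h1, h2 0, h2 1]
      norm_num
      linear_combination c * e2
    · rw [coeff_linPart_succ, h2, h2 l, h2 (l + 2)]
      simp

/-- Written with factorials, equality would reduce to `2(p + 3) = 2p + 3`. -/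
theorem descFactorial_ne (p : ℕ) :
    (p + 1) * (2 * p + 4).descFactorial (p + 1) ≠ 4 * (2 * p + 2).descFactorial (p + 2) := by
  intro h
  have h1 := Nat.factorial_mul_descFactorial (show p + 1 ≤ 2 * p + 4 by omega)
  have h2 := Nat.factorial_mul_descFactorial (show p + 2 ≤ 2 * p + 2 by omega)
  rw [show 2 * p + 4 - (p + 1) = p + 3 by omega] at h1
  rw [show 2 * p + 2 - (p + 2) = p by omega] at h2
  rw [show 2 * p + 4 = (2 * p + 3) + 1 from rfl, Nat.factorial_succ (2 * p + 3),
    show 2 * p + 3 = (2 * p + 2) + 1 from rfl, Nat.factorial_succ (2 * p + 2), ← h2, Nat.factorial_succ (p + 2),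
    Nat.factorial_succ (p + 1), Nat.factorial_succ p] at h1
  have h3 : 0 < (2 * p + 2).descFactorial (p + 2) := Nat.descFactorial_pos.2 (by omega)
  have h4 : 0 < p.factorial := Nat.factorial_pos p
  set D := (2 * p + 2).descFactorial (p + 2)
  set D' := (2 * p + 2 + 1 + 1).descFactorial (p + 1) with hD'
  have h : (p + 1) * D' = 4 * D := h
  have h5 : (p.factorial * D) * ((p + 3) * (p + 2) * 4) =
      (p.factorial * D) * ((2 * p + 4) * (2 * p + 3)) := by
    linear_combination h1 - (p + 3) * (p + 2) * p.factorial * h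
  have h6 := Nat.eq_of_mul_eq_mul_left (Nat.mul_pos h4 h3) h5
  nlinarith

theorem classification_of_zero {lam mu : ℝ} {b : ℂ} {Q : ℂ[X]} (hQ : Q ≠ 0)
    (h : IsProfile lam mu (magTrans (-conj b) (gaussProfile Q 0 0))) :
    ∃ c : ℂ, c ≠ 0 ∧
      ((∃ n : ℕ, Q = C c * X ^ n ∧ mu * b = 0 ∧
          lam + n * mu = ‖c‖ ^ 2 * ((2 * n).factorial : ℝ) / (2 * 2 ^ (2 * n) * n.factorial)) ∨
        ∃ β : ℂ, β ≠ 0 ∧ Q = C c * (X - C β) ∧ b = conj β / (1 + ‖β‖ ^ 2 : ℝ) ∧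
          mu = -(‖c‖ ^ 2 / 8 * (1 + ‖β‖ ^ 2)) ∧
          lam = ‖c‖ ^ 2 / 2 * (1 + ‖β‖ ^ 2) - ‖c‖ ^ 2 / (8 * (1 + ‖β‖ ^ 2))) := by
  have h := (isProfile_magTrans_iff b (le_refl Q.natDegree)).1 h
  change linPart lam mu b Q = _ at h
  set n := Q.natDegree with hn
  set c := Q.leadingCoeff with hc
  have hc0 : c ≠ 0 := leadingCoeff_ne_zero.2 hQ
  have hQn : Q.coeff n = c := rfl
  have hQgt : ∀ k, n < k → Q.coeff k = 0 := fun k hk => coeff_eq_zero_of_natDegree_lt hk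
  have hLgt : ∀ k, n + 1 < k → (linPart lam mu b Q).coeff k = 0 := by
    intro k hk
    obtain ⟨k, rfl⟩ : ∃ l, k = l + 1 := ⟨k - 1, by omega⟩
    rw [coeff_linPart_succ, hQgt _ (by omega), hQgt _ (by omega), hQgt _ (by omega)]
    simp
  have hLn : (linPart lam mu b Q).coeff (n + 1) = mu * b * c := by
    rw [coeff_linPart_succ, hQgt (n + 1) (by omega), hQgt (n + 2) (by omega), hQn]
    simp
    ring
  set m := Q.natTrailingDegree with hm
  have hmn : m ≤ n := natTrailingDegree_le_natDegree Q
  have hQlt : ∀ k, k < m → Q.coeff k = 0 := fun k hk => coeff_eq_zero_of_lt_natTrailingDegree hk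
  have hQm : Q.coeff m ≠ 0 := by
    have := trailingCoeff_nonzero_iff_nonzero.2 hQ
    rwa [trailingCoeff] at this
  have htop := coeff_gaussPoly_top hQlt hmn
  rw [← hn, ← hc] at htop
  -- Since the linear part has degree at most `n + 1`, this forces `m ≥ n - 1`.
  have htop0 : (linPart lam mu b Q).coeff (2 * n - m) ≠ 0 := by
    rw [h, coeff_C_mul, htop]
    have : ((2 * n).descFactorial m : ℂ) ≠ 0 := by
      exact_mod_cast (Nat.descFactorial_pos.2 (by omega)).ne'
    simp [hQm, hc0, this]
  have hmono : m = n → Q = C c * X ^ n := by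
    intro hmn
    ext k
    rw [coeff_C_mul_X_pow]
    split_ifs with hk
    · rw [hk, hQn]
    · rcases Ne.lt_or_gt hk with hk | hk
      · exact hQlt k (hmn ▸ hk)
      · exact hQgt k hk
  refine ⟨c, hc0, ?_⟩
  by_cases hb : (mu : ℂ) * b = 0
  · left
    -- The coefficient of degree `n + 1` of the linear part is `μ b c`, which is zero here, so the
    -- bound improves to `2n - m ≤ n`.
    have hmn' : m = n := by
      by_contra hne
      rcases (show 2 * n - m = n + 1 ∨ n + 1 < 2 * n - m by omega) with h1 | h1
      · rw [h1, hLn, hb, zero_mul] at htop0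
        exact htop0 rfl
      · exact htop0 (hLgt _ h1)
    refine ⟨n, hmono hmn', hb, ?_⟩
    rw [hmono hmn'] at h
    exact (isProfile_monomial_iff n hc0 hb).1 h
  · right
    -- For a monomial the nonlinear side has degree at most `n`, against the nonzero coefficient `μ
    -- b c` in degree `n + 1`.
    have hne : m ≠ n := by
      intro hmn'
      have h1 : (linPart lam mu b Q).coeff (n + 1) = 0 := by
        rw [h, coeff_C_mul, coeff_gaussPoly_zero _ _ natDegree_pow_le, Finset.sum_eq_zero, mul_zero]
        intro k _
        by_cases hk : k < m
        · rw [coeff_map, hQlt k hk]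
          simp
        · rw [coeff_eq_zero_of_natDegree_lt (show (Q ^ 2).natDegree < n + 1 + k from
            natDegree_pow_le.trans_lt (by omega))]
          simp
      rw [hLn] at h1
      exact mul_ne_zero hb hc0 h1
    have hm1 : n = m + 1 := by
      by_contra hne'
      exact htop0 (hLgt _ (by omega))
    set d := Q.coeff m with hd
    rcases Nat.eq_zero_or_pos m with hm0 | hmpos
    · have hn1 : n = 1 := by omega
      have hcd : c * (d / c) = d := by field_simp
      have hQeq : Q = C c * (X - C (-(d / c))) := by
        obtain ⟨x, y, e⟩ := exists_eq_X_add_C_of_natDegree_le_one (p := Q) (by omega)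
        have h1 : c = x := by rw [← hQn, hn1, e]; simp
        have h2 : d = y := by rw [hd, hm0, e]; simp
        rw [map_neg, sub_neg_eq_add, mul_add, ← C_mul, hcd, h1, h2]
        exact e
      set β := -(d / c) with hβ
      have hβ0 : β ≠ 0 := neg_ne_zero.2 (div_ne_zero hQm hc0)
      rw [hn1, hQeq] at h
      obtain ⟨e2, e1, e0⟩ := (linPart_linear_iff hc0).1 h
      refine ⟨β, hβ0, hQeq, ?_⟩
      have hmu : (mu : ℂ) ≠ 0 := left_ne_zero_of_mul hb
      have hN : (‖c‖ ^ 2 : ℝ) ≠ 0 := by positivity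
      set N : ℝ := ‖c‖ ^ 2 with hNdef
      clear_value N
      have e2' : (mu : ℂ) * conj b = -N * β / 8 := by
        have := congrArg conj e2
        simpa only [map_mul, map_div₀, map_neg, Complex.conj_ofReal, Complex.conj_conj, map_ofNat]
          using this
      -- The top equation makes `μ b` a real multiple of `β̄`, so `b β` is real; this lets `λ` be
      -- eliminated from the other two equations to give `μ`.
      have hreal : conj b * conj β = b * β := by
        apply mul_left_cancel₀ hmu
        linear_combination conj β * e2' - β * e2
      have e3 : (lam : ℂ) + N / 8 * (1 - b * β) = N / 2 * (β * conj β + 1) := by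
        apply mul_right_cancel₀ hβ0
        linear_combination e0 + (1 - b * β) * e2'
      have e4 : (mu : ℂ) = -(N / 8 * (1 + β * conj β)) := by
        linear_combination e1 - e3 - conj b * e2 + β * e2 + N / 8 * hreal
      have hββ := mul_conj_eq_norm_sq β
      rw [hββ] at e4 e3
      have hmu' : mu = -(N / 8 * (1 + ‖β‖ ^ 2)) := by exact_mod_cast e4
      have hβ1 : ((1 + ‖β‖ ^ 2 : ℝ) : ℂ) ≠ 0 := by
        have : (1 + ‖β‖ ^ 2 : ℝ) ≠ 0 := by positivity
        exact_mod_cast this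
      have hbeq : b = conj β / ((1 + ‖β‖ ^ 2 : ℝ) : ℂ) := by
        rw [eq_div_iff hβ1]
        have hNC : (N : ℂ) ≠ 0 := by exact_mod_cast hN
        apply mul_left_cancel₀ hNC
        rw [e4] at e2
        push_cast at e2 ⊢
        linear_combination -8 * e2
      refine ⟨hbeq, hmu', ?_⟩
      have e5 : (lam : ℂ) = ((N / 2 * (1 + ‖β‖ ^ 2) - N / (8 * (1 + ‖β‖ ^ 2)) : ℝ) : ℂ) := by
        have e6 : b * β = ((‖β‖ ^ 2 : ℝ) : ℂ) / ((1 + ‖β‖ ^ 2 : ℝ) : ℂ) := by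
          rw [hbeq, ← hββ]; ring
        rw [e6] at e3
        push_cast at e3 hβ1 ⊢
        field_simp
        field_simp at e3
        linear_combination e3
      exact_mod_cast e5
    -- With `m = p + 1` and `n = p + 2`, the coefficients of degree `n + 1` and `p = m - 1` each
    -- express `μ b̄` through `c` and `d`. In degree `p` only `k = n` survives on the right, because
    -- `Q²` starts in degree `2m = p + n`.
    · exfalso
      obtain ⟨p, hp⟩ : ∃ p, m = p + 1 := ⟨m - 1, by omega⟩
      have hnp : n = p + 2 := by omega
      have hdesc := descFactorial_ne p
      have e1 : mu * b * c = 1 / 2 * (conj d * (c ^ 2 *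
          ((1 / 2) ^ (2 * n) * ((2 * n).descFactorial m : ℂ)))) := by
        rw [← hLn, h, coeff_C_mul, ← htop]
        congr 2
        omega
      have hQlt' : ∀ k, k ≤ p → Q.coeff k = 0 := fun k hk => hQlt k (by omega)
      have hdp : Q.coeff (p + 1) = d := by rw [hd, hp]
      have e2 : mu * (conj b * (p + 1) * d) = 1 / 2 * (conj c * (d ^ 2 *
          ((1 / 2) ^ (2 * p + 2) * ((2 * p + 2).descFactorial (p + 2) : ℂ)))) := by
        have hL : (linPart lam mu b Q).coeff p = mu * (conj b * (p + 1) * d) := by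
          rcases p with _ | p
          · rw [coeff_linPart_zero, hQlt' 0 le_rfl, ← hdp]
            simp
          · rw [coeff_linPart_succ, hQlt' _ le_rfl, hQlt' p (by omega), ← hdp]
            push_cast
            ring
        have hXdvd : X ^ m ∣ Q := X_pow_dvd_iff.2 hQlt
        obtain ⟨T, hT⟩ := hXdvd
        have hT0 : T.coeff 0 = d := by
          rw [hd]
          conv_rhs => rw [hT, coeff_X_pow_mul']
          simp
        have hsq : Q ^ 2 = X ^ (2 * m) * T ^ 2 := by
          conv_lhs => rw [hT]
          ring
        have hsq1 : (Q ^ 2).coeff (2 * m) = d ^ 2 := by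
          rw [hsq, coeff_X_pow_mul', if_pos le_rfl, Nat.sub_self, coeff_zero_eq_eval_zero, eval_pow,
            ← coeff_zero_eq_eval_zero, hT0]
        have hsq2 : (Q ^ 2).coeff (p + m) = 0 := by
          rw [hsq, coeff_X_pow_mul', if_neg (by omega)]
        rw [← hL, h, coeff_C_mul, coeff_gaussPoly_zero _ _ natDegree_pow_le, Finset.sum_eq_single n]
        · rw [coeff_map, hQn, show p + n = 2 * m by omega, hsq1, show 2 * m = 2 * p + 2 by omega, hnp]
        · intro k hk hkn
          have hk := Finset.mem_range.1 hk
          rcases (show k ≤ p ∨ k = m by omega) with h1 | h1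
          · rw [coeff_map, hQlt' k h1]
            simp
          · rw [h1, hsq2]
            simp
        · simp
      have hcc : conj c ≠ 0 := by simpa using hc0
      rw [hnp, hp] at e1
      have e1' : (mu : ℂ) * conj b * conj c = 1 / 2 * (d * (conj c ^ 2 *
          ((1 / 2) ^ (2 * (p + 2)) * ((2 * (p + 2)).descFactorial (p + 1) : ℂ)))) := by
        have := congrArg conj e1
        simpa only [map_mul, map_div₀, map_pow, map_one, map_natCast, Complex.conj_ofReal,
          Complex.conj_conj, map_ofNat] using this
      rw [show 2 * (p + 2) = 2 * p + 4 by ring] at e1'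
      apply hdesc
      have e3 : ((p : ℂ) + 1) * ((2 * p + 4).descFactorial (p + 1) : ℂ) =
          4 * ((2 * p + 2).descFactorial (p + 2) : ℂ) := by
        have hz : conj c * d * (conj c * d) * (1 / 2 * (1 / 2) ^ (2 * p + 4) : ℂ) ≠ 0 := by
          have : conj c * d ≠ 0 := mul_ne_zero hcc hQm
          exact mul_ne_zero (mul_ne_zero this this) (by simp)
        apply mul_left_cancel₀ hz
        rw [show (1 / 2 : ℂ) ^ (2 * p + 2) = 4 * (1 / 2) ^ (2 * p + 4) by
          rw [pow_add, pow_add _ _ 4]; ring] at e2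
        linear_combination conj c * e2 - (p + 1) * d * e1'
      exact_mod_cast e3

end LLL

end

/-! ### Gaussian inner products and conserved quantities -/

noncomputable section

namespace LLL

open scoped ComplexConjugate
open Polynomial

theorem integrable_pow_mul_pow_conj {r : ℝ} (hr : 1 ≤ r) (j k : ℕ) :
    Integrable fun w : ℂ => w ^ j * conj w ^ k * (Real.exp (-r * ‖w‖ ^ 2) : ℂ) := by
  refine (integrable_pow_mul_exp (j + k) 0).mono' ?_ (Filter.Eventually.of_forall fun w => ?_)
  · exact Continuous.aestronglyMeasurable (by fun_prop)
  · rw [norm_mul, norm_mul, norm_pow, norm_pow, RCLike.norm_conj, Complex.norm_real,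
      Real.norm_of_nonneg (Real.exp_pos _).le, ← pow_add]
    gcongr
    nlinarith [sq_nonneg ‖w‖]

theorem integral_pow_mul_pow_conj {r : ℝ} (hr : 1 ≤ r) (j k : ℕ) :
    ∫ w : ℂ, w ^ j * conj w ^ k * (Real.exp (-r * ‖w‖ ^ 2) : ℂ) =
      if j = k then ((Real.pi * k.factorial / r ^ (k + 1) : ℝ) : ℂ) else 0 := by
  split_ifs with h
  · subst h
    have h1 := Complex.integral_rpow_mul_exp_neg_mul_rpow (p := 2) (q := 2 * j) (b := r) (by norm_num)
      (by have : (0 : ℝ) ≤ j := j.cast_nonneg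
          linarith) (by linarith)
    have h2 : ∀ w : ℂ, w ^ j * conj w ^ j * (Real.exp (-r * ‖w‖ ^ 2) : ℂ) =
        ((‖w‖ ^ (2 * j : ℝ) * Real.exp (-r * ‖w‖ ^ (2 : ℝ)) : ℝ) : ℂ) := by
      intro w
      rw [← mul_pow, mul_conj_eq_norm_sq, Real.rpow_mul (norm_nonneg w)]
      norm_cast
    simp_rw [h2]
    rw [integral_complex_ofReal, h1]
    congr 1
    have h3 : (2 * (j : ℝ) + 2) / 2 = (j + 1 : ℝ) := by ring
    rw [neg_div, h3, Real.rpow_neg (by linarith), Real.Gamma_nat_eq_factorial,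
      show (j + 1 : ℝ) = ((j + 1 : ℕ) : ℝ) by push_cast; rfl, Real.rpow_natCast]
    field_simp
  · have hjk : (j : ℝ) - k ≠ 0 := sub_ne_zero.2 (by exact_mod_cast h)
    -- Rotation by this angle multiplies `w^j w̄^k` by `e^{iπ} = -1`, so the rotation-invariant
    -- integral vanishes.
    have h1 := integral_comp_rot (Real.pi / (j - k))
      fun w : ℂ => w ^ j * conj w ^ k * (Real.exp (-r * ‖w‖ ^ 2) : ℂ)
    set I := ∫ w : ℂ, w ^ j * conj w ^ k * (Real.exp (-r * ‖w‖ ^ 2) : ℂ)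
    have h2 : ∀ w : ℂ, (Complex.exp (Complex.I * (Real.pi / (j - k) : ℝ)) * w) ^ j *
        conj (Complex.exp (Complex.I * (Real.pi / (j - k) : ℝ)) * w) ^ k *
        (Real.exp (-r * ‖Complex.exp (Complex.I * (Real.pi / (j - k) : ℝ)) * w‖ ^ 2) : ℂ) =
        -1 * (w ^ j * conj w ^ k * (Real.exp (-r * ‖w‖ ^ 2) : ℂ)) := by
      intro w
      rw [norm_spaceRot_arg, map_mul, ← Complex.exp_conj, mul_pow, mul_pow, ← Complex.exp_nat_mul,
        ← Complex.exp_nat_mul, mul_mul_mul_comm, ← Complex.exp_add, ← Complex.exp_pi_mul_I]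
      rw [mul_assoc]
      congr 2
      simp only [map_mul, Complex.conj_I, Complex.conj_ofReal]
      have : ((j : ℂ) - k) ≠ 0 := by exact_mod_cast hjk
      push_cast
      field_simp
      ring
    simp_rw [h2] at h1
    rw [integral_const_mul] at h1
    change -1 * I = I at h1
    linear_combination (-1 / 2) * h1

/-- The weighted `L²` inner product of two polynomials. -/
def gaussInner (r : ℝ) (R S : ℂ[X]) : ℂ :=
  ∫ w : ℂ, R.eval w * conj (S.eval w) * (Real.exp (-r * ‖w‖ ^ 2) : ℂ)

theorem eval_mul_conj_eq_sum (r : ℝ) {R S : ℂ[X]} {N M : ℕ} (hR : R.natDegree ≤ N)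
    (hS : S.natDegree ≤ M) (w : ℂ) :
    R.eval w * conj (S.eval w) * (Real.exp (-r * ‖w‖ ^ 2) : ℂ) =
      ∑ j ∈ Finset.range (N + 1), ∑ k ∈ Finset.range (M + 1),
        R.coeff j * conj (S.coeff k) * (w ^ j * conj w ^ k * (Real.exp (-r * ‖w‖ ^ 2) : ℂ)) := by
  rw [eval_eq_sum_range' (Nat.lt_succ_of_le hR), eval_eq_sum_range' (Nat.lt_succ_of_le hS), map_sum,
    Finset.sum_mul_sum, Finset.sum_mul]
  refine Finset.sum_congr rfl fun j _ => ?_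
  rw [Finset.sum_mul]
  refine Finset.sum_congr rfl fun k _ => ?_
  rw [map_mul, map_pow]
  ring

theorem integrable_eval_mul_conj {r : ℝ} (hr : 1 ≤ r) (R S : ℂ[X]) :
    Integrable fun w : ℂ => R.eval w * conj (S.eval w) * (Real.exp (-r * ‖w‖ ^ 2) : ℂ) := by
  simp_rw [eval_mul_conj_eq_sum r le_rfl le_rfl]
  exact integrable_finsetSum _ fun j _ => integrable_finsetSum _ fun k _ =>
    (integrable_pow_mul_pow_conj hr j k).const_mul _

theorem gaussInner_eq_sum {r : ℝ} (hr : 1 ≤ r) (R : ℂ[X]) {S : ℂ[X]} {M : ℕ}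
    (hS : S.natDegree ≤ M) : gaussInner r R S = ∑ k ∈ Finset.range (M + 1),
      R.coeff k * conj (S.coeff k) * ((Real.pi * k.factorial / r ^ (k + 1) : ℝ) : ℂ) := by
  rw [gaussInner]
  simp_rw [eval_mul_conj_eq_sum r (le_max_left R.natDegree M) hS]
  rw [integral_finsetSum _ fun j _ => integrable_finsetSum _ fun k _ =>
    (integrable_pow_mul_pow_conj hr j k).const_mul _]
  simp_rw [integral_finsetSum _ fun k (_ : k ∈ Finset.range (M + 1)) =>
    (integrable_pow_mul_pow_conj hr _ k).const_mul _, integral_const_mul,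
    integral_pow_mul_pow_conj hr]
  rw [Finset.sum_comm]
  refine Finset.sum_congr rfl fun k hk => ?_
  have hk := Finset.mem_range.1 hk
  simp only [mul_ite, mul_zero, Finset.sum_ite_eq', Finset.mem_range]
  rw [if_pos ((Nat.lt_succ_iff.1 hk).trans (le_max_right _ _) |>.trans_lt (Nat.lt_succ_self _))]

/-- `Λ` generates rotations, so it annihilates the radial Gaussian and acts on the holomorphic
factor as `z ∂_z`. -/
theorem angMom_gaussian {f : ℂ → ℂ} (hf : Differentiable ℂ f) (z : ℂ) :
    angMom (fun z => (Real.exp (-‖z‖ ^ 2 / 2) : ℂ) * f z) z =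
      (Real.exp (-‖z‖ ^ 2 / 2) : ℂ) * (z * deriv f z) := by
  have h1 : HasFDerivAt (fun z : ℂ => -‖z‖ ^ 2 / 2) ((-1 / 2 : ℝ) • (2 : ℕ) • innerSL ℝ z) z := by
    rw [show (fun z : ℂ => -‖z‖ ^ 2 / 2) = fun z => -1 / 2 * ‖z‖ ^ 2 from funext fun z => by ring]
    exact (hasStrictFDerivAt_norm_sq z).hasFDerivAt.const_mul (-1 / 2 : ℝ)
  have h2 := (Complex.ofRealCLM.hasFDerivAt.comp z h1.exp).mul
    ((hf z).hasDerivAt.hasFDerivAt.restrictScalars ℝ)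
  have h3 : fderiv ℝ (fun z : ℂ => (Real.exp (-‖z‖ ^ 2 / 2) : ℂ) * f z) z = _ := h2.fderiv
  rw [angMom, h3]
  simp [Complex.inner]
  linear_combination (Complex.exp (-(‖z‖ : ℂ) ^ 2 / 2) * deriv f z) * Complex.re_add_im z -
    (Complex.exp (-(‖z‖ : ℂ) ^ 2 / 2) * deriv f z * z.re) * Complex.I_sq

/-- The functions `R_{-b̄}(Q e^{-|z|²/2})` in terms of the centred Gaussian. -/
theorem magTrans_gaussProfile_eq (Q : ℂ[X]) (b z : ℂ) :
    magTrans (-conj b) (gaussProfile Q 0 0) z =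
      Q.eval (z - conj b) * magTrans (-conj b) (gaussProfile 1 0 0) z := by
  rw [magTrans_gaussProfile, magTrans_gaussProfile, eval_one]
  ring

theorem magTrans_gaussProfile_one_mul_conj (b z : ℂ) :
    magTrans (-conj b) (gaussProfile 1 0 0) z * conj (magTrans (-conj b) (gaussProfile 1 0 0) z) =
      (Real.exp (-1 * ‖z - conj b‖ ^ 2) : ℂ) := by
  have hn : ‖Complex.exp ((conj z * -conj b - z * conj (-conj b)) / 2)‖ = 1 := by
    rw [Complex.norm_exp, Real.exp_eq_one_iff]
    simp
  rw [mul_conj_eq_norm_sq, magTrans, norm_mul, hn, mul_one, norm_gaussProfile, eval_one, norm_one,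
    one_mul, ← Real.exp_nat_mul, ← sub_eq_add_neg]
  congr 2
  simp
  ring

theorem norm_sq_magTrans_gaussProfile (Q : ℂ[X]) (b z : ℂ) :
    ((‖magTrans (-conj b) (gaussProfile Q 0 0) z‖ ^ 2 : ℝ) : ℂ) =
      Q.eval (z - conj b) * conj (Q.eval (z - conj b)) *
        (Real.exp (-1 * ‖z - conj b‖ ^ 2) : ℂ) := by
  rw [← mul_conj_eq_norm_sq, magTrans_gaussProfile_eq, map_mul, mul_mul_mul_comm,
    magTrans_gaussProfile_one_mul_conj]

theorem angMom_magTrans_gaussProfile (Q : ℂ[X]) (b z : ℂ) :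
    angMom (magTrans (-conj b) (gaussProfile Q 0 0)) z *
        conj (magTrans (-conj b) (gaussProfile Q 0 0) z) =
      ((X + C (conj b)) * (derivative Q + C b * Q)).eval (z - conj b) *
        conj (Q.eval (z - conj b)) * (Real.exp (-1 * ‖z - conj b‖ ^ 2) : ℂ) := by
  have hf := hasDerivAt_eval_sub_mul_exp Q b
  rw [show magTrans (-conj b) (gaussProfile Q 0 0) = fun z => (Real.exp (-‖z‖ ^ 2 / 2) : ℂ) *
    (Q.eval (z - conj b) * Complex.exp (b * z - b * conj b / 2)) from
    funext (magTrans_gaussProfile Q b), angMom_gaussian (fun z => (hf z).differentiableAt),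
    (hf z).deriv, ← magTrans_gaussProfile_one_mul_conj, magTrans_gaussProfile]
  simp only [eval_mul, eval_add, eval_X, eval_C, eval_one, sub_add_cancel, map_mul, one_mul]
  ring

/-- Recentring at `b̄` makes every density a polynomial pairing: `|v|²` has weight `e^{-|w|²}` and
`|v|⁴` has weight `e^{-2|w|²}`. The multiplier `z` becomes `w + b̄`. -/
theorem hasConservedQuantities_magTrans {Q : ℂ[X]} {b : ℂ} {H M P : ℝ} {q : ℂ}
    (hH : gaussInner 2 (Q ^ 2) (Q ^ 2) = ((4 * H : ℝ) : ℂ)) (hM : gaussInner 1 Q Q = M)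
    (hP : gaussInner 1 ((X + C (conj b)) * (derivative Q + C b * Q)) Q = P)
    (hq : gaussInner 1 ((X + C (conj b)) * Q) Q = q) :
    HasConservedQuantities (magTrans (-conj b) (gaussProfile Q 0 0)) H M P q := by
  set v := magTrans (-conj b) (gaussProfile Q 0 0) with hv
  have e4 : ∀ z, ((‖v z‖ ^ 4 : ℝ) : ℂ) = (Q ^ 2).eval (z - conj b) *
      conj ((Q ^ 2).eval (z - conj b)) * (Real.exp (-2 * ‖z - conj b‖ ^ 2) : ℂ) := by
    intro z
    rw [show ‖v z‖ ^ 4 = (‖v z‖ ^ 2) ^ 2 by ring, Complex.ofReal_pow,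
      norm_sq_magTrans_gaussProfile, mul_pow, ← Complex.ofReal_pow, ← Real.exp_nat_mul]
    simp only [eval_pow, map_pow, mul_pow]
    congr 3
    push_cast
    ring
  have eq : ∀ z, z * ((‖v z‖ ^ 2 : ℝ) : ℂ) = ((X + C (conj b)) * Q).eval (z - conj b) *
      conj (Q.eval (z - conj b)) * (Real.exp (-1 * ‖z - conj b‖ ^ 2) : ℂ) := by
    intro z
    rw [norm_sq_magTrans_gaussProfile]
    simp only [eval_mul, eval_add, eval_X, eval_C, sub_add_cancel]
    ring
  have hint : ∀ (r : ℝ) (_ : 1 ≤ r) (R S : ℂ[X]), Integrable fun z : ℂ =>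
      R.eval (z - conj b) * conj (S.eval (z - conj b)) * (Real.exp (-r * ‖z - conj b‖ ^ 2) : ℂ) :=
    fun r hr R S => (integrable_eval_mul_conj hr R S).comp_sub_right (conj b)
  have hval : ∀ (r : ℝ) (R S : ℂ[X]), ∫ z : ℂ,
      R.eval (z - conj b) * conj (S.eval (z - conj b)) * (Real.exp (-r * ‖z - conj b‖ ^ 2) : ℂ) =
        gaussInner r R S := fun r R S => integral_sub_right_eq_self
    (fun w : ℂ => R.eval w * conj (S.eval w) * (Real.exp (-r * ‖w‖ ^ 2) : ℂ)) (conj b)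
  refine ⟨?_, ?_, ?_, ?_, ?_, ?_, ?_, ?_⟩
  · have := (hint 2 one_le_two (Q ^ 2) (Q ^ 2)).re
    simp_rw [← e4] at this
    exact this
  · have := (hint 1 le_rfl Q Q).re
    simp_rw [← norm_sq_magTrans_gaussProfile] at this
    exact this
  · simp_rw [hv, angMom_magTrans_gaussProfile]
    exact hint 1 le_rfl _ _
  · simp_rw [eq]
    exact hint 1 le_rfl _ _
  · have := hval 2 (Q ^ 2) (Q ^ 2)
    simp_rw [← e4] at this
    rw [hH, integral_complex_ofReal] at this
    have := Complex.ofReal_injective this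
    rw [hamiltonian, this]
    ring
  · have := hval 1 Q Q
    simp_rw [← norm_sq_magTrans_gaussProfile] at this
    rw [hM, integral_complex_ofReal] at this
    exact Complex.ofReal_injective this
  · rw [angularMomentum, hv]
    simp_rw [angMom_magTrans_gaussProfile]
    rw [hval, hP]
  · rw [magneticMomentum]
    simp_rw [eq]
    rw [hval, hq]

theorem mass_magTrans_gaussProfile (Q : ℂ[X]) (b : ℂ) :
    (mass (magTrans (-conj b) (gaussProfile Q 0 0)) : ℂ) = gaussInner 1 Q Q := by
  rw [mass, ← integral_complex_ofReal]
  simp_rw [norm_sq_magTrans_gaussProfile]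
  exact integral_sub_right_eq_self
    (fun w : ℂ => Q.eval w * conj (Q.eval w) * (Real.exp (-1 * ‖w‖ ^ 2) : ℂ)) (conj b)

theorem magTrans_gaussProfile_mem_fockSpace (Q : ℂ[X]) (b : ℂ) :
    magTrans (-conj b) (gaussProfile Q 0 0) ∈ fockSpace := by
  have h := (magTrans_gaussProfile_mem Q b).1
  refine ⟨h, ?_⟩
  rw [memLp_two_iff_integrable_sq_norm (isGaussianHolomorphic_continuous h).aestronglyMeasurable]
  have := ((integrable_eval_mul_conj (le_refl (1 : ℝ)) Q Q).comp_sub_right (conj b)).re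
  simp_rw [← norm_sq_magTrans_gaussProfile] at this
  exact this

theorem gaussInner_monomial (n : ℕ) (c : ℂ) (R : ℂ[X]) {r : ℝ} (hr : 1 ≤ r) :
    gaussInner r R (C c * X ^ n) =
      R.coeff n * conj c * ((Real.pi * n.factorial / r ^ (n + 1) : ℝ) : ℂ) := by
  rw [gaussInner_eq_sum hr R (natDegree_C_mul_X_pow_le c n), Finset.sum_range_succ,
    Finset.sum_eq_zero, zero_add, coeff_C_mul_X_pow, if_pos rfl]
  intro k hk
  have hk := Finset.mem_range.1 hk
  rw [coeff_C_mul_X_pow, if_neg hk.ne]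
  simp

theorem hasConservedQuantities_monomial {c : ℂ} {n : ℕ} (b : ℂ)
    (hc : ‖c‖ ^ 2 * (Real.pi * n.factorial) = 1) :
    HasConservedQuantities (magTrans (-conj b) (gaussProfile (C c * X ^ n) 0 0))
      (1 / (8 * Real.pi) * (((2 * n).factorial : ℝ) / (2 ^ (2 * n) * (n.factorial : ℝ) ^ 2)))
      1 (n + ‖b‖ ^ 2) (conj b) := by
  have hcc : c * conj c * (Real.pi * n.factorial) = 1 := by
    rw [mul_conj_eq_norm_sq]
    exact_mod_cast hc
  refine hasConservedQuantities_magTrans ?_ ?_ ?_ ?_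
  · rw [show (C c * X ^ n) ^ 2 = C (c ^ 2) * X ^ (2 * n) by rw [mul_pow, C_pow]; ring,
      gaussInner_monomial _ _ _ one_le_two, coeff_C_mul_X_pow, if_pos rfl, map_pow]
    have hn : (n.factorial : ℂ) ≠ 0 := by exact_mod_cast n.factorial_ne_zero
    have hπ : (Real.pi : ℂ) ≠ 0 := by exact_mod_cast Real.pi_ne_zero
    have e : c ^ 2 * conj c ^ 2 = 1 / (Real.pi * n.factorial) ^ 2 := by
      rw [eq_div_iff (pow_ne_zero _ (mul_ne_zero hπ hn)), ← mul_pow, ← mul_pow, hcc, one_pow]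
    rw [e]
    push_cast
    field_simp
    ring
  · rw [gaussInner_monomial _ _ _ le_rfl, coeff_C_mul_X_pow, if_pos rfl]
    simp only [one_pow, div_one]
    push_cast
    exact hcc
  · rw [gaussInner_monomial _ _ _ le_rfl]
    have : ((X + C (conj b)) * (derivative (C c * X ^ n) + C b * (C c * X ^ n))).coeff n =
        c * (n + b * conj b) := by
      rcases n with _ | n
      · simp [add_mul]
        ring
      · simp [add_mul, coeff_X_mul, coeff_X_pow]
        ring
    rw [this, mul_conj_eq_norm_sq]
    simp only [one_pow, div_one]
    push_cast
    linear_combination ((n : ℂ) + (‖b‖ : ℂ) ^ 2) * hcc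
  · rw [gaussInner_monomial _ _ _ le_rfl]
    have : ((X + C (conj b)) * (C c * X ^ n)).coeff n = c * conj b := by
      rcases n with _ | n
      · simp [add_mul]
        ring
      · simp [add_mul, coeff_X_mul, coeff_X_pow]
        ring
    rw [this]
    simp only [one_pow, div_one]
    push_cast
    linear_combination conj b * hcc

theorem gaussInner_linear (c β : ℂ) (R : ℂ[X]) :
    gaussInner 1 R (C c * (X - C β)) = Real.pi * conj c * (R.coeff 1 - conj β * R.coeff 0) := by
  rw [gaussInner_eq_sum le_rfl R (M := 1)
    ((natDegree_C_mul_le _ _).trans (natDegree_X_sub_C_le β)), Finset.sum_range_succ,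
    Finset.sum_range_one]
  simp
  ring

theorem hasConservedQuantities_linear {c : ℂ} {b : ℝ}
    (hc : ‖c‖ ^ 2 * (Real.pi * (1 + b ^ 2)) = 1) :
    HasConservedQuantities
      (magTrans (-conj ((b / (1 + b ^ 2) : ℝ) : ℂ)) (gaussProfile (C c * (X - C (b : ℂ))) 0 0))
      (1 / (8 * Real.pi) * (1 - 1 / (2 * (1 + b ^ 2) ^ 2))) 1 (1 / (1 + b ^ 2) ^ 2) 0 := by
  have hcc : c * conj c * (Real.pi * (1 + b ^ 2)) = 1 := by
    rw [mul_conj_eq_norm_sq]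
    exact_mod_cast hc
  have hb : (1 + b ^ 2 : ℂ) ≠ 0 := by
    have : (1 + b ^ 2 : ℝ) ≠ 0 := by positivity
    exact_mod_cast this
  have hπ : (Real.pi : ℂ) ≠ 0 := by exact_mod_cast Real.pi_ne_zero
  refine hasConservedQuantities_magTrans ?_ ?_ ?_ ?_
  · have hsq : (C c * (X - C (b : ℂ))) ^ 2 = C (c ^ 2) * X ^ 2 + C (-(2 * c ^ 2 * b)) * X ^ 1 +
        C ((c * b) ^ 2) * X ^ 0 := by
      simp only [C_mul, C_pow, C_neg, C_ofNat]
      ring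
    have hdeg : ((C c * (X - C (b : ℂ))) ^ 2).natDegree ≤ 2 :=
      natDegree_pow_le.trans (Nat.mul_le_mul_left 2 (m := 1)
        ((natDegree_C_mul_le _ _).trans (natDegree_X_sub_C_le _)))
    rw [gaussInner_eq_sum one_le_two _ hdeg, Finset.sum_range_succ, Finset.sum_range_succ,
      Finset.sum_range_one, hsq]
    simp only [coeff_add, coeff_C_mul_X_pow]
    norm_num
    have e : c ^ 2 * conj c ^ 2 = 1 / (Real.pi * (1 + b ^ 2)) ^ 2 := by
      rw [eq_div_iff (pow_ne_zero _ (mul_ne_zero hπ hb)), ← mul_pow, ← mul_pow, hcc, one_pow]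
    have e' : ∀ x : ℂ, c ^ 2 * conj c ^ 2 * (Real.pi / 2 * (b ^ 4 + 2 * b ^ 2 + 1 / 2)) = x →
      (c * b) ^ 2 * (conj c * b) ^ 2 * (Real.pi / 2) +
      2 * c ^ 2 * b * (conj 2 * conj c ^ 2 * b) * (Real.pi / 4) +
      c ^ 2 * conj c ^ 2 * (Real.pi * 2 / 8) = x := by
      rintro x rfl
      rw [map_ofNat]
      ring
    refine e' _ ?_
    rw [e]
    field_simp
    ring
  · rw [gaussInner_linear]
    simp
    linear_combination hcc
  · rw [gaussInner_linear]
    have e : ((X + C (conj ((b / (1 + b ^ 2) : ℝ) : ℂ))) * (derivative (C c * (X - C (b : ℂ))) +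
        C ((b / (1 + b ^ 2) : ℝ) : ℂ) * (C c * (X - C (b : ℂ))))).coeff 1 - conj (b : ℂ) *
        ((X + C (conj ((b / (1 + b ^ 2) : ℝ) : ℂ))) * (derivative (C c * (X - C (b : ℂ))) +
        C ((b / (1 + b ^ 2) : ℝ) : ℂ) * (C c * (X - C (b : ℂ))))).coeff 0 = c / (1 + b ^ 2) := by
      simp [add_mul]
      field_simp
      ring
    rw [e]
    push_cast
    field_simp
    linear_combination hcc
  -- With translation parameter `β = b / (1 + b²)`, the pairing is proportional to `β(1 + b²) - b`,
  -- so the magnetic momentum vanishes.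
  · rw [gaussInner_linear]
    simp [add_mul]
    right
    field_simp
    ring

end LLL

end

/-! ### Rotation invariance, square integrability and the combined classification -/

noncomputable section

namespace LLL

open scoped ComplexConjugate
open Polynomial

theorem rot_neg_rot (γ θ : ℝ) (v : ℂ → ℂ) :
    phaseRot (-γ) (spaceRot (-θ) (phaseRot γ (spaceRot θ v))) = v := by
  rw [phaseRot_spaceRot_phaseRot_spaceRot, neg_add_cancel, neg_add_cancel,
    phaseRot_zero_spaceRot_zero]

theorem memLp_rot (γ θ : ℝ) {v : ℂ → ℂ} (hv : MemLp v 2 volume) :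
    MemLp (phaseRot γ (spaceRot θ v)) 2 volume :=
  (hv.comp_measurePreserving (measurePreserving_rot θ)).const_mul (Complex.exp (Complex.I * γ))

theorem rot_mem_fockSpace_iff (γ θ : ℝ) {v : ℂ → ℂ} (hv : v ∈ enlargedFockSpace) :
    phaseRot γ (spaceRot θ v) ∈ fockSpace ↔ v ∈ fockSpace := by
  constructor
  · intro h
    refine ⟨hv.1, ?_⟩
    have := memLp_rot (-γ) (-θ) h.2
    rwa [rot_neg_rot] at this
  · exact fun h => ⟨(rot_mem_enlargedFockSpace γ θ hv).1, memLp_rot γ θ h.2⟩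

theorem HasFinitelyManyZeros.rot {v : ℂ → ℂ} (hv : HasFinitelyManyZeros v) (γ θ : ℝ) :
    HasFinitelyManyZeros (phaseRot γ (spaceRot θ v)) := by
  refine (hv.preimage (f := fun z => Complex.exp (Complex.I * θ) * z)
    (mul_right_injective₀ (Complex.exp_ne_zero _)).injOn).subset fun z hz => ?_
  simpa [phaseRot, spaceRot, Complex.exp_ne_zero] using hz

theorem mass_rot (γ θ : ℝ) (v : ℂ → ℂ) : mass (phaseRot γ (spaceRot θ v)) = mass v := by
  simp_rw [mass, norm_phaseRot_spaceRot]
  exact integral_comp_rot θ fun z => ‖v z‖ ^ 2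

theorem hasFinitelyManyZeros_gaussProfile {P : ℂ[X]} (hP : P ≠ 0) (a b : ℂ) :
    HasFinitelyManyZeros (gaussProfile P a b) := by
  refine (P.roots.toFinset.finite_toSet).subset fun z hz => ?_
  have hz : (Real.exp (-‖z‖ ^ 2 / 2) : ℂ) * (P.eval z * Complex.exp (a * z ^ 2 / 2 + b * z)) = 0 := hz
  have := ((mul_eq_zero.1 hz).resolve_left (gauss_ne_zero z))
  have := (mul_eq_zero.1 this).resolve_right (Complex.exp_ne_zero _)
  simpa [hP] using this

theorem HasFinitelyManyZeros.magTrans {v : ℂ → ℂ} (hv : HasFinitelyManyZeros v) (α : ℂ) :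
    HasFinitelyManyZeros (magTrans α v) := by
  refine (hv.preimage (f := fun z => z + α) (add_left_injective α).injOn).subset fun z hz => ?_
  simpa [LLL.magTrans, Complex.exp_ne_zero] using hz

theorem volume_strip (R : ℝ) : volume {z : ℂ | R ≤ z.re ∧ 0 ≤ z.im ∧ z.im ≤ 1} = ⊤ := by
  have h : {z : ℂ | R ≤ z.re ∧ 0 ≤ z.im ∧ z.im ≤ 1} =
      Complex.measurableEquivRealProd ⁻¹' (Set.Ici R ×ˢ Set.Icc 0 1) := by
    ext z
    simp [Complex.measurableEquivRealProd_apply]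
  rw [h, Complex.volume_preserving_equiv_real_prod.measure_preimage_equiv, Measure.volume_eq_prod,
    Measure.prod_prod, Real.volume_Ici, Real.volume_Icc]
  simp

/-- The exponential factor has modulus `e^{-y² - sy}`, with no decay in `x`. On a half-infinite
strip `0 ≤ y ≤ 1` beyond the roots of `P` the profile stays above a positive constant on a set of
infinite measure, against Chebyshev's inequality. -/
theorem gaussProfile_one_notMem_fockSpace {P : ℂ[X]} (hP : P ≠ 0) (s : ℝ) :
    gaussProfile P (1 : ℝ) (Complex.I * s) ∉ fockSpace := by
  rintro ⟨-, hL⟩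
  obtain ⟨c, R, hc, hR⟩ := exists_le_norm_eval hP
  set ε : NNReal := ⟨c * Real.exp (-1 - |s|), by positivity⟩ with hε
  have hε0 : (ε : ENNReal) ≠ 0 := by
    have : 0 < c * Real.exp (-1 - |s|) := by positivity
    rw [ENNReal.coe_ne_zero]
    exact fun h => this.ne' (congrArg NNReal.toReal h)
  have h1 := hL.meas_ge_lt_top (by norm_num) (by norm_num) (ε := ε) (by simpa using hε0)
  refine h1.ne (measure_mono_top (s₁ := {z : ℂ | max R 0 ≤ z.re ∧ 0 ≤ z.im ∧ z.im ≤ 1}) ?_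
    (volume_strip _))
  rintro z ⟨hz1, hz2, hz3⟩
  have hzR : R ≤ ‖z‖ := (le_max_left _ _).trans (hz1.trans (Complex.re_le_norm z))
  have h3 : ‖z‖ ^ 2 = z.re ^ 2 + z.im ^ 2 := by
    rw [← Complex.normSq_eq_norm_sq, Complex.normSq_apply]; ring
  have h4 : (((1 : ℝ) : ℂ) * z ^ 2 / 2 + Complex.I * s * z).re =
      (z.re ^ 2 - z.im ^ 2) / 2 - s * z.im := by
    simp [pow_two]
    ring
  have h5 : c * Real.exp (-1 - |s|) ≤ ‖gaussProfile P (1 : ℝ) (Complex.I * s) z‖ := by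
    rw [norm_gaussProfile, h4, h3]
    gcongr
    · exact hR z hzR
    · have : s * z.im ≤ |s| := by
        have := le_abs_self s
        nlinarith [abs_nonneg s]
      nlinarith
  exact h5

theorem magTrans_phaseRot (α : ℂ) (γ : ℝ) (v : ℂ → ℂ) :
    magTrans α (phaseRot γ v) = phaseRot γ (magTrans α v) := by
  funext z
  simp only [magTrans, phaseRot]
  ring

theorem gaussProfile_C_mul (c : ℂ) (P : ℂ[X]) (a b : ℂ) :
    gaussProfile (C c * P) a b = phaseRot (Complex.arg c) (gaussProfile (C (‖c‖ : ℂ) * P) a b) := by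
  funext z
  simp only [gaussProfile, phaseRot, eval_mul, eval_C]
  have : c = ‖c‖ * Complex.exp (Complex.I * Complex.arg c) := by
    rw [mul_comm Complex.I, Complex.norm_mul_exp_arg_mul_I]
  conv_lhs => rw [this]
  ring

/-- Profiles with finitely many zeros. -/
theorem IsProfile.classification {lam mu : ℝ} {v : ℂ → ℂ} (h : IsProfile lam mu v)
    (hz : HasFinitelyManyZeros v) :
    (∃ (Q : ℂ[X]) (b : ℂ), Q ≠ 0 ∧ v = magTrans (-conj b) (gaussProfile Q 0 0)) ∨
      ∃ (θ : ℝ) (c : ℂ), c ≠ 0 ∧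
        ((∃ s : ℝ, v = phaseRot 0 (spaceRot θ (gaussProfile (C c) (1 : ℝ) (Complex.I * s))) ∧
            mu = 0 ∧ lam = ‖c‖ ^ 2 * Real.exp (s ^ 2 / 2) / Real.sqrt 2) ∨
          ∃ r : ℝ, v = phaseRot 0 (spaceRot θ (gaussProfile (C c * (X + C (Complex.I * r)))
              (1 : ℝ) (Complex.I * (0 : ℝ)))) ∧
            mu = ‖c‖ ^ 2 / Real.sqrt 2 ∧ lam = 1 / Real.sqrt 2 * (3 / 2 + r ^ 2) * ‖c‖ ^ 2) := by
  obtain ⟨C₀, N, hC, hb⟩ := exists_polynomial_bound h.1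
  obtain ⟨f, hf, hvf⟩ := h.1.1
  have hfin : {z | f z = 0}.Finite := hz.subset fun z (hz : f z = 0) => by
    change v z = 0
    rw [hvf, hz, mul_zero]
  have hfb : ∀ z, ‖f z‖ ≤ C₀ * (1 + ‖z‖) ^ N * Real.exp (‖z‖ ^ 2 / 2) := by
    intro z
    have := hb z
    rw [hvf, norm_mul, Complex.norm_real, Real.norm_of_nonneg (Real.exp_pos _).le] at this
    have e : Real.exp (-‖z‖ ^ 2 / 2) * Real.exp (‖z‖ ^ 2 / 2) = 1 := by
      rw [← Real.exp_add, neg_div, neg_add_cancel, Real.exp_zero]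
    calc ‖f z‖ = Real.exp (-‖z‖ ^ 2 / 2) * ‖f z‖ * Real.exp (‖z‖ ^ 2 / 2) := by
          linear_combination -‖f z‖ * e
      _ ≤ _ := by gcongr
  obtain ⟨P, a, b, hP, hfP⟩ := exists_eq_polynomial_mul_exp hf hfin hC hfb
  have hv : v = gaussProfile P a b := by
    funext z
    rw [hvf, hfP, gaussProfile]
  by_cases ha : a = 0
  · left
    refine ⟨C (Complex.exp (b * conj b / 2)) * P.comp (X + C (conj b)), b, ?_, ?_⟩
    · refine mul_ne_zero (by simp [Complex.exp_ne_zero]) ?_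
      rwa [Ne, comp_X_add_C_eq_zero_iff]
    · rw [hv, ha, gaussProfile_eq_magTrans]
  · right
    obtain ⟨θ, P', b', hP', hrot⟩ := exists_rotation_gaussProfile hP a b
    have h1 := h.rot 0 θ
    have e : phaseRot 0 (spaceRot θ v) = gaussProfile P' (‖a‖ : ℝ) b' := by
      rw [← hrot, hv]
      funext z
      simp [phaseRot]
    have hvrot : v = phaseRot 0 (spaceRot (-θ) (gaussProfile P' (‖a‖ : ℝ) b')) := by
      have := rot_neg_rot 0 θ v
      rwa [e, neg_zero, eq_comm] at this
    rw [e] at h1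
    obtain ⟨ha1, c, hc, hs | hr⟩ := classification_of_pos (norm_pos_iff.2 ha) hP' h1
    · obtain ⟨s, hs, hPc, h2⟩ := hs
      refine ⟨-θ, c, hc, Or.inl ⟨s, ?_, h2⟩⟩
      rw [hvrot, ha1, hs, hPc]
    · obtain ⟨r, hr, hPc, h2⟩ := hr
      refine ⟨-θ, c, hc, Or.inr ⟨r, ?_, h2⟩⟩
      rw [hvrot, ha1, hr, hPc]
      simp

end LLL

end

/-! ### The explicit families -/

noncomputable section

namespace LLL

open scoped ComplexConjugate
open Polynomial

theorem phi_eq (n : ℕ) : phi n =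
    gaussProfile (C ((1 / Real.sqrt (Real.pi * n.factorial) : ℝ) : ℂ) * X ^ n) 0 0 := by
  funext z
  simp [phi, gaussProfile]
  ring

theorem phiShift_eq (n : ℕ) (α : ℂ) : phiShift n α = magTrans (-conj α)
    (gaussProfile (C ((1 / Real.sqrt (Real.pi * n.factorial) : ℝ) : ℂ) * X ^ n) 0 0) := by
  rw [phiShift, phi_eq]

theorem phiShift_apply (n : ℕ) (α z : ℂ) : phiShift n α z =
    ((1 / Real.sqrt (Real.pi * n.factorial) : ℝ) : ℂ) * (z - conj α) ^ n *
      Complex.exp (-((‖z‖ ^ 2 / 2 : ℝ) : ℂ) - ((‖α‖ ^ 2 / 2 : ℝ) : ℂ) + α * z) := by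
  rw [phiShift_eq, magTrans_gaussProfile, mul_conj_eq_norm_sq]
  simp only [eval_mul, eval_C, eval_pow, eval_X]
  rw [show (-((‖z‖ ^ 2 / 2 : ℝ) : ℂ) - ((‖α‖ ^ 2 / 2 : ℝ) : ℂ) + α * z) =
    ((-‖z‖ ^ 2 / 2 : ℝ) : ℂ) + (α * z - ((‖α‖ ^ 2 : ℝ) : ℂ) / 2) by push_cast; ring, Complex.exp_add,
    Complex.ofReal_exp]
  ring

theorem norm_one_div_sqrt {x : ℝ} (hx : 0 < x) :
    ‖((1 / Real.sqrt x : ℝ) : ℂ)‖ ^ 2 * x = 1 := by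
  rw [Complex.norm_real, Real.norm_eq_abs, sq_abs, div_pow, Real.sq_sqrt hx.le]
  field_simp

theorem norm_eq_one_div_sqrt {c : ℂ} {x : ℝ} (hx : 0 < x) (h : ‖c‖ ^ 2 * x = 1) :
    ‖c‖ = 1 / Real.sqrt x := by
  rw [eq_div_iff (Real.sqrt_pos.2 hx).ne', ← Real.sqrt_sq (norm_nonneg c),
    ← Real.sqrt_mul (sq_nonneg _), h, Real.sqrt_one]

theorem pi_mul_factorial_pos (n : ℕ) : 0 < Real.pi * n.factorial := by positivity

theorem phiFreq_eq {c : ℂ} {n : ℕ} (h : ‖c‖ ^ 2 * (Real.pi * n.factorial) = 1) :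
    ‖c‖ ^ 2 * ((2 * n).factorial : ℝ) / (2 * 2 ^ (2 * n) * n.factorial) = phiFreq n := by
  rw [eq_div_of_mul_eq (pi_mul_factorial_pos n).ne' h, phiFreq]
  field_simp
  ring

theorem psiFreq_eq {c : ℂ} {b : ℝ} (h : ‖c‖ ^ 2 * (Real.pi * (1 + b ^ 2)) = 1) :
    ‖c‖ ^ 2 / 2 * (1 + b ^ 2) - ‖c‖ ^ 2 / (8 * (1 + b ^ 2)) = psiFreq b := by
  rw [eq_div_of_mul_eq (by positivity) h, psiFreq]
  field_simp
  ring

theorem isProfile_phiShift (n : ℕ) (α : ℂ) : IsProfile (phiFreq n) 0 (phiShift n α) := by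
  have h := norm_one_div_sqrt (pi_mul_factorial_pos n)
  have hc : ((1 / Real.sqrt (Real.pi * n.factorial) : ℝ) : ℂ) ≠ 0 := by
    intro h0
    rw [h0] at h
    simp at h
  rw [phiShift_eq, isProfile_magTrans_iff α (natDegree_C_mul_X_pow_le _ n)]
  refine (isProfile_monomial_iff n hc (by simp)).2 ?_
  rw [phiFreq_eq h]
  simp

theorem hasConservedQuantities_phiShift (n : ℕ) (α : ℂ) : HasConservedQuantities (phiShift n α)
    (1 / (8 * Real.pi) * (((2 * n).factorial : ℝ) / (2 ^ (2 * n) * (n.factorial : ℝ) ^ 2)))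
    1 (n + ‖α‖ ^ 2) (conj α) := by
  rw [phiShift_eq]
  exact hasConservedQuantities_monomial α (norm_one_div_sqrt (pi_mul_factorial_pos n))

theorem phiShift_mem_fockSpace (n : ℕ) (α : ℂ) : phiShift n α ∈ fockSpace := by
  rw [phiShift_eq]
  exact magTrans_gaussProfile_mem_fockSpace _ _

theorem hasFinitelyManyZeros_phiShift (n : ℕ) (α : ℂ) : HasFinitelyManyZeros (phiShift n α) := by
  rw [phiShift_eq]
  refine (hasFinitelyManyZeros_gaussProfile (mul_ne_zero ?_ (pow_ne_zero _ X_ne_zero)) _ _).magTrans _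
  have : Real.sqrt (Real.pi * n.factorial) ≠ 0 := (Real.sqrt_pos.2 (pi_mul_factorial_pos n)).ne'
  rw [Ne, C_eq_zero]
  exact_mod_cast one_div_ne_zero this

theorem psi_eq (b : ℝ) : psi b = magTrans (-conj ((b / (1 + b ^ 2) : ℝ) : ℂ))
    (gaussProfile (C ((1 / Real.sqrt (Real.pi * (1 + b ^ 2)) : ℝ) : ℂ) * (X - C (b : ℂ))) 0 0) := by
  funext z
  have hb : (1 + b ^ 2 : ℝ) ≠ 0 := by positivity
  rw [magTrans_gaussProfile, psi, Complex.conj_ofReal]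
  simp only [eval_mul, eval_C, eval_sub, eval_X]
  have e1 : b * (2 + b ^ 2) / (1 + b ^ 2) = b / (1 + b ^ 2) + b := by
    field_simp
    ring
  rw [e1]
  set β := b / (1 + b ^ 2)
  rw [show Real.exp (-β ^ 2 / 2) / Real.sqrt (Real.pi * (1 + b ^ 2)) =
    Real.exp (-β ^ 2 / 2) * (1 / Real.sqrt (Real.pi * (1 + b ^ 2))) by ring]
  rw [show (β : ℂ) * z - β * β / 2 = β * z + ((-β ^ 2 / 2 : ℝ) : ℂ) by push_cast; ring, Complex.exp_add,
    Complex.exp_add, show -((‖z‖ ^ 2 / 2 : ℝ) : ℂ) = ((-‖z‖ ^ 2 / 2 : ℝ) : ℂ) by push_cast; ring,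
    ← Complex.ofReal_exp, ← Complex.ofReal_exp]
  push_cast
  ring

theorem hasConservedQuantities_psi (b : ℝ) : HasConservedQuantities (psi b)
    (1 / (8 * Real.pi) * (1 - 1 / (2 * (1 + b ^ 2) ^ 2))) 1 (1 / (1 + b ^ 2) ^ 2) 0 := by
  rw [psi_eq]
  exact hasConservedQuantities_linear (norm_one_div_sqrt (by positivity))

theorem psi_mem_fockSpace (b : ℝ) : psi b ∈ fockSpace := by
  rw [psi_eq]
  exact magTrans_gaussProfile_mem_fockSpace _ _

theorem one_div_sqrt_psi_ne_zero (b : ℝ) :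
    ((1 / Real.sqrt (Real.pi * (1 + b ^ 2)) : ℝ) : ℂ) ≠ 0 := by
  have : Real.sqrt (Real.pi * (1 + b ^ 2)) ≠ 0 := (Real.sqrt_pos.2 (by positivity)).ne'
  exact_mod_cast one_div_ne_zero this

theorem hasFinitelyManyZeros_psi (b : ℝ) : HasFinitelyManyZeros (psi b) := by
  rw [psi_eq]
  refine (hasFinitelyManyZeros_gaussProfile (mul_ne_zero ?_ (X_sub_C_ne_zero _)) _ _).magTrans _
  rw [Ne, C_eq_zero]
  exact one_div_sqrt_psi_ne_zero b

theorem isProfile_psi (b : ℝ) : IsProfile (psiFreq b) (-1 / (8 * Real.pi)) (psi b) := by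
  have h := norm_one_div_sqrt (x := Real.pi * (1 + b ^ 2)) (by positivity)
  rw [psi_eq, isProfile_magTrans_iff _ (n := 1)
    ((natDegree_C_mul_le _ _).trans (natDegree_X_sub_C_le _))]
  refine (linPart_linear_iff (one_div_sqrt_psi_ne_zero b)).2 ?_
  rw [eq_div_of_mul_eq (by positivity) h, psiFreq, Complex.conj_ofReal, Complex.conj_ofReal]
  have hb : (1 + b ^ 2 : ℂ) ≠ 0 := by
    have : (1 + b ^ 2 : ℝ) ≠ 0 := by positivity
    exact_mod_cast this
  have hπ : (Real.pi : ℂ) ≠ 0 := by exact_mod_cast Real.pi_ne_zero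
  push_cast
  refine ⟨?_, ?_, ?_⟩
  · field_simp
  · field_simp
    ring
  · field_simp
    ring

theorem expProfile_eq (A s : ℝ) :
    expProfile A s = gaussProfile (C (A : ℂ)) (1 : ℝ) (Complex.I * s) := by
  funext z
  rw [expProfile, gaussProfile, eval_C, add_assoc, Complex.exp_add, Complex.ofReal_exp]
  push_cast
  rw [one_mul, neg_div]
  ring

theorem linProfile_eq (A r : ℝ) : linProfile A r =
    gaussProfile (C (A : ℂ) * (X + C (Complex.I * r))) (1 : ℝ) (Complex.I * (0 : ℝ)) := by
  funext z
  rw [linProfile, gaussProfile, eval_mul, eval_add, eval_C, eval_C, eval_X, Complex.exp_add,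
    Complex.ofReal_exp]
  push_cast
  rw [one_mul, neg_div, mul_zero, zero_mul, add_zero]
  ring

theorem isProfile_expProfile (A s : ℝ) :
    IsProfile (A ^ 2 * Real.exp (s ^ 2 / 2) / Real.sqrt 2) 0 (expProfile A s) := by
  rw [expProfile_eq, show C (A : ℂ) = C 0 * X + C (A : ℂ) by simp, isProfile_linear_iff]
  intro z
  simp
  ring

theorem isProfile_linProfile (A r : ℝ) : IsProfile (1 / Real.sqrt 2 * (3 / 2 + r ^ 2) * A ^ 2)
    (A ^ 2 / Real.sqrt 2) (linProfile A r) := by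
  rw [linProfile_eq, show C (A : ℂ) * (X + C (Complex.I * r)) =
    C (A : ℂ) * X + C (A * (Complex.I * r)) by simp only [C_mul]; ring, isProfile_linear_iff]
  intro z
  simp
  ring_nf
  simp only [Complex.I_sq, show Complex.I ^ 3 = -Complex.I by rw [pow_succ, Complex.I_sq]; ring]
  ring

theorem gaussProfile_one_C_mul_notMem {c : ℂ} (hc : c ≠ 0) {P : ℂ[X]} (hP : P ≠ 0) (s : ℝ) :
    gaussProfile (C c * P) (1 : ℝ) (Complex.I * s) ∉ fockSpace ∧
      HasFinitelyManyZeros (gaussProfile (C c * P) (1 : ℝ) (Complex.I * s)) := by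
  have h : C c * P ≠ 0 := mul_ne_zero (by simpa using hc) hP
  exact ⟨gaussProfile_one_notMem_fockSpace h s, hasFinitelyManyZeros_gaussProfile h _ _⟩

theorem expProfile_notMem {A : ℝ} (hA : A ≠ 0) (s : ℝ) :
    expProfile A s ∉ fockSpace ∧ HasFinitelyManyZeros (expProfile A s) := by
  have := gaussProfile_one_C_mul_notMem (c := A) (by exact_mod_cast hA) one_ne_zero s
  rwa [mul_one, ← expProfile_eq] at this

theorem linProfile_notMem {A : ℝ} (hA : A ≠ 0) (r : ℝ) :
    linProfile A r ∉ fockSpace ∧ HasFinitelyManyZeros (linProfile A r) := by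
  have := gaussProfile_one_C_mul_notMem (c := A) (by exact_mod_cast hA)
    (X_add_C_ne_zero (Complex.I * r)) 0
  rwa [← linProfile_eq] at this

theorem gaussProfile_C_eq_expProfile (c : ℂ) (s : ℝ) :
    gaussProfile (C c) (1 : ℝ) (Complex.I * s) = phaseRot (Complex.arg c) (expProfile ‖c‖ s) := by
  have := gaussProfile_C_mul c 1 (1 : ℝ) (Complex.I * s)
  rw [mul_one, mul_one] at this
  rw [this, expProfile_eq]

theorem gaussProfile_eq_linProfile (c : ℂ) (r : ℝ) :
    gaussProfile (C c * (X + C (Complex.I * r))) (1 : ℝ) (Complex.I * (0 : ℝ)) =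
      phaseRot (Complex.arg c) (linProfile ‖c‖ r) := by
  rw [gaussProfile_C_mul, linProfile_eq]

theorem rot_phaseRot (θ γ : ℝ) (v : ℂ → ℂ) :
    phaseRot 0 (spaceRot θ (phaseRot γ v)) = phaseRot γ (spaceRot θ v) := by
  funext z
  simp [phaseRot, spaceRot]

theorem spaceRot_zero (v : ℂ → ℂ) : spaceRot 0 v = v := by
  funext z
  simp [spaceRot]

theorem magTrans_monomial_eq {c : ℂ} {n : ℕ} (h : ‖c‖ ^ 2 * (Real.pi * n.factorial) = 1) (b : ℂ) :
    magTrans (-conj b) (gaussProfile (C c * X ^ n) 0 0) =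
      phaseRot (Complex.arg c) (spaceRot 0 (phiShift n b)) := by
  rw [gaussProfile_C_mul, magTrans_phaseRot, spaceRot_zero, phiShift_eq,
    norm_eq_one_div_sqrt (pi_mul_factorial_pos n) h]

/-- Rotating space by `-arg β` makes the root `β` and the translation real and nonnegative; the
linear factor then releases the phase `e^{i arg β}`, added to that of `c`. -/
theorem magTrans_linear_eq {c β : ℂ} (h : ‖c‖ ^ 2 * (Real.pi * (1 + ‖β‖ ^ 2)) = 1) :
    magTrans (-conj (conj β / ((1 + ‖β‖ ^ 2 : ℝ) : ℂ))) (gaussProfile (C c * (X - C β)) 0 0) =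
      phaseRot (Complex.arg c + Complex.arg β) (spaceRot (-Complex.arg β) (psi ‖β‖)) := by
  rw [gaussProfile_C_mul, magTrans_phaseRot, norm_eq_one_div_sqrt (by positivity) h, psi_eq]
  funext z
  set ρ := ‖β‖ with hρ
  set κ := 1 / Real.sqrt (Real.pi * (1 + ρ ^ 2))
  set E := Complex.exp (Complex.I * Complex.arg β) with hE
  have hE' : Complex.exp (Complex.I * (-Complex.arg β : ℝ)) = E⁻¹ := by
    rw [hE, ← Complex.exp_neg]
    push_cast
    ring_nf
  have hE0 : E ≠ 0 := Complex.exp_ne_zero _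
  have hEc : conj E = E⁻¹ := by
    rw [← hE', hE, ← Complex.exp_conj]
    simp
  have hβ : β = ρ * E := by
    rw [hE, hρ, mul_comm Complex.I, Complex.norm_mul_exp_arg_mul_I]
  have hnE : ‖E⁻¹ * z‖ = ‖z‖ := by rw [← hE', norm_spaceRot_arg]
  have hsum : Complex.exp (Complex.I * ((Complex.arg c + Complex.arg β : ℝ) : ℂ)) =
      Complex.exp (Complex.I * Complex.arg c) * E := by
    rw [hE, ← Complex.exp_add]
    push_cast
    ring_nf
  simp only [phaseRot, spaceRot, magTrans_gaussProfile, hE', hnE, hsum]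
  rw [hβ]
  simp only [eval_mul, eval_C, eval_sub, eval_X, map_mul, map_div₀, Complex.conj_ofReal, hEc, map_inv₀,
    inv_inv]
  have e1 : (ρ : ℂ) * E⁻¹ / ((1 + ρ ^ 2 : ℝ) : ℂ) * z -
      ρ * E⁻¹ / ((1 + ρ ^ 2 : ℝ) : ℂ) * (ρ * E / ((1 + ρ ^ 2 : ℝ) : ℂ)) / 2 =
      ((ρ / (1 + ρ ^ 2) : ℝ) : ℂ) * (E⁻¹ * z) -
        ((ρ / (1 + ρ ^ 2) : ℝ) : ℂ) * ((ρ / (1 + ρ ^ 2) : ℝ) : ℂ) / 2 := by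
    push_cast
    field_simp
  have e2 : z - ρ * E / ((1 + ρ ^ 2 : ℝ) : ℂ) - ρ * E =
      E * (E⁻¹ * z - ((ρ / (1 + ρ ^ 2) : ℝ) : ℂ) - ρ) := by
    push_cast
    field_simp
  rw [e1, e2]
  ring

/-- On a centred monomial a space rotation is a phase `e^{-inμt}`, so any `μ` is absorbed into `λ`.
-/
theorem rotatingWave_monomial (lam mu : ℝ) (c : ℂ) (n : ℕ) :
    rotatingWave lam mu (magTrans (-conj 0) (gaussProfile (C c * X ^ n) 0 0)) =
      rotatingWave (lam + n * mu) 0 (magTrans (-conj 0) (gaussProfile (C c * X ^ n) 0 0)) := by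
  funext t z
  have hn : ‖Complex.exp (-Complex.I * mu * t) * z‖ = ‖z‖ := by
    have := norm_spaceRot_arg (-(mu * t)) z
    convert this using 4
    push_cast
    ring
  rw [rotatingWave_mu_zero, rotatingWave, magTrans_gaussProfile, magTrans_gaussProfile, hn]
  simp only [eval_mul, eval_C, eval_pow, eval_X, map_zero, sub_zero, zero_mul, mul_zero, zero_div,
    Complex.exp_zero, mul_one, mul_pow, ← Complex.exp_nat_mul]
  rw [show -Complex.I * ((lam + n * mu : ℝ) : ℂ) * t =
    -Complex.I * lam * t + n * (-Complex.I * mu * t) by push_cast; ring, Complex.exp_add]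
  ring

end LLL

end

/-! ### Assembling the four classifications -/

noncomputable section

namespace LLL

open scoped ComplexConjugate
open Polynomial

theorem isMPStationaryWave_of_isMStationaryWave {u : ℝ → ℂ → ℂ} (h : IsMStationaryWave u) :
    IsMPStationaryWave u := by
  obtain ⟨lam, v, hv, rfl⟩ := (isMStationaryWave_iff u).1 h
  exact (isMPStationaryWave_iff _).2 ⟨lam, 0, v, hv, rfl⟩

theorem norm_sq_mul_of_mass_monomial {b c : ℂ} {n : ℕ}
    (h : mass (magTrans (-conj b) (gaussProfile (C c * X ^ n) 0 0)) = 1) :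
    ‖c‖ ^ 2 * (Real.pi * n.factorial) = 1 := by
  have h1 := mass_magTrans_gaussProfile (C c * X ^ n) b
  rw [h, gaussInner_monomial _ _ _ le_rfl, coeff_C_mul_X_pow, if_pos rfl, mul_conj_eq_norm_sq] at h1
  simp only [one_pow, div_one] at h1
  exact_mod_cast h1.symm

theorem norm_sq_mul_of_mass_linear {b c β : ℂ}
    (h : mass (magTrans (-conj b) (gaussProfile (C c * (X - C β)) 0 0)) = 1) :
    ‖c‖ ^ 2 * (Real.pi * (1 + ‖β‖ ^ 2)) = 1 := by
  have h1 := mass_magTrans_gaussProfile (C c * (X - C β)) b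
  rw [h, gaussInner_linear] at h1
  simp at h1
  have h2 : ((‖c‖ ^ 2 : ℝ) : ℂ) * (Real.pi * (1 + ((‖β‖ ^ 2 : ℝ) : ℂ))) = 1 := by
    rw [← mul_conj_eq_norm_sq, ← mul_conj_eq_norm_sq]
    linear_combination -h1
  exact_mod_cast h2

/-- Profiles of finite mass with finitely many zeros. -/
theorem IsProfile.of_mem_fockSpace {lam mu : ℝ} {v : ℂ → ℂ} (h : IsProfile lam mu v)
    (hz : HasFinitelyManyZeros v) (hv : v ∈ fockSpace) (hm : mass v = 1) :
    (∃ (n : ℕ) (α : ℂ) (γ : ℝ), rotatingWave lam mu v =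
        rotatingWave (phiFreq n) 0 (phaseRot γ (spaceRot 0 (phiShift n α)))) ∨
      ∃ b γ θ : ℝ, 0 ≤ b ∧ mu = -1 / (8 * Real.pi) ∧ lam = psiFreq b ∧
        v = phaseRot γ (spaceRot θ (psi b)) := by
  rcases h.classification hz with ⟨Q, b, hQ, rfl⟩ | ⟨θ, c, hc, ⟨s, rfl, -⟩ | ⟨r, rfl, -⟩⟩
  · obtain ⟨c, hc, ⟨n, rfl, hb, hlam⟩ | ⟨β, hβ, rfl, rfl, hmu, hlam⟩⟩ := classification_of_zero hQ h
    · left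
      have hcn := norm_sq_mul_of_mass_monomial hm
      rw [phiFreq_eq hcn] at hlam
      refine ⟨n, b, Complex.arg c, ?_⟩
      rw [← magTrans_monomial_eq hcn, ← hlam]
      -- Either the profile does not rotate, or it is centred and `μ` is undetermined. Hence the
      -- conclusion equates waves instead of asserting `μ = 0`.
      rcases mul_eq_zero.1 hb with h0 | rfl
      · have : mu = 0 := by exact_mod_cast h0
        rw [this, mul_zero, add_zero]
      · exact rotatingWave_monomial _ _ _ _
    · right
      have hcβ := norm_sq_mul_of_mass_linear hm
      rw [psiFreq_eq hcβ] at hlam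
      refine ⟨‖β‖, _, _, norm_nonneg _, ?_, hlam, magTrans_linear_eq hcβ⟩
      rw [hmu, eq_div_of_mul_eq (by positivity) hcβ]
      field_simp
  · have h' := h.rot 0 (-θ)
    have e := rot_neg_rot 0 θ (gaussProfile (C c) (1 : ℝ) (Complex.I * s))
    rw [neg_zero] at e
    rw [e] at h'
    rw [rot_mem_fockSpace_iff 0 θ h'.1] at hv
    exact absurd hv (gaussProfile_one_notMem_fockSpace (by simpa using hc) s)
  · have h' := h.rot 0 (-θ)
    have e := rot_neg_rot 0 θ (gaussProfile (C c * (X + C (Complex.I * r))) (1 : ℝ)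
      (Complex.I * (0 : ℝ)))
    rw [neg_zero] at e
    rw [e] at h'
    rw [rot_mem_fockSpace_iff 0 θ h'.1] at hv
    exact absurd hv (gaussProfile_one_C_mul_notMem hc (X_add_C_ne_zero _) 0).1

/-- Profiles of infinite mass with finitely many zeros. -/
theorem IsProfile.of_notMem_fockSpace {lam mu : ℝ} {v : ℂ → ℂ} (h : IsProfile lam mu v)
    (hz : HasFinitelyManyZeros v) (hv : v ∉ fockSpace) : ∃ A γ θ : ℝ, A ≠ 0 ∧
      ((∃ s : ℝ, mu = 0 ∧ lam = A ^ 2 * Real.exp (s ^ 2 / 2) / Real.sqrt 2 ∧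
          v = phaseRot γ (spaceRot θ (expProfile A s))) ∨
        ∃ r : ℝ, mu = A ^ 2 / Real.sqrt 2 ∧ lam = 1 / Real.sqrt 2 * (3 / 2 + r ^ 2) * A ^ 2 ∧
          v = phaseRot γ (spaceRot θ (linProfile A r))) := by
  rcases h.classification hz with ⟨Q, b, -, rfl⟩ | ⟨θ, c, hc, hs⟩
  · exact absurd (magTrans_gaussProfile_mem_fockSpace Q b) hv
  · refine ⟨‖c‖, Complex.arg c, θ, norm_ne_zero_iff.2 hc, ?_⟩
    rcases hs with ⟨s, hvs, hmu, hlam⟩ | ⟨r, hvr, hmu, hlam⟩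
    · refine Or.inl ⟨s, hmu, hlam, ?_⟩
      rw [hvs, gaussProfile_C_eq_expProfile, rot_phaseRot]
    · refine Or.inr ⟨r, hmu, hlam, ?_⟩
      rw [hvr, gaussProfile_eq_linProfile, rot_phaseRot]

theorem mStationary_fock_iff (u : ℝ → ℂ → ℂ) :
    (IsMStationaryWave u ∧ u 0 ∈ fockSpace ∧ HasFinitelyManyZeros (u 0) ∧ mass (u 0) = 1) ↔
      ∃ (n : ℕ) (α : ℂ), EqModRotations u (rotatingWave (phiFreq n) 0 (phiShift n α)) := by
  simp_rw [isMStationaryWave_iff, eqModRotations_iff]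
  constructor
  · rintro ⟨⟨lam, v, hv, rfl⟩, hF, hz, hm⟩
    rw [rotatingWave_zero] at hF hz hm
    rcases hv.of_mem_fockSpace hz hF hm with ⟨n, α, γ, h⟩ | ⟨b, γ, θ, -, h, -⟩
    · exact ⟨n, α, γ, 0, h⟩
    -- An `M`-wave is presented with `μ = 0`, whereas the `ψ_b` require `μ = -1/(8π)`.
    · have := Real.pi_pos
      exact absurd h.symm (div_ne_zero (by norm_num) (by positivity))
  · rintro ⟨n, α, γ, θ, rfl⟩
    have h := isProfile_phiShift n α
    rw [rotatingWave_zero, rot_mem_fockSpace_iff γ θ h.1, mass_rot]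
    exact ⟨⟨_, _, h.rot γ θ, rfl⟩, phiShift_mem_fockSpace n α,
      (hasFinitelyManyZeros_phiShift n α).rot γ θ, (hasConservedQuantities_phiShift n α).mass_eq⟩

theorem mpStationary_fock_iff (u : ℝ → ℂ → ℂ) :
    (IsMPStationaryWave u ∧ u 0 ∈ fockSpace ∧ HasFinitelyManyZeros (u 0) ∧ mass (u 0) = 1) ↔
      ((∃ (n : ℕ) (α : ℂ), EqModRotations u (rotatingWave (phiFreq n) 0 (phiShift n α))) ∨
        ∃ b : ℝ, 0 ≤ b ∧
          EqModRotations u (rotatingWave (psiFreq b) (-1 / (8 * Real.pi)) (psi b))) := by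
  constructor
  · rintro ⟨hu, hF, hz, hm⟩
    obtain ⟨lam, mu, v, hv, rfl⟩ := (isMPStationaryWave_iff u).1 hu
    rw [rotatingWave_zero] at hF hz hm
    simp_rw [eqModRotations_iff]
    rcases hv.of_mem_fockSpace hz hF hm with ⟨n, α, γ, h⟩ | ⟨b, γ, θ, hb, rfl, rfl, rfl⟩
    · exact Or.inl ⟨n, α, γ, 0, h⟩
    · exact Or.inr ⟨b, hb, γ, θ, rfl⟩
  · rintro (h | ⟨b, -, h⟩)
    · obtain ⟨h1, h2⟩ := (mStationary_fock_iff u).2 h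
      exact ⟨isMPStationaryWave_of_isMStationaryWave h1, h2⟩
    · obtain ⟨γ, θ, rfl⟩ := (eqModRotations_iff _ _ _ _).1 h
      have h := isProfile_psi b
      rw [rotatingWave_zero, rot_mem_fockSpace_iff γ θ h.1, mass_rot]
      exact ⟨(isMPStationaryWave_iff _).2 ⟨_, _, _, h.rot γ θ, rfl⟩, psi_mem_fockSpace b,
        (hasFinitelyManyZeros_psi b).rot γ θ, (hasConservedQuantities_psi b).mass_eq⟩

theorem mStationary_notMem_fock_iff (u : ℝ → ℂ → ℂ) :
    (IsMStationaryWave u ∧ u 0 ∉ fockSpace ∧ HasFinitelyManyZeros (u 0)) ↔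
      ∃ A s : ℝ, A ≠ 0 ∧ EqModRotations u
        (rotatingWave (A ^ 2 * Real.exp (s ^ 2 / 2) / Real.sqrt 2) 0 (expProfile A s)) := by
  simp_rw [isMStationaryWave_iff, eqModRotations_iff]
  constructor
  · rintro ⟨⟨lam, v, hv, rfl⟩, hF, hz⟩
    rw [rotatingWave_zero] at hF hz
    obtain ⟨A, γ, θ, hA, ⟨s, -, rfl, rfl⟩ | ⟨r, hmu, -⟩⟩ := hv.of_notMem_fockSpace hz hF
    · exact ⟨A, s, hA, γ, θ, rfl⟩
    -- The linear family rotates at the nonzero speed `A² / √2`, so it contributes no profile with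
    -- `μ = 0`.
    · exact absurd hmu.symm (by positivity)
  · rintro ⟨A, s, hA, γ, θ, rfl⟩
    have h := isProfile_expProfile A s
    rw [rotatingWave_zero, rot_mem_fockSpace_iff γ θ h.1]
    exact ⟨⟨_, _, h.rot γ θ, rfl⟩, (expProfile_notMem hA s).1, (expProfile_notMem hA s).2.rot γ θ⟩

theorem mpStationary_notMem_fock_iff (u : ℝ → ℂ → ℂ) :
    (IsMPStationaryWave u ∧ u 0 ∉ fockSpace ∧ HasFinitelyManyZeros (u 0)) ↔
      ((∃ A s : ℝ, A ≠ 0 ∧ EqModRotations u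
          (rotatingWave (A ^ 2 * Real.exp (s ^ 2 / 2) / Real.sqrt 2) 0 (expProfile A s))) ∨
        ∃ A r : ℝ, A ≠ 0 ∧ EqModRotations u
          (rotatingWave (1 / Real.sqrt 2 * (3 / 2 + r ^ 2) * A ^ 2) (A ^ 2 / Real.sqrt 2)
            (linProfile A r))) := by
  constructor
  · rintro ⟨hu, hF, hz⟩
    obtain ⟨lam, mu, v, hv, rfl⟩ := (isMPStationaryWave_iff u).1 hu
    rw [rotatingWave_zero] at hF hz
    simp_rw [eqModRotations_iff]
    obtain ⟨A, γ, θ, hA, ⟨s, rfl, rfl, rfl⟩ | ⟨r, rfl, rfl, rfl⟩⟩ := hv.of_notMem_fockSpace hz hF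
    · exact Or.inl ⟨A, s, hA, γ, θ, rfl⟩
    · exact Or.inr ⟨A, r, hA, γ, θ, rfl⟩
  · rintro (h | ⟨A, r, hA, h⟩)
    · obtain ⟨h1, h2⟩ := (mStationary_notMem_fock_iff u).2 h
      exact ⟨isMPStationaryWave_of_isMStationaryWave h1, h2⟩
    · obtain ⟨γ, θ, rfl⟩ := (eqModRotations_iff _ _ _ _).1 h
      have h := isProfile_linProfile A r
      rw [rotatingWave_zero, rot_mem_fockSpace_iff γ θ h.1]
      exact ⟨(isMPStationaryWave_iff _).2 ⟨_, _, _, h.rot γ θ, rfl⟩, (linProfile_notMem hA r).1,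
        (linProfile_notMem hA r).2.rot γ θ⟩

end LLL

end

theorem mainTheorem1 :
    -- (i) `M`-stationary waves in `ℰ` with finitely many zeros and unit mass
    ((∀ u : ℝ → ℂ → ℂ,
        (LLL.IsMStationaryWave u ∧ u 0 ∈ LLL.fockSpace ∧ LLL.HasFinitelyManyZeros (u 0) ∧
            LLL.mass (u 0) = 1) ↔
          ∃ (n : ℕ) (α : ℂ), LLL.EqModRotations u
            (LLL.rotatingWave (LLL.phiFreq n) 0 (LLL.phiShift n α))) ∧
      (∀ (n : ℕ) (α z : ℂ), LLL.phiShift n α z =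
        ((1 / Real.sqrt (Real.pi * n.factorial) : ℝ) : ℂ) * (z - (starRingEnd ℂ) α) ^ n *
          Complex.exp (-((‖z‖ ^ 2 / 2 : ℝ) : ℂ) - ((‖α‖ ^ 2 / 2 : ℝ) : ℂ) + α * z)) ∧
      (∀ (n : ℕ) (α : ℂ), LLL.HasConservedQuantities (LLL.phiShift n α)
        (1 / (8 * Real.pi) *
          (((2 * n).factorial : ℝ) / (2 ^ (2 * n) * (n.factorial : ℝ) ^ 2)))
        1 (n + ‖α‖ ^ 2) ((starRingEnd ℂ) α))) ∧
    -- (ii) `MP`-stationary waves in `ℰ` with finitely many zeros and unit mass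
    ((∀ u : ℝ → ℂ → ℂ,
        (LLL.IsMPStationaryWave u ∧ u 0 ∈ LLL.fockSpace ∧ LLL.HasFinitelyManyZeros (u 0) ∧
            LLL.mass (u 0) = 1) ↔
          ((∃ (n : ℕ) (α : ℂ), LLL.EqModRotations u
              (LLL.rotatingWave (LLL.phiFreq n) 0 (LLL.phiShift n α))) ∨
            ∃ b : ℝ, 0 ≤ b ∧ LLL.EqModRotations u
              (LLL.rotatingWave (LLL.psiFreq b) (-1 / (8 * Real.pi)) (LLL.psi b)))) ∧
      (∀ b : ℝ, 0 ≤ b → LLL.HasConservedQuantities (LLL.psi b)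
        (1 / (8 * Real.pi) * (1 - 1 / (2 * (1 + b ^ 2) ^ 2)))
        1 (1 / (1 + b ^ 2) ^ 2) 0)) ∧
    -- (iii) `M`-stationary waves in `ℰ̃ \ ℰ` with finitely many zeros
    (∀ u : ℝ → ℂ → ℂ,
      (LLL.IsMStationaryWave u ∧ u 0 ∉ LLL.fockSpace ∧ LLL.HasFinitelyManyZeros (u 0)) ↔
        ∃ A s : ℝ, A ≠ 0 ∧ LLL.EqModRotations u
          (LLL.rotatingWave (A ^ 2 * Real.exp (s ^ 2 / 2) / Real.sqrt 2) 0
            (LLL.expProfile A s))) ∧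
    -- (iv) `MP`-stationary waves in `ℰ̃ \ ℰ` with finitely many zeros
    (∀ u : ℝ → ℂ → ℂ,
      (LLL.IsMPStationaryWave u ∧ u 0 ∉ LLL.fockSpace ∧ LLL.HasFinitelyManyZeros (u 0)) ↔
        ((∃ A s : ℝ, A ≠ 0 ∧ LLL.EqModRotations u
            (LLL.rotatingWave (A ^ 2 * Real.exp (s ^ 2 / 2) / Real.sqrt 2) 0
              (LLL.expProfile A s))) ∨
          ∃ A r : ℝ, A ≠ 0 ∧ LLL.EqModRotations u
            (LLL.rotatingWave (1 / Real.sqrt 2 * (3 / 2 + r ^ 2) * A ^ 2)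
              (A ^ 2 / Real.sqrt 2) (LLL.linProfile A r)))) :=
  ⟨⟨LLL.mStationary_fock_iff, LLL.phiShift_apply, LLL.hasConservedQuantities_phiShift⟩,
    ⟨LLL.mpStationary_fock_iff, fun b _ => LLL.hasConservedQuantities_psi b⟩,
    LLL.mStationary_notMem_fock_iff, LLL.mpStationary_notMem_fock_iff⟩
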